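/- All schemes are quasi-projective over $\mathbb{C}$ unless stated otherwise. Let $Y$ be a primitive double curve: a Cohen–Macaulay scheme whose reduced subscheme $C=Y_{red}$ is a smooth irreducible projective curve, every closed point of which has a neighbourhood that can be embedded in a smooth surface, and such that the ideal sheaf $\mathcal I_{C,Y}$ satisfies $\mathcal I_{C,Y}\neq 0$, $\mathcal I_{C,Y}^2=0$. Let $S$ be a smooth connected curve, $P\in S$ a closed point, and $\pi:\mathcal C\to S$ a maximal reducible deformation of $Y$, that is: (i) $\mathcal C$ is reduced with exactly two irreducible components $\mathcal C_1,\mathcal C_2$; (ii) $\pi^{-1}(P)\simeq Y$, so that $C$ is viewed as a curve in $\mathcal C$; (iii) for $i=1,2$, the restriction $\pi_i:\mathcal C_i\to S$ of $\pi$ is a flat family of smooth irreducible projective curves, and $\pi_i^{-1}(P)=C$; (iv) for every closed point $z\neq P$ of $S$, the fibre $\mathcal C_z$ is reduced and its components $\mathcal C_{1,z},\mathcal C_{2,z}$ meet transversally (possibly nowhere), i.e. their scheme-theoretic intersection consists of reduced points. Let $\mathcal Z\subset\mathcal C$ be the closure, with its reduced structure, of the locus of the intersection points of $\mathcal C_{1,z}$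 and $\mathcal C_{2,z}$, $z\neq P$. Let $t$ be a generator of the maximal ideal of $\mathcal O_{S,P}$; we also denote by $t$ its pull-backs $(t,t)\in\mathcal O_{\mathcal C,x}\subset\mathcal O_{\mathcal C_1,x}\times\mathcal O_{\mathcal C_2,x}$. Then there is a unique integer $p>0$ such that, for every closed point $x\in C$, the ideal $\mathcal I_{C,\mathcal C,x}$ of $C$ in $\mathcal C$ is generated by $t$ and by an element $(t^p\lambda_1,0)\in\mathcal O_{\mathcal C,x}$ with $\lambda_1\in\mathcal O_{\mathcal C_1,x}$ not divisible by $t$. Let $C^{(p)}\subset\mathcal C_1\cap\mathcal C_2$ be the closed subscheme whose ideal sheaf in $\mathcal C$ is generated by the ideal sheaves of $\mathcal C_1$ and $\mathcal C_2$ and by the $p$-th power of the ideal sheaf of $\pi^{-1}(P)$ (it is the $p$-th infinitesimal neighbourhood of $C$ in $\mathcal C_1$ and in $\mathcal C_2$). Let $\eta:\mathcal D\to\mathcal C$ be the associated fragmented deformation, with its canonical morphism: $\mathcal D$ is the gluing of $\mathcal C_1$ and $\mathcal C_2$ along $C^{(p)}$, i.e. the relative spectrum over $\mathcal C$ of the sheaf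 of algebras $\{(\alpha,\beta)\in\mathcal O_{\mathcal C_1}\times\mathcal O_{\mathcal C_2}\ ;\ \alpha_{|C^{(p)}}=\beta_{|C^{(p)}}\}$ (so that at a closed point $x\in C$ it is $\{(\alpha,\beta)\ ;\ \alpha\equiv\beta \bmod t^p\}$, and outside $C$ it is $\mathcal O_{\mathcal C_1}\times\mathcal O_{\mathcal C_2}$). Then $\eta$ is the blowing-up of $\mathcal C$ along $\mathcal Z$: the ideal sheaf $\eta^{-1}(\mathcal I_{\mathcal Z,\mathcal C})\mathcal O_{\mathcal D}$ is invertible, and every morphism of schemes $f:T\to\mathcal C$ such that $f^{-1}(\mathcal I_{\mathcal Z,\mathcal C})\mathcal O_T$ is invertible factors uniquely through $\eta$. -/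

import Mathlib

open CategoryTheory Limits AlgebraicGeometry

noncomputable section

namespace ReducibleDeformation

/-! ### Varieties over the complex numbers -/

/-- The base scheme `Spec ℂ`. -/
abbrev SpecC : Scheme.{0} := Spec (CommRingCat.of ℂ)

attribute [local instance] MvPolynomial.gradedAlgebra

/-- Complex projective `n`-space, as `Proj ℂ[x₀, …, xₙ]`. -/
def projectiveSpace (n : ℕ) : Scheme.{0} :=
  Proj (MvPolynomial.homogeneousSubmodule (Fin (n + 1)) ℂ)

/-- The structure morphism of complex projective `n`-space. -/
def projectiveSpaceStr (n : ℕ) : projectiveSpace n ⟶ SpecC :=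
  Proj.toSpecZero (MvPolynomial.homogeneousSubmodule (Fin (n + 1)) ℂ) ≫
    Spec.map (CommRingCat.ofHom
      (algebraMap ℂ (MvPolynomial.homogeneousSubmodule (Fin (n + 1)) ℂ 0)))

/-- An algebraic variety: a quasi-projective scheme over `ℂ` (not necessarily reduced or
irreducible), i.e. a `ℂ`-scheme that is isomorphic to a locally closed subscheme of some
projective space. -/
def IsVariety {X : Scheme.{0}} (sX : X ⟶ SpecC) : Prop :=
  ∃ (n : ℕ) (i : X ⟶ projectiveSpace n), IsImmersion i ∧ i ≫ projectiveSpaceStr n = sX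

/-- A projective scheme over `ℂ`. -/
def IsProjectiveVariety {X : Scheme.{0}} (sX : X ⟶ SpecC) : Prop :=
  ∃ (n : ℕ) (i : X ⟶ projectiveSpace n), IsClosedImmersion i ∧ i ≫ projectiveSpaceStr n = sX

/-- A smooth connected curve over `ℂ`. -/
structure IsSmoothConnectedCurve {X : Scheme.{0}} (sX : X ⟶ SpecC) : Prop where
  variety : IsVariety sX
  smooth : SmoothOfRelativeDimension 1 sX
  connected : ConnectedSpace X

/-- A smooth irreducible projective curve over `ℂ`. -/
structure IsSmoothProjectiveCurve {X : Scheme.{0}} (sX : X ⟶ SpecC) : Prop where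
  projective : IsProjectiveVariety sX
  smooth : SmoothOfRelativeDimension 1 sX
  irreducible : IrreducibleSpace X

/-- A smooth surface over `ℂ`. -/
structure IsSmoothSurface {X : Scheme.{0}} (sX : X ⟶ SpecC) : Prop where
  variety : IsVariety sX
  smooth : SmoothOfRelativeDimension 2 sX

/-- A Cohen-Macaulay local ring: a Noetherian local ring possessing a regular sequence whose
length is the Krull dimension. -/
def IsCohenMacaulayLocalRing (R : Type) [CommRing R] [IsLocalRing R] : Prop :=
  IsNoetherianRing R ∧ ∃ rs : List R, (∀ r ∈ rs, r ∈ IsLocalRing.maximalIdeal R) ∧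
    RingTheory.Sequence.IsRegular R rs ∧ ((rs.length : ℕ∞) : WithBot ℕ∞) = ringKrullDim R

/-- A primitive double curve (ribbon) `Y` over `ℂ`: a Cohen-Macaulay variety whose reduced
subscheme `C` is a smooth irreducible projective curve, every closed point of which has a
neighbourhood that can be embedded in a smooth surface, and which has multiplicity two, i.e. the
ideal sheaf of `C` in `Y` is nonzero and its square is zero. -/
structure IsPrimitiveDoubleCurve {Y : Scheme.{0}} (sY : Y ⟶ SpecC) : Prop where
  variety : IsVariety sY
  cohenMacaulay : ∀ y : Y, IsCohenMacaulayLocalRing (Y.presheaf.stalk y)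
  reduced_smooth : IsSmoothProjectiveCurve (Y.nilradical.subschemeι ≫ sY)
  locally_in_surface : ∀ y : Y, IsClosed ({y} : Set Y) → ∃ U : Y.Opens, y ∈ U ∧
    ∃ (T : Scheme.{0}) (sT : T ⟶ SpecC), IsSmoothSurface sT ∧
      ∃ j : U.toScheme ⟶ T, IsImmersion j ∧ j ≫ sT = U.ι ≫ sY
  nilradical_ne_bot : Y.nilradical ≠ ⊥
  nilradical_sq : Y.nilradical ^ 2 = ⊥

/-! ### Ideal sheaves and blowing-ups -/

/-- The stalk at `x` of an ideal sheaf, as an ideal of the local ring at `x`. -/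
def stalkIdeal {X : Scheme.{0}} (I : X.IdealSheafData) (x : X) : Ideal (X.presheaf.stalk x) :=
  ⨆ (U : X.affineOpens) (hx : x ∈ U.1), (I.ideal U).map (X.presheaf.germ U.1 x hx).hom

/-- An invertible ideal sheaf: locally generated by one element that is not a zero divisor. -/
def IsInvertibleIdeal {X : Scheme.{0}} (I : X.IdealSheafData) : Prop :=
  ∀ x : X, ∃ U : X.affineOpens, x ∈ U.1 ∧
    ∃ a ∈ nonZeroDivisors Γ(X, U.1), I.ideal U = Ideal.span {a}

/-- `η : B ⟶ X` is the blowing-up of `X` along the closed subscheme with ideal sheaf `I`: the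
inverse image ideal sheaf `η⁻¹I · 𝒪_B` is invertible, and every `f : T ⟶ X` such that
`f⁻¹I · 𝒪_T` is invertible factors uniquely through `η`. -/
def IsBlowingUp {B X : Scheme.{0}} (η : B ⟶ X) (I : X.IdealSheafData) : Prop :=
  IsInvertibleIdeal (I.comap η) ∧
    ∀ (T : Scheme.{0}) (f : T ⟶ X), IsInvertibleIdeal (I.comap f) → ∃! g : T ⟶ B, g ≫ η = f

/-! ### Gluing two closed subschemes along a common closed subscheme

Let `I₁, I₂ ⊆ J` be ideal sheaves on `X`, defining closed subschemes `X₁, X₂ ⊇ W`. The sheaf of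
`𝒪_X`-algebras `{(α, β) ∈ 𝒪_{X₁} × 𝒪_{X₂} ; α|_W = β|_W}` is quasi-coherent; its relative spectrum
is the scheme obtained by gluing `X₁` and `X₂` along `W`, and it has a canonical morphism
to `X`. -/

section Algebra

variable {R R' : Type} [CommRing R] [CommRing R']

/-- The ring of pairs `(α, β) ∈ R/I₁ × R/I₂` such that `α` and `β` have the same image
in `R/J`. -/
def gluedRing {I₁ I₂ J : Ideal R} (h₁ : I₁ ≤ J) (h₂ : I₂ ≤ J) : Subring ((R ⧸ I₁) × (R ⧸ I₂)) :=
  RingHom.eqLocus ((Ideal.Quotient.factor h₁).comp (RingHom.fst _ _))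
    ((Ideal.Quotient.factor h₂).comp (RingHom.snd _ _))

/-- The canonical map `R → gluedRing`. -/
def toGluedRing {I₁ I₂ J : Ideal R} (h₁ : I₁ ≤ J) (h₂ : I₂ ≤ J) : R →+* gluedRing h₁ h₂ :=
  RingHom.codRestrict ((Ideal.Quotient.mk I₁).prod (Ideal.Quotient.mk I₂)) _ fun _ => rfl

/-- Functoriality of `gluedRing`. -/
def gluedRingMap {I₁ I₂ J : Ideal R} (h₁ : I₁ ≤ J) (h₂ : I₂ ≤ J) {I₁' I₂' J' : Ideal R'}
    (h₁' : I₁' ≤ J') (h₂' : I₂' ≤ J') (φ : R →+* R') (k₁ : I₁ ≤ I₁'.comap φ)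
    (k₂ : I₂ ≤ I₂'.comap φ) (k : J ≤ J'.comap φ) : gluedRing h₁ h₂ →+* gluedRing h₁' h₂' :=
  RingHom.restrict ((Ideal.quotientMap I₁' φ k₁).prodMap (Ideal.quotientMap I₂' φ k₂)) _ _ (by
    rintro ⟨a, b⟩ h
    obtain ⟨a, rfl⟩ := Ideal.Quotient.mk_surjective a
    obtain ⟨b, rfl⟩ := Ideal.Quotient.mk_surjective b
    replace h : a - b ∈ J := Ideal.Quotient.eq.mp h
    change Ideal.Quotient.mk J' (φ a) = Ideal.Quotient.mk J' (φ b)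
    rw [Ideal.Quotient.eq, ← map_sub]
    exact k h)

theorem gluedRing_isLocalizationAway {I₁ I₂ J : Ideal R} (h₁ : I₁ ≤ J) (h₂ : I₂ ≤ J)
    {I₁' I₂' J' : Ideal R'} (h₁' : I₁' ≤ J') (h₂' : I₂' ≤ J') (φ : R →+* R')
    (e₁ : I₁.map φ = I₁') (e₂ : I₂.map φ = I₂') (e : J.map φ = J')
    (k₁ : I₁ ≤ I₁'.comap φ) (k₂ : I₂ ≤ I₂'.comap φ) (k : J ≤ J'.comap φ) (f : R)
    (hφ : letI := φ.toAlgebra; IsLocalization.Away f R') :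
    letI := (gluedRingMap h₁ h₂ h₁' h₂' φ k₁ k₂ k).toAlgebra
    IsLocalization.Away (toGluedRing h₁ h₂ f) (gluedRing h₁' h₂') := by
  let := φ.toAlgebra
  have : IsLocalization.Away f R' := hφ
  let := (gluedRingMap h₁ h₂ h₁' h₂' φ k₁ k₂ k).toAlgebra
  subst e₁ e₂ e
  have key : ∀ (K : Ideal R) (x : R), φ x ∈ K.map φ → ∃ n : ℕ, f ^ n * x ∈ K := by
    intro K x hx
    obtain ⟨m, hm, h⟩ :=
      (IsLocalization.algebraMap_mem_map_algebraMap_iff (Submonoid.powers f) R' K x).mp hx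
    obtain ⟨n, rfl⟩ := hm
    exact ⟨n, h⟩
  have hto : ∀ r : R, algebraMap (gluedRing h₁ h₂) (gluedRing h₁' h₂') (toGluedRing h₁ h₂ r) =
      toGluedRing h₁' h₂' (φ r) := fun r => rfl
  refine ⟨?_, ?_, ?_⟩
  · rintro ⟨_, n, rfl⟩
    change IsUnit (algebraMap (gluedRing h₁ h₂) (gluedRing h₁' h₂') (toGluedRing h₁ h₂ f ^ n))
    rw [map_pow, hto]
    exact ((IsLocalization.Away.algebraMap_isUnit (S := R') f).map (toGluedRing h₁' h₂')).pow n
  · rintro ⟨⟨a, b⟩, hab⟩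
    obtain ⟨a, rfl⟩ := Ideal.Quotient.mk_surjective a
    obtain ⟨b, rfl⟩ := Ideal.Quotient.mk_surjective b
    replace hab : a - b ∈ J.map φ := Ideal.Quotient.eq.mp hab
    obtain ⟨n, a₀, ha⟩ := IsLocalization.Away.surj f a
    obtain ⟨m, b₀, hb⟩ := IsLocalization.Away.surj f b
    change a * φ f ^ n = φ a₀ at ha
    change b * φ f ^ m = φ b₀ at hb
    have hd : φ (f ^ m * a₀ - f ^ n * b₀) ∈ J.map φ := by
      have : φ (f ^ m * a₀ - f ^ n * b₀) = φ f ^ (n + m) * (a - b) := by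
        rw [map_sub, map_mul, map_mul, ← ha, ← hb, map_pow, map_pow]; ring
      rw [this]
      exact Ideal.mul_mem_left _ _ hab
    obtain ⟨l, hl⟩ := key J _ hd
    refine ⟨(⟨(Ideal.Quotient.mk I₁ (f ^ l * (f ^ m * a₀)),
      Ideal.Quotient.mk I₂ (f ^ l * (f ^ n * b₀))), ?_⟩,
      ⟨toGluedRing h₁ h₂ f ^ (l + n + m), l + n + m, rfl⟩), ?_⟩
    · change Ideal.Quotient.mk J _ = Ideal.Quotient.mk J _
      rw [Ideal.Quotient.eq, ← mul_sub]
      exact hl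
    · change _ * algebraMap (gluedRing h₁ h₂) (gluedRing h₁' h₂')
        (toGluedRing h₁ h₂ f ^ (l + n + m)) = _
      rw [map_pow, hto, ← map_pow]
      refine Subtype.ext (Prod.ext ?_ ?_)
      · change Ideal.Quotient.mk _ (a * φ f ^ (l + n + m)) =
          Ideal.Quotient.mk _ (φ (f ^ l * (f ^ m * a₀)))
        rw [map_mul φ, map_mul φ, ← ha, map_pow φ, map_pow φ]
        congr 1; ring
      · change Ideal.Quotient.mk _ (b * φ f ^ (l + n + m)) =
          Ideal.Quotient.mk _ (φ (f ^ l * (f ^ n * b₀)))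
        rw [map_mul φ, map_mul φ, ← hb, map_pow φ, map_pow φ]
        congr 1; ring
  · rintro ⟨⟨a, b⟩, hab⟩ ⟨⟨c, d⟩, hcd⟩ h
    obtain ⟨a, rfl⟩ := Ideal.Quotient.mk_surjective a
    obtain ⟨b, rfl⟩ := Ideal.Quotient.mk_surjective b
    obtain ⟨c, rfl⟩ := Ideal.Quotient.mk_surjective c
    obtain ⟨d, rfl⟩ := Ideal.Quotient.mk_surjective d
    have hp := congrArg Subtype.val h
    have hp₁ : Ideal.Quotient.mk (I₁.map φ) (φ a) = Ideal.Quotient.mk _ (φ c) :=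
      congrArg Prod.fst hp
    have hp₂ : Ideal.Quotient.mk (I₂.map φ) (φ b) = Ideal.Quotient.mk _ (φ d) :=
      congrArg Prod.snd hp
    rw [Ideal.Quotient.eq, ← map_sub] at hp₁ hp₂
    obtain ⟨n, hn⟩ := key _ _ hp₁
    obtain ⟨m, hm⟩ := key _ _ hp₂
    refine ⟨⟨toGluedRing h₁ h₂ f ^ (n + m), n + m, rfl⟩, ?_⟩
    change toGluedRing h₁ h₂ f ^ (n + m) * _ = toGluedRing h₁ h₂ f ^ (n + m) * _
    rw [← map_pow]
    refine Subtype.ext (Prod.ext ?_ ?_)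
    · change Ideal.Quotient.mk I₁ (f ^ (n + m) * a) = Ideal.Quotient.mk I₁ (f ^ (n + m) * c)
      rw [Ideal.Quotient.eq, ← mul_sub, pow_add, mul_right_comm]
      exact Ideal.mul_mem_right _ _ hn
    · change Ideal.Quotient.mk I₂ (f ^ (n + m) * b) = Ideal.Quotient.mk I₂ (f ^ (n + m) * d)
      rw [Ideal.Quotient.eq, ← mul_sub, pow_add, mul_assoc]
      exact Ideal.mul_mem_left _ _ hm

end Algebra

section Gluing

open Scheme.AffineZariskiSite

variable {X : Scheme.{0}} {I₁ I₂ J : X.IdealSheafData} (h₁ : I₁ ≤ J) (h₂ : I₂ ≤ J)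

/-- The presheaf of rings `U ↦ {(α, β) ∈ 𝒪_{X₁}(U) × 𝒪_{X₂}(U) ; α|_W = β|_W}` on the affine open
subsets of `X`. -/
def gluedAlgebra : X.AffineZariskiSiteᵒᵖ ⥤ CommRingCat.{0} where
  obj U := CommRingCat.of (gluedRing (h₁ U.unop) (h₂ U.unop))
  map {U V} i := CommRingCat.ofHom (gluedRingMap _ _ _ _
    (X.presheaf.map (homOfLE (toOpens_mono i.unop.le)).op).hom
    (I₁.ideal_le_comap_ideal (toOpens_mono i.unop.le))
    (I₂.ideal_le_comap_ideal (toOpens_mono i.unop.le))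
    (J.ideal_le_comap_ideal (toOpens_mono i.unop.le)))
  map_id U := by
    refine CommRingCat.hom_ext (RingHom.ext ?_)
    rintro ⟨⟨a, b⟩, hab⟩
    obtain ⟨a, rfl⟩ := Ideal.Quotient.mk_surjective a
    obtain ⟨b, rfl⟩ := Ideal.Quotient.mk_surjective b
    refine Subtype.ext (Prod.ext ?_ ?_)
    · change Ideal.Quotient.mk _ (X.presheaf.map (𝟙 _) a) = Ideal.Quotient.mk _ a
      rw [X.presheaf.map_id]; rfl
    · change Ideal.Quotient.mk _ (X.presheaf.map (𝟙 _) b) = Ideal.Quotient.mk _ b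
      rw [X.presheaf.map_id]; rfl
  map_comp {U V W} i j := by
    refine CommRingCat.hom_ext (RingHom.ext ?_)
    rintro ⟨⟨a, b⟩, hab⟩
    obtain ⟨a, rfl⟩ := Ideal.Quotient.mk_surjective a
    obtain ⟨b, rfl⟩ := Ideal.Quotient.mk_surjective b
    have key : ∀ c, X.presheaf.map (homOfLE (toOpens_mono (i ≫ j).unop.le)).op c =
        X.presheaf.map (homOfLE (toOpens_mono j.unop.le)).op
          (X.presheaf.map (homOfLE (toOpens_mono i.unop.le)).op c) := fun c => by
      rw [← CommRingCat.comp_apply, ← X.presheaf.map_comp]; rfl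
    refine Subtype.ext (Prod.ext ?_ ?_)
    · exact congrArg (Ideal.Quotient.mk _) (key a)
    · exact congrArg (Ideal.Quotient.mk _) (key b)

/-- The structure map from `𝒪_X` to `gluedAlgebra`. -/
def toGluedAlgebra : (toOpensFunctor X).op ⋙ X.presheaf ⟶ gluedAlgebra h₁ h₂ where
  app U := CommRingCat.ofHom (toGluedRing (h₁ U.unop) (h₂ U.unop))
  naturality U V i := by
    ext a
    rfl

theorem toGluedAlgebra_coequifibered : (toGluedAlgebra h₁ h₂).Coequifibered := by
  refine coequifibered_iff_forall_isLocalizationAway.mpr fun U f => ?_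
  exact gluedRing_isLocalizationAway (h₁ U) (h₂ U) (h₁ (U.basicOpen f)) (h₂ (U.basicOpen f))
    (X.presheaf.map (homOfLE (X.basicOpen_le f)).op).hom
    (I₁.map_ideal_basicOpen U f) (I₂.map_ideal_basicOpen U f) (J.map_ideal_basicOpen U f)
    (I₁.ideal_le_comap_ideal (X.basicOpen_le f)) (I₂.ideal_le_comap_ideal (X.basicOpen_le f))
    (J.ideal_le_comap_ideal (X.basicOpen_le f)) f (U.2.isLocalization_basicOpen f)

/-- The scheme obtained by gluing `X₁` and `X₂` along `W`: the relative spectrum over `X` of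
`gluedAlgebra`. -/
def gluedScheme : Scheme.{0} := (relativeGluingData (toGluedAlgebra_coequifibered h₁ h₂)).glued

/-- The canonical (affine) morphism from the glued scheme to `X`. -/
def gluedSchemeTo : gluedScheme h₁ h₂ ⟶ X :=
  (relativeGluingData (toGluedAlgebra_coequifibered h₁ h₂)).toBase

end Gluing

/-! ### Maximal reducible deformations of a primitive double curve -/

/-- The ideal sheaf on `X` of the scheme-theoretic fibre of `π : X ⟶ S` over `z`. -/
def fibreIdeal {X S : Scheme.{0}} (π : X ⟶ S) (z : S) : X.IdealSheafData := (π.fiberι z).ker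

/-- The ideal sheaf of a closed subset, endowed with its reduced structure. -/
abbrev reducedIdeal {X : Scheme.{0}} (A : TopologicalSpace.Closeds X) : X.IdealSheafData :=
  Scheme.IdealSheafData.vanishingIdeal A

/-- A flat family of smooth irreducible projective curves parametrised by `S`. -/
structure IsFamilyOfSmoothCurves {X S : Scheme.{0}} (sS : S ⟶ SpecC) (π : X ⟶ S) : Prop where
  flat : Flat π
  fibre : ∀ z : S, IsClosed ({z} : Set S) → IsSmoothProjectiveCurve (π.fiberι z ≫ π ≫ sS)

/-- `π : X ⟶ S` is a maximal reducible deformation of the primitive double curve `Y`, with `P` the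
point of the smooth curve `S` over which the fibre is `Y`, and with irreducible components `X₁`
and `X₂` (endowed with their reduced structures). -/
structure IsMaximalReducibleDeformation {Y X S : Scheme.{0}} (sY : Y ⟶ SpecC) (sS : S ⟶ SpecC)
    (π : X ⟶ S) (P : S) (X₁ X₂ : TopologicalSpace.Closeds X) : Prop where
  variety : IsVariety (π ≫ sS)
  reduced : IsReduced X
  components_ne : X₁ ≠ X₂
  components : irreducibleComponents X = {(X₁ : Set X), (X₂ : Set X)}
  /-- the fibre over `P` is `Y` -/
  specialFibre : ∃ e : Y ≅ π.fiber P, e.hom ≫ π.fiberι P ≫ π ≫ sS = sY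
  family₁ : IsFamilyOfSmoothCurves sS ((reducedIdeal X₁).subschemeι ≫ π)
  family₂ : IsFamilyOfSmoothCurves sS ((reducedIdeal X₂).subschemeι ≫ π)
  /-- the fibre of `X₁` over `P` is the reduced curve `C` of the fibre of `X` over `P` -/
  specialFibre₁ : reducedIdeal X₁ ⊔ fibreIdeal π P = (fibreIdeal π P).radical
  /-- the fibre of `X₂` over `P` is the reduced curve `C` of the fibre of `X` over `P` -/
  specialFibre₂ : reducedIdeal X₂ ⊔ fibreIdeal π P = (fibreIdeal π P).radical
  /-- the other fibres are reduced -/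
  reduced_fibre : ∀ z : S, IsClosed ({z} : Set S) → z ≠ P → IsReduced (π.fiber z)
  /-- the two components of the other fibres meet transversally: their scheme-theoretic
  intersection consists of reduced points -/
  transversal : ∀ z : S, IsClosed ({z} : Set S) → z ≠ P → ∀ x : X, x ∈ X₁ → x ∈ X₂ → π x = z →
    stalkIdeal (reducedIdeal X₁ ⊔ reducedIdeal X₂ ⊔ fibreIdeal π z) x =
      IsLocalRing.maximalIdeal (X.presheaf.stalk x)

/-- The closure `Z` in `X` of the locus of the intersection points of the two components of the
fibres of `π` over the points different from `P`. -/
def intersectionCurve {X S : Scheme.{0}} (π : X ⟶ S) (P : S)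
    (X₁ X₂ : TopologicalSpace.Closeds X) : TopologicalSpace.Closeds X :=
  TopologicalSpace.Closeds.closure {x | x ∈ X₁ ∧ x ∈ X₂ ∧ π x ≠ P}

/-- The defining property of the integer `p`: `p > 0` and, at every closed point `x` of the curve
`C` (the reduced fibre over `P`), with `t` a local equation at `x` of the fibre over `P`,
the ideal of `C` in `X` at `x` is generated by `t` and by an element `e = (t ^ p * l, 0)` of
`𝒪_{X, x} ⊆ 𝒪_{X₁, x} × 𝒪_{X₂, x}`, where the image of `l` in `𝒪_{X₁, x}` is not divisible
by `t`. -/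
def IsContactExponent {X S : Scheme.{0}} (π : X ⟶ S) (P : S)
    (X₁ X₂ : TopologicalSpace.Closeds X) (p : ℕ) : Prop :=
  0 < p ∧ ∀ x : X, IsClosed ({x} : Set X) → π x = P →
    ∃ t l e : X.presheaf.stalk x,
      stalkIdeal (fibreIdeal π P) x = Ideal.span {t} ∧
      l ∉ stalkIdeal (reducedIdeal X₁) x ⊔ Ideal.span {t} ∧
      e - t ^ p * l ∈ stalkIdeal (reducedIdeal X₁) x ∧
      e ∈ stalkIdeal (reducedIdeal X₂) x ∧
      stalkIdeal (fibreIdeal π P).radical x = Ideal.span {t, e}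

/-- The ideal sheaf on `X` of the closed subscheme `C⁽ᵖ⁾` of `X₁ ∩ X₂`, the `p`-th infinitesimal
neighbourhood of `C` in both `X₁` and `X₂`: it is generated by the ideals of `X₁`, of `X₂`, and by
the `p`-th power of the ideal of the fibre over `P`. -/
def infinitesimalIdeal {X S : Scheme.{0}} (π : X ⟶ S) (P : S)
    (X₁ X₂ : TopologicalSpace.Closeds X) (p : ℕ) : X.IdealSheafData :=
  reducedIdeal X₁ ⊔ reducedIdeal X₂ ⊔ fibreIdeal π P ^ p

/-- The associated fragmented deformation `D`: the two components `X₁`, `X₂` glued along `C⁽ᵖ⁾`,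
i.e. the relative spectrum over `X` of
`{(α, β) ∈ 𝒪_{X₁} × 𝒪_{X₂} ; α ≡ β mod t ^ p}`. -/
def associatedFragmented {X S : Scheme.{0}} (π : X ⟶ S) (P : S)
    (X₁ X₂ : TopologicalSpace.Closeds X) (p : ℕ) : Scheme.{0} :=
  gluedScheme (I₁ := reducedIdeal X₁) (I₂ := reducedIdeal X₂)
    (J := infinitesimalIdeal π P X₁ X₂ p)
    (le_sup_left.trans le_sup_left) (le_sup_right.trans le_sup_left)

/-- The canonical morphism `η` from the associated fragmented deformation to `X`, induced by the
inclusion of `𝒪_X` in `𝒪_D`. -/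
def associatedFragmentedTo {X S : Scheme.{0}} (π : X ⟶ S) (P : S)
    (X₁ X₂ : TopologicalSpace.Closeds X) (p : ℕ) : associatedFragmented π P X₁ X₂ p ⟶ X :=
  gluedSchemeTo _ _

end ReducibleDeformation

end

/-! At a closed point of `C`, let `A` be the local ring of the total space, `I₁` and `I₂` the ideals
of the two components, `t` an equation of the fibre over `P`, and `K` the ideal of `C`. Then `I₁ +
(t) = I₂ + (t) = K` is prime, `t` is regular modulo each `Iᵢ` by flatness, and `I₁ ∩ I₂ = 0`. The
ribbon lies locally in a smooth surface, so the maximal ideal is generated by `t` and two more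
elements, and this forces `K = (t, e)`, with a second generator that may be taken in `I₂`. Nakayama
gives `I₂ = (e)`. Writing `e = t ^ p * l` modulo `I₁` with `l ∉ K` defines `p`. Exchanging the
components shows that `I₁` is generated by `e' = t ^ p * l - e` (`IsContact.span_sub_eq`). The
exponent is the least `n` for which `t ^ n` lies in `I₁ + I₂` at the generic point of `C`, hence it
is the same at all closed points (`IsSpecialPoint.le_iff`).

The ideal of `Z` is the saturation of `I₁ + I₂` by `t`, because away from `C` the scheme-theoretic
intersection is already reduced (`mem_stalkIdeal_intersectionCurve_iff`). At a point of `C` it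
equals `I₁ + I₂ + (l)`. So everything takes the form recorded in `IsGluingChart`: `I₁ = (e')`, `I₂ =
(e)`, `e + e' = s * l`, gluing ideal `I₁ + I₂ + (s)`, center `I₁ + I₂ + (l)`. Here `s = t ^ p` on
`C`, and `s = 1` elsewhere. The data spread from closed points to affine open neighbourhoods, which
cover everything by the Jacobson property.

The blowing-up statement is then algebra. In the glued ring `e = l * (s, 0)` and `e' = l * (0, s)`,
so the center extends to the ideal of the nonzerodivisor `l`. Conversely, if the center becomes
`(a)` with `a` regular, write `e = a * y`, `e' = a * y'`, `l = a * z`. The relations `y * y' = 0`,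
`y + y' = s * z` and `(y, y', z) = 1` force `z` to be a unit, so `l` generates the center. Since `l`
multiplies the glued ring into `R`, the only possible lift is `b ↦ φ (l * b) / φ l`, and it is a
ring homomorphism (`IsGluingChart.existsUnique_lift`). -/

namespace ReducibleDeformation

/-! ### Noetherian local rings -/

section LocalAlgebra

open IsLocalRing

variable {A : Type*} [CommRing A] [IsLocalRing A] [IsNoetherianRing A]

/-- Krull's intersection theorem in the Noetherian local ring `A ⧸ L`. -/
theorem mem_of_forall_mem_sup_maximalIdeal_pow {L : Ideal A} {a : A}
    (h : ∀ n : ℕ, a ∈ L ⊔ maximalIdeal A ^ n) : a ∈ L := by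
  by_cases hL : L = ⊤
  · simp [hL]
  have : Nontrivial (A ⧸ L) := Ideal.Quotient.nontrivial_iff.mpr hL
  have : IsLocalRing (A ⧸ L) := .of_surjective' _ Ideal.Quotient.mk_surjective
  have hm : (maximalIdeal A).map (Ideal.Quotient.mk L) ≠ ⊤ := by
    intro h
    have h1 : (1 : A) ∈ ((maximalIdeal A).map (Ideal.Quotient.mk L)).comap
        (Ideal.Quotient.mk L) := by rw [h]; trivial
    rw [Ideal.comap_map_mk (le_maximalIdeal hL)] at h1
    exact (Ideal.ne_top_iff_one _).mp (maximalIdeal.isMaximal A).ne_top h1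
  rw [← Ideal.Quotient.eq_zero_iff_mem, ← Ideal.mem_bot,
    ← Ideal.iInf_pow_eq_bot_of_isLocalRing _ hm, Ideal.mem_iInf]
  intro n
  rw [← Ideal.map_pow]
  obtain ⟨b, hb, c, hc, rfl⟩ := Submodule.mem_sup.mp (h n)
  rw [map_add, Ideal.Quotient.eq_zero_iff_mem.mpr hb, zero_add]
  exact Ideal.mem_map_of_mem _ hc

theorem mem_of_forall_mem_sup_span_pow {L : Ideal A} {a u : A} (hu : u ∈ maximalIdeal A)
    (h : ∀ n : ℕ, a ∈ L ⊔ Ideal.span {u ^ n}) : a ∈ L :=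
  mem_of_forall_mem_sup_maximalIdeal_pow fun n => sup_le_sup_left
    ((Ideal.span_singleton_le_iff_mem _).mpr (Ideal.pow_mem_pow hu n)) _ (h n)

theorem mem_sup_span_singleton {R : Type*} [CommRing R] {L : Ideal R} {u a : R} :
    a ∈ L ⊔ Ideal.span {u} ↔ ∃ v, a - v * u ∈ L := by
  rw [Submodule.mem_sup]
  constructor
  · rintro ⟨b, hb, c, hc, rfl⟩
    obtain ⟨v, rfl⟩ := Ideal.mem_span_singleton'.mp hc
    exact ⟨v, by simpa using hb⟩
  · rintro ⟨v, hv⟩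
    exact ⟨_, hv, v * u, Ideal.mem_span_singleton'.mpr ⟨v, rfl⟩, by ring⟩

/-- In a Noetherian local ring, if `u` lies in the maximal ideal then an element outside of `L` can
be written, modulo `L`, as `b * u ^ n` with `b ∉ L ⊔ (u)`. -/
theorem exists_eq_mul_pow {L : Ideal A} {a u : A} (hu : u ∈ maximalIdeal A) (ha : a ∉ L) :
    ∃ (n : ℕ) (b : A), b ∉ L ⊔ Ideal.span {u} ∧ a - b * u ^ n ∈ L := by
  by_contra! H
  -- If no such form exists, every coefficient of `u ^ n` is again divisible by `u` modulo `L`, so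
  -- `a` lies in all `L + (u ^ n)`.
  refine ha (mem_of_forall_mem_sup_span_pow hu fun n => mem_sup_span_singleton.mpr ?_)
  induction n with
  | zero => exact ⟨a, by simp⟩
  | succ n ih =>
    obtain ⟨v, hv⟩ := ih
    by_cases h : v ∈ L ⊔ Ideal.span {u}
    · obtain ⟨w, hw⟩ := mem_sup_span_singleton.mp h
      refine ⟨w, ?_⟩
      have := L.add_mem hv (L.mul_mem_right (u ^ n) hw)
      convert this using 1; ring
    · exact absurd hv (H n v h)

/-- A local ring modulo `L` whose maximal ideal is generated by a non-nilpotent `u` has no proper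
quotient in which `u` stays non-nilpotent. -/
theorem eq_of_le_of_maximalIdeal_eq_sup {L K : Ideal A} {u : A} (hLK : L ≤ K)
    (hm : maximalIdeal A = L ⊔ Ideal.span {u}) (hu : ∀ n : ℕ, u ^ n ∉ K) : L = K := by
  refine le_antisymm hLK fun a ha => ?_
  by_contra haL
  have hum : u ∈ maximalIdeal A := hm ▸ Ideal.mem_sup_right (Ideal.mem_span_singleton_self u)
  obtain ⟨n, b, hb, hab⟩ := exists_eq_mul_pow hum haL
  rw [← hm, mem_maximalIdeal, mem_nonunits_iff, not_not] at hb
  refine hu n ((Ideal.unit_mul_mem_iff_mem K hb).mp ?_)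
  have := K.sub_mem ha (hLK hab)
  simpa using this

/-- Modulo `L`, every nonzero element is a unit times a power of `u`. A product of two such elements
has the same form, and it is nonzero because `u` is not nilpotent. -/
theorem isPrime_of_maximalIdeal_eq_sup {L : Ideal A} {u : A}
    (hm : maximalIdeal A = L ⊔ Ideal.span {u}) (hu : ∀ n : ℕ, u ^ n ∉ L) : L.IsPrime := by
  have hum : u ∈ maximalIdeal A := hm ▸ Ideal.mem_sup_right (Ideal.mem_span_singleton_self u)
  refine Ideal.isPrime_iff.mpr ⟨fun h => hu 0 (h ▸ trivial), fun {a b} hab => ?_⟩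
  by_contra! H
  obtain ⟨n, c, hc, hac⟩ := exists_eq_mul_pow hum H.1
  obtain ⟨m, d, hd, hbd⟩ := exists_eq_mul_pow hum H.2
  rw [← hm, mem_maximalIdeal, mem_nonunits_iff, not_not] at hc hd
  refine hu (n + m) ((Ideal.unit_mul_mem_iff_mem L (hc.mul hd)).mp ?_)
  have := L.sub_mem hab (L.add_mem (L.mul_mem_right b hac) (L.mul_mem_left (c * u ^ n) hbd))
  convert this using 1; ring

/-- Being a nonzerodivisor modulo an ideal. -/
def IsRegularMod {R : Type*} [CommRing R] (I : Ideal R) (t : R) : Prop :=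
  ∀ a, t * a ∈ I → a ∈ I

theorem IsRegularMod.pow {R : Type*} [CommRing R] {I : Ideal R} {t : R} (h : IsRegularMod I t)
    (n : ℕ) : IsRegularMod I (t ^ n) := by
  induction n with
  | zero => intro a ha; simpa using ha
  | succ n ih => intro a ha; exact h _ (ih _ (by rwa [← mul_assoc, ← pow_succ]))

theorem isRegularMod_of_isPrime {R : Type*} [CommRing R] {I : Ideal R} (hI : I.IsPrime) {t : R}
    (ht : t ∉ I) : IsRegularMod I t := fun _ ha => (hI.mem_or_mem ha).resolve_left ht

/-- If `t` is a nonzerodivisor modulo `I` and generates a prime ideal modulo `I`, then `I` is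
prime. -/
theorem isPrime_of_isPrime_sup {I : Ideal A} {t : A} (ht : t ∈ maximalIdeal A)
    (hreg : IsRegularMod I t) (hK : (I ⊔ Ideal.span {t}).IsPrime) : I.IsPrime := by
  refine Ideal.isPrime_iff.mpr ⟨fun h => hK.ne_top (by simp [h]), fun {a b} hab => ?_⟩
  by_contra! H
  obtain ⟨n, c, hc, hac⟩ := exists_eq_mul_pow ht H.1
  obtain ⟨m, d, hd, hbd⟩ := exists_eq_mul_pow ht H.2
  have h : t ^ (n + m) * (c * d) ∈ I := by
    have := I.sub_mem hab (I.add_mem (I.mul_mem_right b hac) (I.mul_mem_left (c * t ^ n) hbd))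
    convert this using 1; ring
  exact (hK.mem_or_mem (Ideal.mem_sup_left (hreg.pow _ _ h))).elim hc hd

/-- Comparison of `t`-adic valuations modulo `I`. -/
theorem le_of_pow_mul_mem {R : Type*} [CommRing R] {I : Ideal R} {t b c : R} {n m : ℕ}
    (hreg : IsRegularMod I t)
    (hc : c ∉ I ⊔ Ideal.span {t}) (h : t ^ n * c - t ^ m * b ∈ I) : m ≤ n := by
  by_contra! hlt
  obtain ⟨k, rfl⟩ := Nat.exists_eq_add_of_lt hlt
  refine hc (mem_sup_span_singleton.mpr ⟨t ^ k * b, hreg.pow n _ ?_⟩)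
  convert h using 1; ring

/-- The kernel of the reduction to a curve is generated by two elements when the maximal ideal
is generated by two elements modulo `t`. -/
theorem exists_eq_span_pair {K : Ideal A} {t u v w : A} (htK : t ∈ K) (hK : K.IsPrime)
    (hm : maximalIdeal A = K ⊔ Ideal.span {u}) (hu : u ∉ K)
    (hm' : maximalIdeal A = Ideal.span {t, v, w}) : ∃ g, K = Ideal.span {t, g} := by
  -- If `v` is a unit multiple of `u` modulo `K`, then `v` also generates the maximal ideal of `A ⧸
  -- K`, and `w` can be moved into `K` by subtracting a multiple of `v`. The corrected `w` is the
  -- generator sought.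
  have key : ∀ v w : A, maximalIdeal A = Ideal.span {t, v, w} →
      (∃ a, IsUnit a ∧ v - a * u ∈ K) → ∃ g, K = Ideal.span {t, g} := by
    rintro v w hm' ⟨a, ha, hva⟩
    obtain ⟨a', haa'⟩ := ha.exists_left_inv
    have hv : ∀ n : ℕ, v ^ n ∉ K := by
      intro n hn
      have hvK := hK.mem_of_pow_mem _ hn
      have : a * u ∈ K := by simpa using K.sub_mem hvK hva
      exact hu ((Ideal.unit_mul_mem_iff_mem K ha).mp this)
    have hwm : w ∈ K ⊔ Ideal.span {u} := by
      rw [← hm, hm']; exact Ideal.subset_span (by simp)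
    obtain ⟨b, hb⟩ := mem_sup_span_singleton.mp hwm
    have hg : w - b * a' * v ∈ K := by
      have := K.sub_mem hb (K.mul_mem_left (b * a') hva)
      have e : w - b * a' * v = w - b * u - b * a' * (v - a * u) + b * u * (1 - a' * a) := by ring
      rw [e, haa']; simpa using this
    refine ⟨w - b * a' * v, (eq_of_le_of_maximalIdeal_eq_sup (u := v) ?_ ?_ hv).symm⟩
    · rw [Ideal.span_le]; rintro x (rfl | rfl) <;> assumption
    · rw [hm', ← Ideal.span_union]
      apply le_antisymm <;> rw [Ideal.span_le]
      · rintro x (rfl | rfl | rfl)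
        · exact Ideal.subset_span (by simp)
        · exact Ideal.subset_span (by simp)
        · have : x = (x - b * a' * v) + b * a' * v := by ring
          rw [this]
          exact Ideal.add_mem _ (Ideal.subset_span (by simp))
            (Ideal.mul_mem_left _ _ (Ideal.subset_span (by simp)))
      · rintro x ((rfl | rfl) | rfl)
        · exact Ideal.subset_span (by simp)
        · exact Ideal.sub_mem _ (Ideal.subset_span (by simp))
            (Ideal.mul_mem_left _ _ (Ideal.subset_span (by simp)))
        · exact Ideal.subset_span (by simp)
  have hv : v ∈ K ⊔ Ideal.span {u} := by rw [← hm, hm']; exact Ideal.subset_span (by simp)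
  have hw : w ∈ K ⊔ Ideal.span {u} := by rw [← hm, hm']; exact Ideal.subset_span (by simp)
  obtain ⟨a, ha⟩ := mem_sup_span_singleton.mp hv
  obtain ⟨b, hb⟩ := mem_sup_span_singleton.mp hw
  by_cases hau : IsUnit a
  · exact key v w hm' ⟨a, hau, ha⟩
  by_cases hbu : IsUnit b
  · exact key w v (by rw [hm']; congr 1; ext; simp only [Set.mem_insert_iff,
      Set.mem_singleton_iff]; tauto) ⟨b, hbu, hb⟩
  -- If neither coefficient is a unit, then `u` is in `K` plus the maximal ideal times `u`, hence in
  -- `K`.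
  exfalso
  have hum : u ∈ Ideal.span {t, v, w} := by
    rw [← hm', hm]; exact Ideal.mem_sup_right (Ideal.mem_span_singleton_self u)
  obtain ⟨x, y, z, hxyz⟩ := Submodule.mem_span_triple.mp hum
  simp only [smul_eq_mul] at hxyz
  have h1 : (1 - (y * a + z * b)) * u ∈ K := by
    have : (1 - (y * a + z * b)) * u = x * t + y * (v - a * u) + z * (w - b * u) := by
      linear_combination -hxyz
    rw [this]
    exact K.add_mem (K.add_mem (K.mul_mem_left _ htK) (K.mul_mem_left _ ha)) (K.mul_mem_left _ hb)
  have h2 : y * a + z * b ∈ maximalIdeal A :=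
    Ideal.add_mem _ (Ideal.mul_mem_left _ _ hau) (Ideal.mul_mem_left _ _ hbu)
  have h3 : IsUnit (1 - (y * a + z * b)) := by
    by_contra h
    have : (1 : A) ∈ maximalIdeal A := by
      have := Ideal.add_mem _ (show 1 - (y * a + z * b) ∈ maximalIdeal A from h) h2
      simp at this
    exact (Ideal.ne_top_iff_one _).mp (maximalIdeal.isMaximal A).ne_top this
  exact hu ((Ideal.unit_mul_mem_iff_mem K h3).mp h1)

/-- If `x * t + y * e` is in `I`, then so is `x * t`, and regularity puts `x` in `I`. Thus `I = (e)
+ t * I`, and Nakayama concludes. -/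
theorem eq_span_singleton_of_sup_eq {I : Ideal A} {t e : A} (ht : t ∈ maximalIdeal A)
    (hreg : IsRegularMod I t) (he : e ∈ I)
    (h : I ⊔ Ideal.span {t} = Ideal.span {t, e}) : I = Ideal.span {e} := by
  refine le_antisymm ?_ ((Ideal.span_singleton_le_iff_mem _).mpr he)
  refine Submodule.le_of_le_smul_of_le_jacobson_bot (I := Ideal.span {t})
    (IsNoetherian.noetherian I)
    ?_ fun a ha => ?_
  · rw [Ideal.span_singleton_le_iff_mem, IsLocalRing.jacobson_eq_maximalIdeal _ bot_ne_top]
    exact ht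
  · obtain ⟨x, y, rfl⟩ := Ideal.mem_span_pair.mp (h ▸ Ideal.mem_sup_left ha)
    have : x * t ∈ I := by simpa using I.sub_mem ha (I.mul_mem_left y he)
    rw [mul_comm] at this
    refine Submodule.mem_sup.mpr ⟨y * e, Ideal.mul_mem_left _ _ (Ideal.mem_span_singleton_self e),
      t * x, ?_, by ring⟩
    exact Ideal.mul_mem_mul (Ideal.mem_span_singleton_self t) (hreg _ this)

/-- The local form of the contact of `V(I₁)` and `V(I₂)` along `V(K)`, to order `p` with respect to
the local equation `t`. -/
structure IsContact {R : Type*} [CommRing R] (I₁ I₂ K : Ideal R) (t l e : R) (p : ℕ) : Prop where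
  notMem : l ∉ K
  sub_mem : e - t ^ p * l ∈ I₁
  mem : e ∈ I₂
  eq_span : K = Ideal.span {t, e}

/-- Correcting `g` by a multiple of `t` gives a generator `e` of `I₂`. It is not in `I₁`, since `I₁
∩ I₂ = 0` and `I₂ ≠ 0`; hence `e` has a finite `t`-adic order `p` modulo `I₁`, with leading
coefficient `l`. -/
theorem exists_isContact {I₁ I₂ K : Ideal A} {t g : A} (ht : t ∈ maximalIdeal A)
    (h₁ : I₁ ⊔ Ideal.span {t} = K) (h₂ : I₂ ⊔ Ideal.span {t} = K) (hinf : I₁ ⊓ I₂ = ⊥)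
    (hne : I₂ ≠ ⊥) (hreg₂ : IsRegularMod I₂ t) (hK : K = Ideal.span {t, g}) :
    ∃ (p : ℕ) (l e : A), IsContact I₁ I₂ K t l e p := by
  have hg : g ∈ I₂ ⊔ Ideal.span {t} := by rw [h₂, hK]; exact Ideal.subset_span (by simp)
  obtain ⟨c, hc⟩ := mem_sup_span_singleton.mp hg
  have hK' : K = Ideal.span {t, g - c * t} := by
    rw [hK]
    apply le_antisymm <;> rw [Ideal.span_le]
    · rintro x (rfl | rfl)
      · exact Ideal.subset_span (by simp)
      · have : x = (x - c * t) + c * t := by ring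
        rw [this]
        exact Ideal.add_mem _ (Ideal.subset_span (by simp))
          (Ideal.mul_mem_left _ _ (Ideal.subset_span (by simp)))
    · rintro x (rfl | rfl)
      · exact Ideal.subset_span (by simp)
      · exact Ideal.sub_mem _ (Ideal.subset_span (by simp))
            (Ideal.mul_mem_left _ _ (Ideal.subset_span (by simp)))
  have hgen := eq_span_singleton_of_sup_eq ht hreg₂ hc (h₂.trans hK')
  have hg₁ : g - c * t ∉ I₁ := by
    intro h
    have : g - c * t ∈ I₁ ⊓ I₂ := ⟨h, hc⟩
    rw [hinf, Ideal.mem_bot] at this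
    rw [this, Ideal.span_singleton_eq_bot.mpr rfl] at hgen
    exact hne hgen
  obtain ⟨p, l, hl, hpl⟩ := exists_eq_mul_pow ht hg₁
  exact ⟨p, l, g - c * t, h₁ ▸ hl, by rwa [mul_comm l] at hpl, hc, hK'⟩

namespace IsContact

variable {I₁ I₂ K : Ideal A} {t l e : A} {p : ℕ}

theorem pos {R : Type*} [CommRing R] {I₁ I₂ K : Ideal R} {t l e : R}
    (h : IsContact I₁ I₂ K t l e p) (h₁ : I₁ ⊔ Ideal.span {t} = K)
    (h₂ : I₂ ⊔ Ideal.span {t} = K) : 0 < p := by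
  rw [Nat.pos_iff_ne_zero]
  rintro rfl
  refine h.notMem ?_
  have := K.sub_mem (h₂.le (Ideal.mem_sup_left h.mem)) (h₁.le (Ideal.mem_sup_left h.sub_mem))
  simpa using this

theorem span_eq (h : IsContact I₁ I₂ K t l e p) (ht : t ∈ maximalIdeal A)
    (h₂ : I₂ ⊔ Ideal.span {t} = K) (hreg₂ : IsRegularMod I₂ t) : I₂ = Ideal.span {e} :=
  eq_span_singleton_of_sup_eq ht hreg₂ h.mem (h₂.trans h.eq_span)

/-- Modulo `I₁` the ideal `I₂` is generated by `t ^ p * l`, so an element `t ^ n * b` with `b ∉ K`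
can lie there only if `n ≥ p`. The left side is symmetric in the two components and free of `l` and
`e`, which makes exponents comparable. -/
theorem pow_mul_mem_iff (h : IsContact I₁ I₂ K t l e p) (ht : t ∈ maximalIdeal A)
    (h₁ : I₁ ⊔ Ideal.span {t} = K) (h₂ : I₂ ⊔ Ideal.span {t} = K)
    (hreg₁ : IsRegularMod I₁ t) (hreg₂ : IsRegularMod I₂ t) (n : ℕ) :
    (∃ b, b ∉ K ∧ t ^ n * b ∈ I₁ ⊔ I₂) ↔ p ≤ n := by
  rw [h.span_eq ht h₂ hreg₂]
  constructor
  · rintro ⟨b, hb, hbn⟩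
    obtain ⟨v, hv⟩ := mem_sup_span_singleton.mp hbn
    refine le_of_pow_mul_mem (b := v * l) hreg₁ (h₁ ▸ hb) ?_
    have := I₁.add_mem hv (I₁.mul_mem_left v h.sub_mem)
    convert this using 1; ring
  · intro hpn
    obtain ⟨k, rfl⟩ := Nat.exists_eq_add_of_le hpn
    refine ⟨l, h.notMem, mem_sup_span_singleton.mpr ⟨t ^ k, ?_⟩⟩
    have := I₁.mul_mem_left (-t ^ k) h.sub_mem
    convert this using 1; ring

theorem span_sub_eq (h : IsContact I₁ I₂ K t l e p) (ht : t ∈ maximalIdeal A) (hK : K.IsPrime)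
    (h₁ : I₁ ⊔ Ideal.span {t} = K) (h₂ : I₂ ⊔ Ideal.span {t} = K)
    (hreg₁ : IsRegularMod I₁ t) (hreg₂ : IsRegularMod I₂ t) (hinf : I₁ ⊓ I₂ = ⊥) (hne : I₁ ≠ ⊥) :
    I₁ = Ideal.span {t ^ p * l - e} := by
  -- The same construction with the components exchanged gives a generator `e'` of `I₁`; the
  -- symmetric characterisation shows that the exponent is the same.
  obtain ⟨q, l', e', h'⟩ := exists_isContact ht h₂ h₁ (by rwa [inf_comm]) hne hreg₁ h.eq_span
  have hpq : p = q := le_antisymm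
    ((h.pow_mul_mem_iff ht h₁ h₂ hreg₁ hreg₂ q).mp (by
      rw [sup_comm]; exact (h'.pow_mul_mem_iff ht h₂ h₁ hreg₂ hreg₁ q).mpr le_rfl))
    ((h'.pow_mul_mem_iff ht h₂ h₁ hreg₂ hreg₁ p).mp (by
      rw [sup_comm]; exact (h.pow_mul_mem_iff ht h₁ h₂ hreg₁ hreg₂ p).mpr le_rfl))
  subst hpq
  have hI₁ := h'.span_eq ht h₁ hreg₁
  have hI₂ := h.span_eq ht h₂ hreg₂
  have hmem : t ^ p * l - e ∈ I₁ := by simpa using I₁.neg_mem h.sub_mem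
  obtain ⟨w, hw⟩ := Ideal.mem_span_singleton'.mp (hI₁ ▸ hmem)
  have hmem' : t ^ p * l' - e' ∈ I₂ := by simpa using I₂.neg_mem h'.sub_mem
  obtain ⟨v, hv⟩ := Ideal.mem_span_singleton'.mp (hI₂ ▸ hmem')
  -- With `t ^ p * l - e = w * e'` and `t ^ p * l' - e' = v * e`, cancelling `t ^ p` compares `l`
  -- and `l'` in both directions. Hence `(1 - w * v) * l ∈ K`, and since `l ∉ K` the factor `w` is a
  -- unit.
  have k₁ : l - w * l' ∈ I₂ := by
    refine hreg₂.pow p _ ?_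
    have := I₂.add_mem h.mem (I₂.mul_mem_left w h'.sub_mem)
    convert this using 1
    linear_combination -hw
  have k₂ : l' - v * l ∈ I₁ := by
    refine hreg₁.pow p _ ?_
    have := I₁.add_mem h'.mem (I₁.mul_mem_left v h.sub_mem)
    convert this using 1
    linear_combination -hv
  have k₃ : (1 - w * v) * l ∈ K := by
    have := K.add_mem (h₂.le (Ideal.mem_sup_left k₁)) (K.mul_mem_left w (h₁.le
      (Ideal.mem_sup_left k₂)))
    convert this using 1; ring
  have hwv : 1 - w * v ∈ maximalIdeal A :=
    le_maximalIdeal hK.ne_top ((hK.mem_or_mem k₃).resolve_right h.notMem)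
  have hwu : IsUnit (w * v) := by
    by_contra hn
    have : (1 : A) ∈ maximalIdeal A := by
      have := Ideal.add_mem _ hwv (show w * v ∈ maximalIdeal A from hn)
      simp at this
    exact (Ideal.ne_top_iff_one _).mp (maximalIdeal.isMaximal A).ne_top this
  rw [hI₁, ← hw, Ideal.span_singleton_mul_left_unit (isUnit_of_mul_isUnit_left hwu)]

/-- The saturation of `I₁ ⊔ I₂` with respect to `t`. -/
theorem exists_pow_mul_mem_iff (h : IsContact I₁ I₂ K t l e p) (ht : t ∈ maximalIdeal A)
    (hK : K.IsPrime) (h₁ : I₁ ⊔ Ideal.span {t} = K) (h₂ : I₂ ⊔ Ideal.span {t} = K)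
    (hreg₁ : IsRegularMod I₁ t) (hreg₂ : IsRegularMod I₂ t) (a : A) :
    (∃ n : ℕ, t ^ n * a ∈ I₁ ⊔ I₂) ↔ a ∈ I₁ ⊔ I₂ ⊔ Ideal.span {l} := by
  have hI₂ := h.span_eq ht h₂ hreg₂
  have hpl : t ^ p * l ∈ I₁ ⊔ I₂ := by
    have := Ideal.sub_mem _ (Ideal.mem_sup_right (S := I₁) h.mem)
      (Ideal.mem_sup_left (T := I₂) h.sub_mem)
    simpa using this
  constructor
  · rintro ⟨n, hn⟩
    rw [hI₂] at hn
    obtain ⟨v, hv⟩ := mem_sup_span_singleton.mp hn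
    have h0 : t ^ n * a - t ^ p * (v * l) ∈ I₁ := by
      have := I₁.add_mem hv (I₁.mul_mem_left v h.sub_mem)
      convert this using 1; ring
    suffices a ∈ I₁ ⊔ Ideal.span {l} from
      sup_le_sup_right (c := Ideal.span {l}) le_sup_left this
    rcases le_total n p with hnp | hnp
    · obtain ⟨k, rfl⟩ := Nat.exists_eq_add_of_le hnp
      refine mem_sup_span_singleton.mpr ⟨t ^ k * v, hreg₁.pow n _ ?_⟩
      convert h0 using 1; ring
    · obtain ⟨k, rfl⟩ := Nat.exists_eq_add_of_le hnp
      have h1 : t ^ k * a - v * l ∈ I₁ := hreg₁.pow p _ (by convert h0 using 1; ring)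
      clear h0 hv hn hnp
      induction k generalizing v with
      | zero => exact mem_sup_span_singleton.mpr ⟨v, by simpa using h1⟩
      | succ k ih =>
        have hvl : v * l ∈ K := by
          rw [← h₁]
          refine mem_sup_span_singleton.mpr ⟨t ^ k * a, ?_⟩
          have := I₁.neg_mem h1
          convert this using 1; ring
        have hv := (hK.mem_or_mem hvl).resolve_right h.notMem
        rw [← h₁] at hv
        obtain ⟨w, hw⟩ := mem_sup_span_singleton.mp hv
        refine ih w (hreg₁ _ ?_)
        have := I₁.add_mem h1 (I₁.mul_mem_left l hw)
        convert this using 1; ring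
  · intro ha
    obtain ⟨w, hw⟩ := mem_sup_span_singleton.mp ha
    refine ⟨p, ?_⟩
    have := Ideal.add_mem _ (Ideal.mul_mem_left _ (t ^ p) hw) (Ideal.mul_mem_left _ w hpl)
    convert this using 1; ring

end IsContact

/-- Transversal intersection: if `I₁ ⊔ I₂` and `t` generate the maximal ideal, then `I₁ ⊔ I₂`
is generated modulo `I₁` by one element. -/
theorem exists_sup_eq_sup_span {I₁ I₂ : Ideal A} {t u : A}
    (hm₁ : maximalIdeal A = I₁ ⊔ Ideal.span {t} ⊔ Ideal.span {u})
    (hm : maximalIdeal A = I₁ ⊔ I₂ ⊔ Ideal.span {t}) (ht : ∀ n : ℕ, t ^ n ∉ I₁ ⊔ I₂) :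
    ∃ e ∈ I₂, I₁ ⊔ I₂ = I₁ ⊔ Ideal.span {e} := by
  have hu : u ∈ I₁ ⊔ Ideal.span {t} ⊔ I₂ := by
    rw [sup_right_comm, ← hm, hm₁]
    exact Ideal.mem_sup_right (Ideal.mem_span_singleton_self u)
  -- The part `e` of `u` lying in `I₂` can replace `u`: together with `I₁` and `t` it still
  -- generates the maximal ideal.
  obtain ⟨k, hk, e, he, rfl⟩ := Submodule.mem_sup.mp hu
  have hle : I₁ ⊔ Ideal.span {e} ≤ I₁ ⊔ I₂ :=
    sup_le_sup_left ((Ideal.span_singleton_le_iff_mem _).mpr he) _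
  refine ⟨e, he, (eq_of_le_of_maximalIdeal_eq_sup (u := t) hle ?_ ht).symm⟩
  apply le_antisymm
  · rw [hm₁, sup_right_comm I₁ (Ideal.span {e})]
    refine sup_le le_sup_left ((Ideal.span_singleton_le_iff_mem _).mpr (Ideal.add_mem _ ?_ ?_))
    · exact Ideal.mem_sup_left hk
    · exact Ideal.mem_sup_right (Ideal.mem_span_singleton_self e)
  · rw [hm]
    exact sup_le_sup_right hle _

theorem eq_span_of_sup_eq_sup_span {R : Type*} [CommRing R] {I₁ I₂ : Ideal R} {e : R} (he : e ∈ I₂)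
    (h : I₁ ⊔ I₂ = I₁ ⊔ Ideal.span {e}) (hinf : I₁ ⊓ I₂ = ⊥) : I₂ = Ideal.span {e} := by
  refine le_antisymm (fun a ha => ?_) ((Ideal.span_singleton_le_iff_mem _).mpr he)
  obtain ⟨v, hv⟩ := mem_sup_span_singleton.mp (h.le (Ideal.mem_sup_right ha))
  have : a - v * e ∈ I₁ ⊓ I₂ := ⟨hv, I₂.sub_mem ha (I₂.mul_mem_left _ he)⟩
  rw [hinf, Ideal.mem_bot, sub_eq_zero] at this
  exact this ▸ Ideal.mul_mem_left _ _ (Ideal.mem_span_singleton_self e)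

/-- When the fibre `t = 0` of the union of `V(I₁)` and `V(I₂)` is reduced, `t` is not nilpotent on
the intersection. -/
theorem pow_notMem_sup_of_isRadical {R : Type*} [CommRing R] {I₁ I₂ : Ideal R} {t : R}
    (hne : I₁ ⊔ I₂ ≠ ⊤) (hinf : I₁ ⊓ I₂ = ⊥) (hreg₁ : IsRegularMod I₁ t)
    (hreg₂ : IsRegularMod I₂ t) (hrad : (Ideal.span {t}).IsRadical) (n : ℕ) :
    t ^ n ∉ I₁ ⊔ I₂ := by
  induction n with
  | zero => simpa using (Ideal.ne_top_iff_one _).mp hne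
  | succ n ih =>
    intro h
    obtain ⟨a, ha, b, hb, hab⟩ := Submodule.mem_sup.mp h
    have hmul : ∀ {a b : R}, a ∈ I₁ → b ∈ I₂ → a * b = 0 := fun {a b} ha hb => by
      have : a * b ∈ I₁ ⊓ I₂ := ⟨I₁.mul_mem_right _ ha, I₂.mul_mem_left _ hb⟩
      rwa [hinf, Ideal.mem_bot] at this
    -- Since `a * b = 0`, one has `a ^ 2 = a * (a + b) = a * t ^ (n + 1)`, so radicality of `(t)`
    -- gives `a ∈ (t)`; likewise for `b`.
    have ha' : a ∈ Ideal.span {t} := hrad ⟨2, by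
      have : a ^ 2 = (a * t ^ n) * t := by linear_combination a * hab - hmul ha hb
      rw [this]; exact Ideal.mul_mem_left _ _ (Ideal.mem_span_singleton_self t)⟩
    have hb' : b ∈ Ideal.span {t} := hrad ⟨2, by
      have : b ^ 2 = (b * t ^ n) * t := by linear_combination b * hab - hmul ha hb
      rw [this]; exact Ideal.mul_mem_left _ _ (Ideal.mem_span_singleton_self t)⟩
    obtain ⟨c, rfl⟩ := Ideal.mem_span_singleton.mp ha'
    obtain ⟨d, rfl⟩ := Ideal.mem_span_singleton.mp hb'
    -- Regularity of `t` modulo both ideals, together with `I₁ ∩ I₂ = 0`, makes `t` a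
    -- nonzerodivisor, so it can be cancelled and the exponent drops by one.
    have hz : t ^ n - (c + d) = 0 := by
      have h0 : t * (t ^ n - (c + d)) = 0 := by linear_combination -hab
      have : t ^ n - (c + d) ∈ I₁ ⊓ I₂ := ⟨hreg₁ _ (by rw [h0]; exact zero_mem _),
        hreg₂ _ (by rw [h0]; exact zero_mem _)⟩
      rwa [hinf, Ideal.mem_bot] at this
    rw [sub_eq_zero] at hz
    exact ih (hz ▸ Ideal.add_mem _ (Ideal.mem_sup_left (hreg₁ _ ha))
      (Ideal.mem_sup_right (hreg₂ _ hb)))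

end LocalAlgebra

/-! ### Local form of a glued scheme at a point -/

/-- Elements presenting two subschemes `V(I₁)`, `V(I₂)` glued along `V(J)`, and the center `V(Z)`
whose blowing-up is the gluing. -/
structure IsGluingChart {R : Type*} [CommRing R] (I₁ I₂ J Z : Ideal R) (e e' s l : R) : Prop where
  eq₁ : I₁ = Ideal.span {e'}
  eq₂ : I₂ = Ideal.span {e}
  inf : I₁ ⊓ I₂ = ⊥
  add : e + e' = s * l
  glue : J = I₁ ⊔ I₂ ⊔ Ideal.span {s}
  center : Z = I₁ ⊔ I₂ ⊔ Ideal.span {l}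
  regular₁ : IsRegularMod I₁ l
  regular₂ : IsRegularMod I₂ l
  regular : IsRegularMod I₁ s

/-! ### Spreading out from a localization -/

section SpreadingOut

variable {R : Type*} [CommRing R] (m : Ideal R) [m.IsPrime]
  (A : Type*) [CommRing A] [Algebra R A] [IsLocalization.AtPrime A m]

/-- Each of the finitely many generators of `K` needs one denominator, and their product serves for
all. Phrasing the conclusion inside `R` lets it be used in any ring where `f` becomes invertible. -/
theorem exists_notMem_forall_mul_mem {K L : Ideal R} (hK : K.FG)
    (h : K.map (algebraMap R A) ≤ L.map (algebraMap R A)) : ∃ f ∉ m, ∀ r ∈ K, f * r ∈ L := by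
  classical
  obtain ⟨s, rfl⟩ := hK
  have key : ∀ r ∈ s, ∃ f ∉ m, f * r ∈ L := by
    intro r hr
    have : algebraMap R A r ∈ L.map (algebraMap R A) :=
      h (Ideal.mem_map_of_mem _ (Ideal.subset_span hr))
    obtain ⟨f, hf, hfr⟩ :=
      (IsLocalization.algebraMap_mem_map_algebraMap_iff m.primeCompl A L r).mp this
    exact ⟨f, hf, hfr⟩
  choose! f hf hfr using key
  refine ⟨∏ r ∈ s, f r, ?_, ?_⟩
  · have : ∏ r ∈ s, f r ∈ m.primeCompl := prod_mem fun r hr => hf r hr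
    exact this
  · intro r hr
    have : Ideal.span (s : Set R) ≤ Submodule.comap (LinearMap.mulLeft R (∏ r ∈ s, f r)) L := by
      rw [Ideal.span_le]
      intro x hx
      change (∏ r ∈ s, f r) * x ∈ L
      rw [← Finset.prod_erase_mul s f hx, mul_assoc]
      exact L.mul_mem_left _ (hfr x hx)
    exact this hr

theorem exists_notMem_forall_list [IsNoetherianRing R] (l : List (Ideal R × Ideal R))
    (h : ∀ q ∈ l, q.1.map (algebraMap R A) ≤ q.2.map (algebraMap R A)) :
    ∃ f ∉ m, ∀ q ∈ l, ∀ r ∈ q.1, f * r ∈ q.2 := by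
  induction l with
  | nil => exact ⟨1, m.primeCompl.one_mem, by simp⟩
  | cons q l ih =>
    obtain ⟨f, hf, hfl⟩ := ih fun q hq => h q (List.mem_cons_of_mem _ hq)
    obtain ⟨g, hg, hgq⟩ := exists_notMem_forall_mul_mem m A (IsNoetherian.noetherian q.1)
      (h q List.mem_cons_self)
    refine ⟨f * g, m.primeCompl.mul_mem hf hg, fun q' hq' r hr => ?_⟩
    rcases List.mem_cons.mp hq' with rfl | hq'
    · rw [mul_assoc]; exact Ideal.mul_mem_left _ _ (hgq r hr)
    · rw [mul_right_comm]; exact Ideal.mul_mem_right _ _ (hfl q' hq' r hr)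

theorem map_le_map_of_forall_mul_mem {S : Type*} [CommRing S] [Algebra R S] {f : R}
    (hf : IsUnit (algebraMap R S f)) {K L : Ideal R} (h : ∀ r ∈ K, f * r ∈ L) :
    K.map (algebraMap R S) ≤ L.map (algebraMap R S) := by
  rw [Ideal.map_le_iff_le_comap]
  intro r hr
  refine Ideal.mem_comap.mpr ((Ideal.unit_mul_mem_iff_mem _ hf).mp ?_)
  rw [← map_mul]
  exact Ideal.mem_map_of_mem _ (h r hr)

/-- The ideal of elements multiplied by `l` into `I`. -/
def colonElement (I : Ideal R) (l : R) : Ideal R := Submodule.comap (LinearMap.mulLeft R l) I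

/-- Turns regularity into an inclusion of extended ideals, so that it spreads out from a
localization in the same way as the other conditions of a chart. -/
theorem isRegularMod_map_iff (M : Submonoid R) {S : Type*} [CommRing S] [Algebra R S]
    [IsLocalization M S] (I : Ideal R) (l : R) :
    IsRegularMod (I.map (algebraMap R S)) (algebraMap R S l) ↔
      (colonElement I l).map (algebraMap R S) ≤ I.map (algebraMap R S) := by
  constructor
  · intro h
    rw [Ideal.map_le_iff_le_comap]
    intro r hr
    refine h _ ?_
    rw [← map_mul]
    exact Ideal.mem_map_of_mem _ hr
  · intro h a ha
    obtain ⟨⟨r, s⟩, hrs⟩ := IsLocalization.surj M a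
    dsimp only at hrs
    have hlr : algebraMap R S (l * r) ∈ I.map (algebraMap R S) := by
      rw [map_mul, ← hrs, ← mul_assoc]
      exact Ideal.mul_mem_right _ _ ha
    obtain ⟨c, hc, hcr⟩ := (IsLocalization.algebraMap_mem_map_algebraMap_iff M S I _).mp hlr
    have hcr' : c * r ∈ colonElement I l := by
      change l * (c * r) ∈ I
      rwa [mul_left_comm]
    have h1 := h (Ideal.mem_map_of_mem (algebraMap R S) hcr')
    rw [map_mul, ← hrs, mul_left_comm, mul_comm] at h1
    have hu : IsUnit (algebraMap R S c * algebraMap R S s) :=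
      (IsLocalization.map_units S ⟨c, hc⟩).mul (IsLocalization.map_units S s)
    refine (Ideal.unit_mul_mem_iff_mem _ hu).mp ?_
    convert h1 using 1

theorem IsRegularMod.unit_mul {I : Ideal R} {l w : R} (h : IsRegularMod I l) (hw : IsUnit w) :
    IsRegularMod I (w * l) := fun a ha =>
  h a ((Ideal.unit_mul_mem_iff_mem I hw).mp (by rwa [← mul_assoc]))

/-- Scaling `s` and `l` by `w` forces the factor `w * w` on `e` and `e'`, to preserve `e + e' = s *
l`. This serves to clear denominators. -/
theorem IsGluingChart.unit_mul {I₁ I₂ J Z : Ideal R} {e e' s l w : R}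
    (h : IsGluingChart I₁ I₂ J Z e e' s l) (hw : IsUnit w) :
    IsGluingChart I₁ I₂ J Z (w * w * e) (w * w * e') (w * s) (w * l) where
  eq₁ := by rw [Ideal.span_singleton_mul_left_unit (hw.mul hw)]; exact h.eq₁
  eq₂ := by rw [Ideal.span_singleton_mul_left_unit (hw.mul hw)]; exact h.eq₂
  inf := h.inf
  add := by linear_combination w * w * h.add
  glue := by rw [Ideal.span_singleton_mul_left_unit hw]; exact h.glue
  center := by rw [Ideal.span_singleton_mul_left_unit hw]; exact h.center
  regular₁ := h.regular₁.unit_mul hw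
  regular₂ := h.regular₂.unit_mul hw
  regular := h.regular.unit_mul hw

/-- After clearing denominators, all conditions except `I₁ ∩ I₂ = 0` are finitely many inclusions of
ideals; the relation `e + e' = s * l` is the inclusion of the ideal of the difference in `⊥`. A
single `f` handles them all. -/
theorem IsGluingChart.exists_away [IsNoetherianRing R] {I₁ I₂ J Z : Ideal R} {e e' s l : A}
    (h : IsGluingChart (I₁.map (algebraMap R A)) (I₂.map (algebraMap R A))
      (J.map (algebraMap R A)) (Z.map (algebraMap R A)) e e' s l) :
    ∃ f ∉ m, ∀ (S : Type*) [CommRing S] [Algebra R S] [IsLocalization.Away f S],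
      I₁.map (algebraMap R S) ⊓ I₂.map (algebraMap R S) = ⊥ → ∃ e e' s l : S,
        IsGluingChart (I₁.map (algebraMap R S)) (I₂.map (algebraMap R S))
          (J.map (algebraMap R S)) (Z.map (algebraMap R S)) e e' s l := by
  classical
  obtain ⟨b, hb⟩ := IsLocalization.exist_integer_multiples_of_finset (R := R) m.primeCompl
    ({e, e', s, l} : Finset A)
  have hint : ∀ a ∈ ({e, e', s, l} : Finset A), ∃ r : R,
      algebraMap R A r = algebraMap R A b * a := by
    intro a ha
    obtain ⟨r, hr⟩ := hb a ha
    exact ⟨r, by rw [hr]; exact Algebra.smul_def _ _⟩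
  obtain ⟨e₀, he₀⟩ := hint e (by simp)
  obtain ⟨e₀', he₀'⟩ := hint e' (by simp)
  obtain ⟨s₀, hs₀⟩ := hint s (by simp)
  obtain ⟨l₀, hl₀⟩ := hint l (by simp)
  replace h := h.unit_mul (IsLocalization.map_units A b)
  rw [mul_assoc, mul_assoc, ← he₀, ← he₀', ← hs₀, ← hl₀, ← map_mul, ← map_mul] at h
  have hadd : algebraMap R A (b * e₀ + b * e₀' - s₀ * l₀) = 0 := by
    rw [map_sub, map_add, map_mul _ s₀, h.add, sub_self]
  have hspan : ∀ r : R, (Ideal.span {r}).map (algebraMap R A) = Ideal.span {algebraMap R A r} :=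
    fun r => by rw [Ideal.map_span, Set.image_singleton]
  obtain ⟨f, hf, hfl⟩ := exists_notMem_forall_list m A
    [(I₁, Ideal.span {b * e₀'}), (Ideal.span {b * e₀'}, I₁), (I₂, Ideal.span {b * e₀}),
      (Ideal.span {b * e₀}, I₂), (J, I₁ ⊔ I₂ ⊔ Ideal.span {s₀}), (I₁ ⊔ I₂ ⊔ Ideal.span {s₀}, J),
      (Z, I₁ ⊔ I₂ ⊔ Ideal.span {l₀}), (I₁ ⊔ I₂ ⊔ Ideal.span {l₀}, Z),
      (colonElement I₁ l₀, I₁), (colonElement I₂ l₀, I₂), (colonElement I₁ s₀, I₁),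
      (Ideal.span {b * e₀ + b * e₀' - s₀ * l₀}, ⊥)] (by
    simp only [List.forall_mem_cons, Ideal.map_sup, hspan]
    refine ⟨h.eq₁.le, h.eq₁.ge, h.eq₂.le, h.eq₂.ge, h.glue.le, h.glue.ge, h.center.le,
      h.center.ge, ?_, ?_, ?_, ?_, by simp⟩
    · exact (isRegularMod_map_iff m.primeCompl _ _).mp h.regular₁
    · exact (isRegularMod_map_iff m.primeCompl _ _).mp h.regular₂
    · exact (isRegularMod_map_iff m.primeCompl _ _).mp h.regular
    · rw [hadd]; simp)
  refine ⟨f, hf, fun S _ _ _ hinf => ⟨algebraMap R S (b * e₀), algebraMap R S (b * e₀'),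
    algebraMap R S s₀, algebraMap R S l₀, ?_⟩⟩
  have hfS : IsUnit (algebraMap R S f) := IsLocalization.Away.algebraMap_isUnit f
  have hspan' : ∀ r : R, (Ideal.span {r}).map (algebraMap R S) = Ideal.span {algebraMap R S r} :=
    fun r => by rw [Ideal.map_span, Set.image_singleton]
  replace hfl := fun q hq => map_le_map_of_forall_mul_mem hfS (hfl q hq)
  simp only [List.forall_mem_cons, Ideal.map_sup, hspan'] at hfl
  obtain ⟨k₁, k₂, k₃, k₄, k₅, k₆, k₇, k₈, k₉, k₁₀, k₁₁, k₁₂, -⟩ := hfl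
  refine ⟨le_antisymm k₁ k₂, le_antisymm k₃ k₄, hinf, ?_, le_antisymm k₅ k₆, le_antisymm k₇ k₈,
    (isRegularMod_map_iff (.powers f) _ _).mpr k₉, (isRegularMod_map_iff (.powers f) _ _).mpr k₁₀,
    (isRegularMod_map_iff (.powers f) _ _).mpr k₁₁⟩
  rw [← map_add, ← map_mul, ← sub_eq_zero, ← map_sub]
  simpa using k₁₂

end SpreadingOut

/-! ### The universal property of a gluing chart -/

section UniversalProperty

variable {R : Type} [CommRing R] {I₁ I₂ J Z : Ideal R} {h₁ : I₁ ≤ J} {h₂ : I₂ ≤ J} {e e' s l : R}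

namespace IsGluingChart

theorem mem_nonZeroDivisors (h : IsGluingChart I₁ I₂ J Z e e' s l) :
    toGluedRing h₁ h₂ l ∈ nonZeroDivisors (gluedRing h₁ h₂) := by
  rw [mem_nonZeroDivisors_iff_left]
  rintro ⟨⟨a, b⟩, hab⟩ h0
  obtain ⟨a, rfl⟩ := Ideal.Quotient.mk_surjective a
  obtain ⟨b, rfl⟩ := Ideal.Quotient.mk_surjective b
  have h0' := congrArg Subtype.val h0
  have ha : Ideal.Quotient.mk I₁ (l * a) = 0 := congrArg Prod.fst h0'
  have hb : Ideal.Quotient.mk I₂ (l * b) = 0 := congrArg Prod.snd h0'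
  rw [Ideal.Quotient.eq_zero_iff_mem] at ha hb
  refine Subtype.ext (Prod.ext ?_ ?_)
  · exact Ideal.Quotient.eq_zero_iff_mem.mpr (h.regular₁ _ ha)
  · exact Ideal.Quotient.eq_zero_iff_mem.mpr (h.regular₂ _ hb)

/-- As `s ∈ J`, the pairs `(s, 0)` and `(0, s)` belong to the glued ring, and `e = l * (s, 0)`, `e'
= l * (0, s)`. -/
theorem map_center_eq (h : IsGluingChart I₁ I₂ J Z e e' s l) :
    Z.map (toGluedRing h₁ h₂) = Ideal.span {toGluedRing h₁ h₂ l} := by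
  have hs : s ∈ J := by
    rw [h.glue]; exact Ideal.mem_sup_right (Ideal.mem_span_singleton_self s)
  have he : e ∈ I₂ := h.eq₂ ▸ Ideal.mem_span_singleton_self e
  have he' : e' ∈ I₁ := h.eq₁ ▸ Ideal.mem_span_singleton_self e'
  have hspan : ∀ r : R, (Ideal.span {r}).map (toGluedRing h₁ h₂) =
      Ideal.span {toGluedRing h₁ h₂ r} := fun r => by rw [Ideal.map_span, Set.image_singleton]
  have hZ : Z.map (toGluedRing h₁ h₂) = Ideal.span {toGluedRing h₁ h₂ e'} ⊔
      Ideal.span {toGluedRing h₁ h₂ e} ⊔ Ideal.span {toGluedRing h₁ h₂ l} := by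
    rw [← hspan, ← hspan, ← hspan, ← Ideal.map_sup, ← Ideal.map_sup]
    exact congrArg _ (h.center.trans (by rw [← h.eq₁, ← h.eq₂]))
  rw [hZ]
  refine sup_eq_right.mpr (sup_le ?_ ?_)
  · rw [Ideal.span_singleton_le_span_singleton]
    refine ⟨⟨(0, Ideal.Quotient.mk I₂ s), ?_⟩, Subtype.ext (Prod.ext ?_ ?_)⟩
    · change Ideal.Quotient.mk J 0 = Ideal.Quotient.mk J s
      rw [Ideal.Quotient.eq, zero_sub]; exact J.neg_mem hs
    · change Ideal.Quotient.mk I₁ e' = Ideal.Quotient.mk I₁ (l * 0)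
      rw [Ideal.Quotient.eq, mul_zero, sub_zero]; exact he'
    · change Ideal.Quotient.mk I₂ e' = Ideal.Quotient.mk I₂ (l * s)
      rw [Ideal.Quotient.eq]
      have := I₂.neg_mem he
      convert this using 1
      linear_combination h.add
  · rw [Ideal.span_singleton_le_span_singleton]
    refine ⟨⟨(Ideal.Quotient.mk I₁ s, 0), ?_⟩, Subtype.ext (Prod.ext ?_ ?_)⟩
    · change Ideal.Quotient.mk J s = Ideal.Quotient.mk J 0
      rw [Ideal.Quotient.eq, sub_zero]; exact hs
    · change Ideal.Quotient.mk I₁ e = Ideal.Quotient.mk I₁ (l * s)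
      rw [Ideal.Quotient.eq]
      have := I₁.neg_mem he'
      convert this using 1
      linear_combination h.add
    · change Ideal.Quotient.mk I₂ e = Ideal.Quotient.mk I₂ (l * 0)
      rw [Ideal.Quotient.eq, mul_zero, sub_zero]; exact he

theorem toGluedRing_injective (h : IsGluingChart I₁ I₂ J Z e e' s l) :
    Function.Injective (toGluedRing h₁ h₂) := by
  rw [injective_iff_map_eq_zero]
  intro r hr
  have hr' := congrArg Subtype.val hr
  have h1 : Ideal.Quotient.mk I₁ r = 0 := congrArg Prod.fst hr'
  have h2 : Ideal.Quotient.mk I₂ r = 0 := congrArg Prod.snd hr'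
  rw [Ideal.Quotient.eq_zero_iff_mem] at h1 h2
  have : r ∈ I₁ ⊓ I₂ := ⟨h1, h2⟩
  rwa [h.inf, Ideal.mem_bot] at this

/-- For a pair `(a, b)` write `a - b = i₁ + i₂ + c * s`. Modulo `I₁` the product `l * s` equals `e`,
while `e` vanishes modulo `I₂`, so `l * (b + i₂) + c * e` represents `l * (a, b)`. Thus `l`
multiplies the glued ring into `R`. -/
theorem exists_toGluedRing_eq_mul (h : IsGluingChart I₁ I₂ J Z e e' s l) (b : gluedRing h₁ h₂) :
    ∃ x c : R, toGluedRing h₁ h₂ (l * x + c * e) = toGluedRing h₁ h₂ l * b := by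
  obtain ⟨⟨a, b⟩, hab⟩ := b
  obtain ⟨a, rfl⟩ := Ideal.Quotient.mk_surjective a
  obtain ⟨b, rfl⟩ := Ideal.Quotient.mk_surjective b
  replace hab : a - b ∈ J := Ideal.Quotient.eq.mp hab
  have he : e ∈ I₂ := h.eq₂ ▸ Ideal.mem_span_singleton_self e
  have he' : e' ∈ I₁ := h.eq₁ ▸ Ideal.mem_span_singleton_self e'
  rw [h.glue] at hab
  obtain ⟨c, hc⟩ := mem_sup_span_singleton.mp hab
  obtain ⟨i₁, hi₁, i₂, hi₂, hi⟩ := Submodule.mem_sup.mp hc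
  refine ⟨b + i₂, c, Subtype.ext (Prod.ext ?_ ?_)⟩
  · change Ideal.Quotient.mk I₁ (l * (b + i₂) + c * e) = Ideal.Quotient.mk I₁ (l * a)
    rw [Ideal.Quotient.eq]
    have := I₁.neg_mem (I₁.add_mem (I₁.mul_mem_left l hi₁) (I₁.mul_mem_left c he'))
    convert this using 1
    linear_combination l * hi + c * h.add
  · change Ideal.Quotient.mk I₂ (l * (b + i₂) + c * e) = Ideal.Quotient.mk I₂ (l * b)
    rw [Ideal.Quotient.eq]
    have := I₂.add_mem (I₂.mul_mem_left l hi₂) (I₂.mul_mem_left c he)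
    convert this using 1
    ring

/-- If the center becomes invertible, then it is generated by `l`. -/
theorem map_center_eq_of_eq_span (h : IsGluingChart I₁ I₂ J Z e e' s l) {O : Type*} [CommRing O]
    (φ : R →+* O) {a : O} (ha : a ∈ nonZeroDivisors O) (haZ : Z.map φ = Ideal.span {a}) :
    φ l ∈ nonZeroDivisors O ∧ φ l ∣ φ e := by
  have hZ : Ideal.span {φ e', φ e, φ l} = Ideal.span {a} := by
    rw [← haZ, h.center, h.eq₁, h.eq₂, ← Ideal.span_union, ← Ideal.span_union, Ideal.map_span]
    congr 1
    ext x
    simp [Set.image_insert_eq, or_comm, or_left_comm, or_assoc]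
  have hd : ∀ x ∈ ({φ e', φ e, φ l} : Set O), ∃ y, x = a * y := fun x hx =>
    Ideal.mem_span_singleton.mp (hZ ▸ Ideal.subset_span hx)
  obtain ⟨y', hy'⟩ := hd (φ e') (by simp)
  obtain ⟨y, hy⟩ := hd (φ e) (by simp)
  obtain ⟨z, hz⟩ := hd (φ l) (by simp)
  have haa : a ∈ Ideal.span {φ e', φ e, φ l} := hZ ▸ Ideal.mem_span_singleton_self a
  obtain ⟨c₁, c₂, c₃, hc⟩ := Submodule.mem_span_triple.mp haa
  simp only [smul_eq_mul] at hc
  have hcancel : ∀ {x y : O}, a * x = a * y → x = y := fun hxy =>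
    (mul_cancel_left_mem_nonZeroDivisors ha).mp hxy
  -- The relations among `e`, `e'` and `l` are divided by the nonzerodivisor `a`; the product
  -- relation `e * e' = 0` is divided by it twice.
  have k₁ : c₁ * y' + c₂ * y + c₃ * z = 1 := hcancel (by
    rw [mul_one]; linear_combination hc - c₁ * hy' - c₂ * hy - c₃ * hz)
  have k₂ : y + y' = φ s * z := hcancel (by
    have := congrArg φ h.add
    rw [map_add, map_mul] at this
    linear_combination this - hy - hy' + φ s * hz)
  have k₃ : y * y' = 0 := hcancel (hcancel (by
    have h0 : e * e' ∈ I₁ ⊓ I₂ := ⟨I₁.mul_mem_left _ (h.eq₁ ▸ Ideal.mem_span_singleton_self e'),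
      I₂.mul_mem_right _ (h.eq₂ ▸ Ideal.mem_span_singleton_self e)⟩
    rw [h.inf, Ideal.mem_bot] at h0
    have := congrArg φ h0
    rw [map_mul, map_zero, hy, hy'] at this
    linear_combination this))
  -- Since `y * y' = 0`, both `y ^ 2` and `y' ^ 2` are multiples of `z`. Squaring `c₁ * y' + c₂ * y
  -- = 1 - c₃ * z` therefore exhibits `1` as a multiple of `z`, and the cofactor is the witness.
  have hzu : IsUnit z := by
    refine .of_mul_eq_one (c₁ ^ 2 * y' * φ s + c₂ ^ 2 * y * φ s + c₃ * (2 - c₃ * z)) ?_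
    have k₄ : y' ^ 2 = φ s * z * y' := by linear_combination y' * k₂ - k₃
    have k₅ : y ^ 2 = φ s * z * y := by linear_combination y * k₂ - k₃
    linear_combination (-c₁ ^ 2) * k₄ - c₂ ^ 2 * k₅ - 2 * c₁ * c₂ * k₃ +
      (c₁ * y' + c₂ * y + 1 - c₃ * z) * k₁
  refine ⟨hz ▸ mul_mem ha hzu.mem_nonZeroDivisors, ?_⟩
  rw [hz, hy]
  exact mul_dvd_mul_left a hzu.dvd

/-- The gluing is universal among the morphisms making the center invertible. -/
theorem existsUnique_lift (h : IsGluingChart I₁ I₂ J Z e e' s l) {O : Type*} [CommRing O]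
    (φ : R →+* O) {a : O} (ha : a ∈ nonZeroDivisors O) (haZ : Z.map φ = Ideal.span {a}) :
    ∃! ψ : gluedRing h₁ h₂ →+* O, ψ.comp (toGluedRing h₁ h₂) = φ := by
  obtain ⟨hl, hle⟩ := h.map_center_eq_of_eq_span φ ha haZ
  have hcancel : ∀ {x y : O}, φ l * x = φ l * y → x = y := fun hxy =>
    (mul_cancel_left_mem_nonZeroDivisors hl).mp hxy
  -- The value at `b` is the quotient `φ (l * b) / φ l`. It exists because `φ l` divides `φ e`, and
  -- it is independent of the representative because `R` embeds in the glued ring.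
  have hex : ∀ b : gluedRing h₁ h₂, ∃ o : O,
      ∀ r, toGluedRing h₁ h₂ r = toGluedRing h₁ h₂ l * b → φ l * o = φ r := by
    intro b
    obtain ⟨x, c, hxc⟩ := h.exists_toGluedRing_eq_mul b
    obtain ⟨y, hy⟩ := hle
    refine ⟨φ x + φ c * y, fun r hr => ?_⟩
    rw [h.toGluedRing_injective (hr.trans hxc.symm), map_add, map_mul, map_mul, hy]
    ring
  choose ψ hψ using hex
  have hex : ∀ b : gluedRing h₁ h₂, ∃ r, toGluedRing h₁ h₂ r = toGluedRing h₁ h₂ l * b := fun b =>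
    have ⟨x, c, hxc⟩ := h.exists_toGluedRing_eq_mul b
    ⟨_, hxc⟩
  have hψφ : ∀ r, ψ (toGluedRing h₁ h₂ r) = φ r := fun r => hcancel (by
    rw [hψ _ (l * r) (by rw [map_mul]), map_mul])
  refine ⟨{ toFun := ψ, map_one' := ?_, map_mul' := ?_, map_zero' := ?_, map_add' := ?_ },
    RingHom.ext hψφ, ?_⟩
  · rw [← map_one (toGluedRing h₁ h₂), hψφ, map_one]
  · intro b c
    obtain ⟨r, hr⟩ := hex b
    obtain ⟨r', hr'⟩ := hex c
    -- Each factor of a product needs its own `l` to come from `R`, so two copies of `φ l` are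
    -- cancelled.
    refine hcancel (hcancel ?_)
    have e : φ l * (φ l * (ψ b * ψ c)) = φ l * ψ b * (φ l * ψ c) := by ring
    rw [e, hψ b r hr, hψ c r' hr', ← map_mul]
    obtain ⟨r'', hr''⟩ := hex (b * c)
    rw [hψ _ r'' hr'', ← map_mul]
    congr 1
    refine h.toGluedRing_injective (h₁ := h₁) (h₂ := h₂) ?_
    rw [map_mul, map_mul, hr, hr', hr'']
    ring
  · rw [← map_zero (toGluedRing h₁ h₂), hψφ, map_zero]
  · intro b c
    obtain ⟨r, hr⟩ := hex b
    obtain ⟨r', hr'⟩ := hex c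
    refine hcancel ?_
    rw [hψ (b + c) (r + r') (by rw [map_add, hr, hr', mul_add]), mul_add, hψ b r hr, hψ c r' hr',
      map_add]
  · intro ψ' hψ'
    refine RingHom.ext fun b => hcancel ?_
    obtain ⟨r, hr⟩ := hex b
    change φ l * ψ' b = φ l * ψ b
    rw [hψ b r hr, ← hψ', RingHom.comp_apply, RingHom.comp_apply, hr, map_mul]

end IsGluingChart

end UniversalProperty

/-! ### Inverse images and stalks of ideal sheaves -/

section IdealSheaves

open Scheme Scheme.IdealSheafData TopologicalSpace

variable {X Y : Scheme.{0}}

/-- The whole of an affine scheme, as an affine open subset. -/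
abbrev affineTop (X : Scheme.{0}) [IsAffine X] : X.affineOpens := ⟨⊤, isAffineOpen_top X⟩

theorem exists_affineOpens_mem_le {x : X} {V : X.Opens} (h : x ∈ V) :
    ∃ U : X.affineOpens, x ∈ U.1 ∧ U.1 ≤ V := by
  obtain ⟨_, ⟨W, hW, rfl⟩, hxW, hWV⟩ := X.isBasis_affineOpens.exists_subset_of_mem_open h V.2
  exact ⟨⟨W, hW⟩, hxW, hWV⟩

theorem exists_affineOpens_mem (x : X) : ∃ U : X.affineOpens, x ∈ U.1 :=
  have ⟨U, hU, _⟩ := exists_affineOpens_mem_le (V := ⊤) (show x ∈ (⊤ : X.Opens) from trivial)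
  ⟨U, hU⟩

theorem ofIdealTop_ideal_top [IsAffine X] (I : Ideal Γ(X, ⊤)) :
    (ofIdealTop I).ideal (affineTop X) = I :=
  (equivOfIsAffine (X := X)).apply_symm_apply I

/-- Between affine schemes the direct image of ideal sheaves is contraction of ideals; its left
adjoint, the inverse image, must be extension. -/
theorem ideal_comap_top [IsAffine X] [IsAffine Y] (I : Y.IdealSheafData) (f : X ⟶ Y) :
    (I.comap f).ideal (affineTop X) = (I.ideal (affineTop Y)).map f.appTop.hom := by
  have hmap : ∀ K : X.IdealSheafData, (K.map f).ideal (affineTop Y) =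
      (K.ideal (affineTop X)).comap f.appTop.hom := fun K =>
    ideal_map K f (affineTop Y) (isAffineOpen_top X)
  apply le_antisymm
  · have h : I.comap f ≤ ofIdealTop ((I.ideal (affineTop Y)).map f.appTop.hom) := by
      rw [← le_map_iff_comap_le]
      refine le_of_isAffine ?_
      rw [hmap, ← Ideal.map_le_iff_le_comap]
      exact (ofIdealTop_ideal_top _).ge
    exact (h _).trans (ofIdealTop_ideal_top _).le
  · rw [Ideal.map_le_iff_le_comap, ← hmap]
    exact I.le_map_comap f _

theorem ideal_comap_image (I : Y.IdealSheafData) (j : X ⟶ Y) [IsOpenImmersion j]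
    (U : X.affineOpens) (V : Y.affineOpens) (hV : V.1 = j ''ᵁ U.1) (e : U.1 ≤ j ⁻¹ᵁ V.1) :
    (I.comap j).ideal U = (I.ideal V).map (j.appLE V.1 U.1 e).hom := by
  obtain ⟨V, hVa⟩ := V
  subst hV
  rw [ideal_comap_of_isOpenImmersion, ← Hom.appIso_hom']
  exact Ideal.comap_symm (j.appIso U.1).commRingCatIsoToRingEquiv

/-- Restriction of `f` to `V ⟶ U` reduces to the affine case. The two ideals are compared on `V` as
a scheme, whose global sections are isomorphic to `Γ(X, V)`. -/
theorem ideal_comap (I : Y.IdealSheafData) (f : X ⟶ Y) (V : X.affineOpens) (U : Y.affineOpens)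
    (e : V.1 ≤ f ⁻¹ᵁ U.1) :
    (I.comap f).ideal V = (I.ideal U).map (f.appLE U.1 V.1 e).hom := by
  have : IsAffine V.1.toScheme := V.2
  have : IsAffine U.1.toScheme := U.2
  have hc : (I.comap f).comap V.1.ι = (I.comap U.1.ι).comap (f.resLE U.1 V.1 e) := by
    rw [← comap_comp, ← comap_comp, Hom.resLE_comp_ι]
  have h1 : ((I.comap f).comap V.1.ι).ideal (affineTop V.1) =
      ((I.comap U.1.ι).comap (f.resLE U.1 V.1 e)).ideal (affineTop V.1) := by rw [hc]
  have eU : (⊤ : U.1.toScheme.Opens) ≤ U.1.ι ⁻¹ᵁ U.1 := by simp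
  have eV : (⊤ : V.1.toScheme.Opens) ≤ V.1.ι ⁻¹ᵁ V.1 := by simp
  rw [ideal_comap_top (I.comap U.1.ι), ideal_comap_image I U.1.ι (affineTop _) U (by simp) eU,
    ideal_comap_image _ V.1.ι (affineTop _) V (by simp) eV, Ideal.map_map,
    ← CommRingCat.hom_comp] at h1
  have h2 : U.1.ι.appLE U.1 ⊤ eU ≫ (f.resLE U.1 V.1 e).appTop =
      f.appLE U.1 V.1 e ≫ V.1.ι.appLE V.1 ⊤ eV := by
    have e' : (⊤ : V.1.toScheme.Opens) ≤ (f.resLE U.1 V.1 e) ⁻¹ᵁ ⊤ := le_rfl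
    have h3 : (f.resLE U.1 V.1 e).appTop = (f.resLE U.1 V.1 e).appLE ⊤ ⊤ e' :=
      (Hom.appLE_eq_app ..).symm
    rw [h3, Hom.appLE_comp_appLE, Hom.appLE_comp_appLE]
    simp only [Hom.resLE_comp_ι]
  rw [h2, CommRingCat.hom_comp, ← Ideal.map_map] at h1
  have hb : Function.Bijective (V.1.ι.appLE V.1 ⊤ eV).hom := by
    have : IsIso (V.1.ι.appLE V.1 ⊤ eV) := by
      rw [show V.1.ι.appLE V.1 ⊤ eV = V.1.topIso.inv by simp; rfl]
      infer_instance
    exact ConcreteCategory.bijective_of_isIso _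
  have hinj : Function.Injective (Ideal.map (V.1.ι.appLE V.1 ⊤ eV).hom) := fun K L hKL => by
    have : (K.map (V.1.ι.appLE V.1 ⊤ eV).hom).comap (V.1.ι.appLE V.1 ⊤ eV).hom =
      (L.map (V.1.ι.appLE V.1 ⊤ eV).hom).comap (V.1.ι.appLE V.1 ⊤ eV).hom := by rw [hKL]
    rwa [Ideal.comap_map_of_bijective _ hb, Ideal.comap_map_of_bijective _ hb] at this
  exact hinj h1

theorem stalkIdeal_eq_map (I : X.IdealSheafData) {x : X} (U : X.affineOpens) (hx : x ∈ U.1) :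
    stalkIdeal I x = (I.ideal U).map (X.presheaf.germ U.1 x hx).hom := by
  refine le_antisymm (iSup₂_le fun V hV => ?_) (le_iSup₂_of_le U hx le_rfl)
  obtain ⟨W, hxW, hWUV⟩ := exists_affineOpens_mem_le (show x ∈ U.1 ⊓ V.1 from ⟨hx, hV⟩)
  have hWU : W.1 ≤ U.1 := hWUV.trans inf_le_left
  have hWV : W.1 ≤ V.1 := hWUV.trans inf_le_right
  have kU : (I.ideal U).map (X.presheaf.map (homOfLE hWU).op).hom = I.ideal W := I.map_ideal hWU
  have kV : (I.ideal V).map (X.presheaf.map (homOfLE hWV).op).hom = I.ideal W := I.map_ideal hWV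
  rw [← X.presheaf.germ_res (homOfLE hWU) x hxW, ← X.presheaf.germ_res (homOfLE hWV) x hxW,
    CommRingCat.hom_comp, CommRingCat.hom_comp, ← Ideal.map_map, ← Ideal.map_map,
    kU, kV]

theorem stalkIdeal_sup (I J : X.IdealSheafData) (x : X) :
    stalkIdeal (I ⊔ J) x = stalkIdeal I x ⊔ stalkIdeal J x := by
  obtain ⟨U, hU⟩ := exists_affineOpens_mem x
  rw [stalkIdeal_eq_map _ U hU, stalkIdeal_eq_map _ U hU, stalkIdeal_eq_map _ U hU, ← Ideal.map_sup]
  rfl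

theorem stalkIdeal_pow (I : X.IdealSheafData) (n : ℕ) (x : X) :
    stalkIdeal (I ^ n) x = stalkIdeal I x ^ n := by
  obtain ⟨U, hU⟩ := exists_affineOpens_mem x
  rw [stalkIdeal_eq_map _ U hU, stalkIdeal_eq_map _ U hU, ← Ideal.map_pow]
  rfl

theorem stalkIdeal_comap (I : Y.IdealSheafData) (f : X ⟶ Y) (x : X) :
    stalkIdeal (I.comap f) x = (stalkIdeal I (f x)).map (f.stalkMap x).hom := by
  obtain ⟨U, hU⟩ := exists_affineOpens_mem (f x)
  obtain ⟨V, hV, hVU⟩ := exists_affineOpens_mem_le (V := f ⁻¹ᵁ U.1) hU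
  rw [stalkIdeal_eq_map _ U hU, stalkIdeal_eq_map _ V hV, ideal_comap I f V U hVU, Ideal.map_map,
    Ideal.map_map, ← CommRingCat.hom_comp, ← CommRingCat.hom_comp, Hom.germ_stalkMap,
    Hom.appLE, Category.assoc, X.presheaf.germ_res]

/-- A germ killed in the stalk of `X` vanishes on a neighbourhood of `y`. Since `j` is an embedding,
this neighbourhood contains the preimage of an affine open of `Y`, on which the section belongs to
the ideal of `X`. -/
theorem ker_stalkMap_of_isClosedImmersion (j : X ⟶ Y) [IsClosedImmersion j] (y : X) :
    RingHom.ker (j.stalkMap y).hom = stalkIdeal j.ker (j y) := by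
  apply le_antisymm
  · intro a ha
    obtain ⟨U, hU, s, rfl⟩ := Y.presheaf.exists_germ_eq a
    rw [RingHom.mem_ker] at ha
    change j.stalkMap y (Y.presheaf.germ U (j y) hU s) = 0 at ha
    rw [Hom.germ_stalkMap_apply, ← map_zero (X.presheaf.germ (j ⁻¹ᵁ U) y hU).hom] at ha
    obtain ⟨W, hyW, i₁, i₂, hW⟩ := X.presheaf.germ_eq _ hU hU _ _ ha
    rw [map_zero] at hW
    obtain ⟨W', hW'⟩ := j.isEmbedding.isOpen_iff.mp W.2
    obtain ⟨V, hV, hVU⟩ := exists_affineOpens_mem_le (x := j y) (V := U ⊓ ⟨W', hW'.1⟩)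
      ⟨hU, show y ∈ j ⁻¹' W' by rw [hW'.2]; exact hyW⟩
    have hVU' : V.1 ≤ U := hVU.trans inf_le_left
    have hVW : j ⁻¹ᵁ V.1 ≤ W := fun z hz => by
      have : z ∈ j ⁻¹' W' := (hVU hz).2
      rwa [hW'.2] at this
    rw [stalkIdeal_eq_map _ V hV, ← Y.presheaf.germ_res_apply (homOfLE hVU') (j y) hV]
    refine Ideal.mem_map_of_mem _ ?_
    rw [Hom.ker_apply, RingHom.mem_ker]
    have h1 : X.presheaf.map (homOfLE hVW).op (X.presheaf.map i₁.op (j.app U s)) = 0 := by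
      rw [hW, map_zero]
    rw [← CommRingCat.comp_apply, ← X.presheaf.map_comp, ← CommRingCat.comp_apply,
      Hom.app_eq_appLE, Hom.appLE_map] at h1
    change (Y.presheaf.map (homOfLE hVU').op ≫ j.app V.1) s = 0
    rw [Hom.app_eq_appLE, Hom.map_appLE]
    exact h1
  · obtain ⟨U, hU⟩ := exists_affineOpens_mem (j y)
    rw [stalkIdeal_eq_map _ U hU, Ideal.map_le_iff_le_comap, Hom.ker_apply]
    intro s hs
    rw [Ideal.mem_comap, RingHom.mem_ker]
    change j.stalkMap y (Y.presheaf.germ U.1 (j y) hU s) = 0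
    rw [Hom.germ_stalkMap_apply]
    have : j.app U.1 s = 0 := hs
    rw [this, map_zero]

end IdealSheaves

/-! ### Local rings of smooth varieties -/

section SmoothAlgebra

open IsLocalRing KaehlerDifferential

variable {A : Type} [CommRing A] [IsLocalRing A] [Algebra ℂ A]

/-- The derivation `a ↦ a - a(x)` with values in the cotangent space at a rational point. -/
theorem exists_derivation_cotangent (hA : ∀ a : A, ∃ c : ℂ, a - algebraMap ℂ A c ∈ maximalIdeal A) :
    ∃ D : Derivation ℂ A (maximalIdeal A).Cotangent,
      ∀ a (ha : a ∈ maximalIdeal A), D a = (maximalIdeal A).toCotangent ⟨a, ha⟩ := by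
  choose c hc using hA
  have hinj : ∀ z : ℂ, algebraMap ℂ A z ∈ maximalIdeal A → z = 0 := fun z hz => by
    by_contra h0
    exact hz ((isUnit_iff_ne_zero.mpr h0).map (algebraMap ℂ A))
  -- The value at the point is unique because nonzero constants are units; hence `c` is a ring
  -- homomorphism.
  have huniq : ∀ (a : A) (z : ℂ), a - algebraMap ℂ A z ∈ maximalIdeal A → c a = z :=
      fun a z hz => by
    have := Ideal.sub_mem _ hz (hc a)
    rw [sub_sub_sub_cancel_left, ← map_sub] at this
    exact sub_eq_zero.mp (hinj _ this)
  have hadd : ∀ a b, c (a + b) = c a + c b := fun a b => huniq _ _ (by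
    have := Ideal.add_mem _ (hc a) (hc b)
    rw [map_add]; convert this using 1; ring)
  have hmul : ∀ a b, c (a * b) = c a * c b := fun a b => huniq _ _ (by
    have := Ideal.add_mem _ (Ideal.mul_mem_right b _ (hc a))
      (Ideal.mul_mem_left _ (algebraMap ℂ A (c a)) (hc b))
    rw [map_mul]; convert this using 1; ring)
  have hsc : ∀ z : ℂ, c (algebraMap ℂ A z) = z := fun z => huniq _ _ (by simp)
  let D : A →ₗ[ℂ] (maximalIdeal A).Cotangent :=
    { toFun a := (maximalIdeal A).toCotangent ⟨a - algebraMap ℂ A (c a), hc a⟩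
      map_add' a b := by
        rw [← map_add]
        congr 1
        refine Subtype.ext ?_
        change a + b - algebraMap ℂ A (c (a + b)) = _
        rw [hadd, map_add]; change _ = (a - _) + (b - _); ring
      map_smul' z a := by
        refine Eq.trans ?_ (algebraMap_smul A z ((maximalIdeal A).toCotangent ⟨_, hc a⟩))
        rw [← map_smul]
        congr 1
        refine Subtype.ext ?_
        change z • a - algebraMap ℂ A (c (z • a)) = algebraMap ℂ A z * (a - algebraMap ℂ A (c a))
        rw [Algebra.smul_def, hmul, hsc, map_mul]; ring }
  refine ⟨Derivation.mk' D fun a b => ?_, fun a ha => ?_⟩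
  · change (maximalIdeal A).toCotangent ⟨_, _⟩ = a • (maximalIdeal A).toCotangent ⟨_, _⟩ +
      b • (maximalIdeal A).toCotangent ⟨_, _⟩
    rw [← map_smul, ← map_smul, ← map_add, Ideal.toCotangent_eq]
    change a * b - algebraMap ℂ A (c (a * b)) - (a * (b - algebraMap ℂ A (c b)) +
      b * (a - algebraMap ℂ A (c a))) ∈ maximalIdeal A ^ 2
    -- The failure of the Leibniz rule is `-(a - a(x)) * (b - b(x))`, an element of the square of
    -- the maximal ideal.
    have := Ideal.neg_mem_iff _ |>.mpr (Ideal.mul_mem_mul (hc a) (hc b))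
    rw [← pow_two] at this
    convert this using 1
    rw [hmul, map_mul]; ring
  · change (maximalIdeal A).toCotangent ⟨_, _⟩ = _
    congr 1
    refine Subtype.ext ?_
    change a - algebraMap ℂ A (c a) = a
    rw [huniq a 0 (by simpa using ha)]; simp

/-- The derivation into the cotangent space factors through the differentials and restricts to the
projection on the maximal ideal. Hence the images of the basis generate the cotangent space, and
Nakayama lifts them. -/
theorem maximalIdeal_eq_span_of_basis [IsNoetherianRing A] {n : ℕ}
    (hA : ∀ a : A, ∃ c : ℂ, a - algebraMap ℂ A c ∈ maximalIdeal A)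
    (b : Module.Basis (Fin n) A (Ω[A⁄ℂ])) :
    ∃ g : Fin n → A, maximalIdeal A = Ideal.span (Set.range g) := by
  obtain ⟨D, hD⟩ := exists_derivation_cotangent hA
  have hg : ∀ i, ∃ g : maximalIdeal A,
      (maximalIdeal A).toCotangent g = D.liftKaehlerDifferential (b i) :=
    fun i => Ideal.toCotangent_surjective _ _
  choose g hg using hg
  refine ⟨fun i => g i, le_antisymm ?_ ?_⟩
  · refine Submodule.le_of_le_smul_of_le_jacobson_bot (I := maximalIdeal A)
      (IsNoetherian.noetherian _) (IsLocalRing.jacobson_eq_maximalIdeal _ bot_ne_top).ge ?_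
    intro a ha
    have h1 : (maximalIdeal A).toCotangent ⟨a, ha⟩ =
        (maximalIdeal A).toCotangent (∑ i, b.repr (KaehlerDifferential.D ℂ A a) i • g i) := by
      rw [map_sum, ← hD a ha]
      conv_lhs => rw [← D.liftKaehlerDifferential_comp_D a,
        ← b.sum_repr (KaehlerDifferential.D ℂ A a)]
      simp only [map_sum, map_smul, hg]
    rw [Ideal.toCotangent_eq] at h1
    refine Submodule.mem_sup.mpr ⟨_, ?_, _, ?_, add_sub_cancel
      ((∑ i, b.repr (KaehlerDifferential.D ℂ A a) i • g i : maximalIdeal A) : A) a⟩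
    · rw [AddSubmonoidClass.coe_finsetSum]
      exact Ideal.sum_mem _ fun i _ => Ideal.mul_mem_left _ _ (Ideal.subset_span ⟨i, rfl⟩)
    · rw [smul_eq_mul, ← pow_two]; exact h1
  · rw [Ideal.span_le]
    rintro _ ⟨i, rfl⟩
    exact (g i).2

/-- By Nakayama `du` generates the free module of differentials of rank one, so its annihilator is
zero. In characteristic zero, `u ^ (n + 1) = 0` gives `(n + 1) * u ^ n * du = 0`, hence `u ^ n = 0`,
down to `1 = 0`. -/
theorem pow_ne_zero_of_basis
    (hA : ∀ a : A, ∃ c : ℂ, a - algebraMap ℂ A c ∈ maximalIdeal A)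
    (b : Module.Basis (Fin 1) A (Ω[A⁄ℂ])) {u : A} (hu : maximalIdeal A = Ideal.span {u}) (n : ℕ) :
    u ^ n ≠ 0 := by
  have hfg : (⊤ : Submodule A (Ω[A⁄ℂ])).FG := by
    rw [← b.span_eq]; exact Submodule.fg_span (Set.finite_range b)
  have htop : ⊤ ≤ Submodule.span A {D ℂ A u} := by
    refine Submodule.le_of_le_smul_of_le_jacobson_bot (I := maximalIdeal A) hfg
      (IsLocalRing.jacobson_eq_maximalIdeal _ bot_ne_top).ge ?_
    rw [← span_range_derivation, Submodule.span_le]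
    rintro _ ⟨a, rfl⟩
    obtain ⟨c, hc⟩ := hA a
    obtain ⟨y, hy⟩ := Ideal.mem_span_singleton.mp (hu ▸ hc)
    have : D ℂ A a = y • D ℂ A u + u • D ℂ A y := by
      rw [sub_eq_iff_eq_add.mp hy, map_add, Derivation.map_algebraMap, add_zero, Derivation.leibniz,
        add_comm]
    rw [this]
    exact Submodule.add_mem_sup
      (Submodule.smul_mem _ _ (Submodule.mem_span_singleton_self _))
      (Submodule.smul_mem_smul (hu ▸ Ideal.mem_span_singleton_self u)
        (Submodule.subset_span ⟨y, rfl⟩))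
  obtain ⟨d, hd⟩ := Submodule.mem_span_singleton.mp (htop (show b 0 ∈ _ from trivial))
  have hreg : ∀ a : A, a • D ℂ A u = 0 → a = 0 := fun a ha => by
    have h1 : a • b 0 = 0 := by rw [← hd, smul_comm, ha, smul_zero]
    have h2 := congrArg (fun x => b.repr x 0) h1
    simpa using h2
  induction n with
  | zero => simp
  | succ n ih =>
    intro h
    have h1 := congrArg (D ℂ A) h
    rw [Derivation.leibniz_pow, map_zero, Nat.add_sub_cancel, ← Nat.cast_smul_eq_nsmul A,
      smul_smul] at h1
    have h2 := hreg _ h1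
    have hun : IsUnit ((n + 1 : ℕ) : A) := by
      have := (isUnit_iff_ne_zero.mpr (Nat.cast_ne_zero (R := ℂ).mpr n.succ_ne_zero)).map
        (algebraMap ℂ A)
      simpa using this
    exact ih (hun.mul_right_eq_zero.mp h2)

theorem exists_basis_kaehlerDifferential {R : Type} [CommRing R] [Algebra ℂ R] [Algebra R A]
    [IsScalarTower ℂ R A] (m : Ideal R) [m.IsPrime] [IsLocalization.AtPrime A m] (n : ℕ)
    [Algebra.IsStandardSmoothOfRelativeDimension n ℂ R] :
    Nonempty (Module.Basis (Fin n) A (Ω[A⁄ℂ])) := by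
  have : Nontrivial R := (algebraMap R A).domain_nontrivial
  have := Algebra.IsStandardSmoothOfRelativeDimension.isStandardSmooth (R := ℂ) (S := R) n
  have hr := Algebra.IsStandardSmoothOfRelativeDimension.rank_kaehlerDifferential
    (R := ℂ) (S := R) n
  have hfr : Module.finrank R (Ω[R⁄ℂ]) = n := Module.finrank_eq_of_rank_eq hr
  have : Algebra.FormallyEtale R A := .of_isLocalization m.primeCompl
  have : Module.Finite R (Ω[R⁄ℂ]) := inferInstance
  let b : Module.Basis (Fin n) R (Ω[R⁄ℂ]) := Module.finBasisOfFinrankEq _ _ hfr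
  exact ⟨(b.baseChange A).map (tensorKaehlerEquivOfFormallyEtale ℂ R A)⟩

end SmoothAlgebra

/-! ### Local rings at rational points of smooth complex schemes -/

section SmoothSchemes

open Scheme IsLocalRing

variable {X Y : Scheme.{0}}

/-- The structure morphism of the local ring of a complex scheme. -/
noncomputable def stalkStr (s : X ⟶ SpecC) (x : X) : CommRingCat.of ℂ ⟶ X.presheaf.stalk x :=
  Spec.preimage (X.fromSpecStalk x ≫ s)

/-- The residue field at `x` is `ℂ`. -/
def IsRationalPoint (s : X ⟶ SpecC) (x : X) : Prop :=
  ∀ a : X.presheaf.stalk x, ∃ c : ℂ, a - (stalkStr s x).hom c ∈ maximalIdeal (X.presheaf.stalk x)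

theorem isRationalPoint_of_isClosed (s : X ⟶ SpecC) [LocallyOfFiniteType s] {x : X}
    (hx : IsClosed {x}) : IsRationalPoint s x := by
  intro a
  have h : (residueFieldIsoBase s x hx).inv = stalkStr s x ≫ X.residue x := by
    apply Spec.map_injective
    rw [SpecMap_residueFieldIsoBase_inv, Spec.map_comp, stalkStr, Spec.map_preimage,
      fromSpecResidueField, Category.assoc]
  refine ⟨(residueFieldIsoBase s x hx).hom.hom ((X.residue x).hom a), ?_⟩
  have h1 : (X.residue x).hom ((stalkStr s x).hom
      ((residueFieldIsoBase s x hx).hom.hom ((X.residue x).hom a))) = (X.residue x).hom a := by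
    have := congrArg (fun φ => φ.hom ((residueFieldIsoBase s x hx).hom.hom ((X.residue x).hom a))) h
    simp only [CommRingCat.hom_comp, RingHom.comp_apply] at this
    rw [← this]
    simp
  have h3 : (X.residue x).hom (a - (stalkStr s x).hom
      ((residueFieldIsoBase s x hx).hom.hom ((X.residue x).hom a))) = 0 := by
    rw [map_sub, h1, sub_self]
  exact (IsLocalRing.residue_eq_zero_iff _).mp h3

theorem stalkStr_comp (f : X ⟶ Y) (s : Y ⟶ SpecC) (x : X) :
    stalkStr s (f x) ≫ f.stalkMap x = stalkStr (f ≫ s) x := by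
  apply Spec.map_injective
  rw [Spec.map_comp, stalkStr, Spec.map_preimage, stalkStr, Spec.map_preimage,
    SpecMap_stalkMap_fromSpecStalk_assoc]

theorem IsRationalPoint.map (f : X ⟶ Y) (s : Y ⟶ SpecC) {x : X} (h : IsRationalPoint (f ≫ s) x) :
    IsRationalPoint s (f x) := by
  intro a
  obtain ⟨c, hc⟩ := h ((f.stalkMap x).hom a)
  refine ⟨c, ?_⟩
  rw [← stalkStr_comp, CommRingCat.hom_comp, RingHom.comp_apply, ← map_sub, mem_maximalIdeal] at hc
  rw [mem_maximalIdeal, mem_nonunits_iff]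
  exact fun hu => hc (hu.map (f.stalkMap x).hom)

theorem exists_basis_stalk (n : ℕ) (s : X ⟶ SpecC) [h : SmoothOfRelativeDimension n s] (x : X) :
    letI := (stalkStr s x).hom.toAlgebra
    Nonempty (Module.Basis (Fin n) (X.presheaf.stalk x) (Ω[(X.presheaf.stalk x)⁄ℂ])) := by
  obtain ⟨U, hU, V, hV, hx, e, hf⟩ := h.exists_isStandardSmoothOfRelativeDimension x
  let r : CommRingCat.of ℂ ⟶ Γ(SpecC, U) := Spec.preimage hU.fromSpec
  have hr : Spec.map r = hU.fromSpec := Spec.map_preimage _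
  -- `Spec ℂ` has one point, so the nonempty open `U` is everything and its ring of sections is `ℂ`.
  have hiso : IsIso (Spec.map r) := by
    rw [hr]
    have : Surjective hU.fromSpec := ⟨fun y => by
      have : y ∈ Set.range hU.fromSpec := by
        rw [hU.range_fromSpec]
        have hsub : y = s x := Subsingleton.elim (α := PrimeSpectrum ℂ) _ _
        exact hsub ▸ e hx
      exact this⟩
    exact (isIso_iff_isOpenImmersion_and_epi_base hU.fromSpec).mpr ⟨inferInstance,
      (TopCat.epi_iff_surjective _).mpr this.1⟩
  have hisor : IsIso r := by
    have : IsIso (Scheme.Spec.map r.op) := hiso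
    exact (isIso_op_iff r).mp (isIso_of_reflects_iso r.op Scheme.Spec)
  let ψ := r ≫ s.appLE U V e
  have hψ : ψ.hom.IsStandardSmoothOfRelativeDimension n :=
    RingHom.isStandardSmoothOfRelativeDimension_respectsIso.2 (s.appLE U V e).hom
      (asIso r).commRingCatIsoToRingEquiv hf
  have hstr : stalkStr s x = ψ ≫ X.presheaf.germ V x hx := by
    apply Spec.map_injective
    rw [stalkStr, Spec.map_preimage, Spec.map_comp, Spec.map_comp, hr,
      IsAffineOpen.SpecMap_appLE_fromSpec s hU hV, ← hV.fromSpecStalk_eq_fromSpecStalk hx,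
      IsAffineOpen.fromSpecStalk, Category.assoc]
  let := ψ.hom.toAlgebra
  let := X.presheaf.algebra_section_stalk ⟨x, hx⟩
  let := (stalkStr s x).hom.toAlgebra
  have : IsScalarTower ℂ Γ(X, V) (X.presheaf.stalk x) :=
    .of_algebraMap_eq' (by
      change (stalkStr s x).hom = _
      rw [hstr]; rfl)
  have := hV.isLocalization_stalk ⟨x, hx⟩
  have : Algebra.IsStandardSmoothOfRelativeDimension n ℂ Γ(X, V) := hψ
  exact exists_basis_kaehlerDifferential (R := Γ(X, V)) (hV.primeIdealOf ⟨x, hx⟩).asIdeal n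

theorem isNoetherianRing_stalk (s : X ⟶ SpecC) [LocallyOfFiniteType s] (x : X) :
    IsNoetherianRing (X.presheaf.stalk x) := by
  have := LocallyOfFiniteType.isLocallyNoetherian s
  infer_instance

theorem exists_maximalIdeal_stalk_eq_span (n : ℕ) (s : X ⟶ SpecC) [SmoothOfRelativeDimension n s]
    {x : X} (hx : IsRationalPoint s x) :
    ∃ g : Fin n → X.presheaf.stalk x,
      maximalIdeal (X.presheaf.stalk x) = Ideal.span (Set.range g) := by
  have : Smooth s := SmoothOfRelativeDimension.smooth n s
  have := isNoetherianRing_stalk s x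
  let := (stalkStr s x).hom.toAlgebra
  obtain ⟨b⟩ := exists_basis_stalk n s x
  exact maximalIdeal_eq_span_of_basis hx b

theorem exists_maximalIdeal_stalk_eq_span_singleton (s : X ⟶ SpecC) [SmoothOfRelativeDimension 1 s]
    {x : X} (hx : IsRationalPoint s x) :
    ∃ u : X.presheaf.stalk x, maximalIdeal (X.presheaf.stalk x) = Ideal.span {u} ∧
      ∀ n : ℕ, u ^ n ≠ 0 := by
  obtain ⟨g, hg⟩ := exists_maximalIdeal_stalk_eq_span 1 s hx
  rw [Set.range_unique] at hg
  let := (stalkStr s x).hom.toAlgebra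
  obtain ⟨b⟩ := exists_basis_stalk 1 s x
  exact ⟨_, hg, pow_ne_zero_of_basis hx b hg⟩

end SmoothSchemes

/-! ### Quasi-projective schemes are of finite type -/

section Varieties

attribute [local instance] MvPolynomial.gradedAlgebra

theorem locallyOfFiniteType_projectiveSpaceStr (n : ℕ) :
    LocallyOfFiniteType (projectiveSpaceStr n) := by
  have : IsScalarTower ℂ (MvPolynomial.homogeneousSubmodule (Fin (n + 1)) ℂ 0)
      (MvPolynomial (Fin (n + 1)) ℂ) := ⟨fun c a b => smul_mul_assoc c a.1 b⟩
  have : Algebra.FiniteType (MvPolynomial.homogeneousSubmodule (Fin (n + 1)) ℂ 0)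
      (MvPolynomial (Fin (n + 1)) ℂ) := .of_restrictScalars_finiteType ℂ _ _
  have h2 : LocallyOfFiniteType (Spec.map (CommRingCat.ofHom
      (algebraMap ℂ (MvPolynomial.homogeneousSubmodule (Fin (n + 1)) ℂ 0)))) := by
    refine (HasRingHomProperty.Spec_iff (P := @LocallyOfFiniteType)).mpr
      (RingHom.FiniteType.of_surjective _ ?_)
    rintro ⟨p, hp⟩
    rw [MvPolynomial.homogeneousSubmodule_zero, Submodule.mem_one] at hp
    obtain ⟨c, hc⟩ := hp
    exact ⟨c, Subtype.ext hc⟩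
  unfold projectiveSpaceStr projectiveSpace
  infer_instance

theorem IsVariety.locallyOfFiniteType {X : Scheme.{0}} {s : X ⟶ SpecC} (h : IsVariety s) :
    LocallyOfFiniteType s := by
  obtain ⟨n, i, hi, rfl⟩ := h
  have := locallyOfFiniteType_projectiveSpaceStr n
  infer_instance

end Varieties

/-! ### Germs, vanishing ideals and specialisations -/

section Stalks

open Scheme IsLocalRing

variable {X Y : Scheme.{0}}

theorem mem_primeIdealOf_iff (U : X.affineOpens) {x : X} (hx : x ∈ U.1) (r : Γ(X, U.1)) :
    r ∈ (IsAffineOpen.primeIdealOf U.2 ⟨x, hx⟩).asIdeal ↔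
      (X.presheaf.germ U.1 x hx).hom r ∈ maximalIdeal (X.presheaf.stalk x) := by
  have hU : IsAffineOpen U.1 := U.2
  change r ∈ (hU.primeIdealOf ⟨x, hx⟩).asIdeal ↔ _
  rw [hU.primeIdealOf_eq_map_closedPoint]
  rfl

theorem fromSpec_mem_and_primeIdealOf (U : X.affineOpens) (q : PrimeSpectrum Γ(X, U.1)) :
    ∃ h : IsAffineOpen.fromSpec U.2 q ∈ U.1, IsAffineOpen.primeIdealOf U.2 ⟨_, h⟩ = q := by
  have hU : IsAffineOpen U.1 := U.2
  have h : hU.fromSpec q ∈ U.1 := by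
    have : hU.fromSpec q ∈ Set.range hU.fromSpec := ⟨q, rfl⟩
    rwa [hU.range_fromSpec] at this
  exact ⟨h, hU.fromSpec.isOpenEmbedding.injective (hU.fromSpec_primeIdealOf ⟨_, h⟩)⟩

theorem mem_support_iff_stalkIdeal_le (I : X.IdealSheafData) (x : X) :
    x ∈ I.support ↔ stalkIdeal I x ≤ maximalIdeal (X.presheaf.stalk x) := by
  obtain ⟨U, hU⟩ := exists_affineOpens_mem x
  rw [I.mem_support_iff_of_mem hU, stalkIdeal_eq_map I U hU, Ideal.map_le_iff_le_comap,
    mem_zeroLocus_iff]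
  refine forall₂_congr fun r _ => ?_
  rw [Ideal.mem_comap, mem_maximalIdeal, mem_nonunits_iff, Scheme.mem_basicOpen _ r x hU]

theorem stalkIdeal_eq_top_iff (I : X.IdealSheafData) (x : X) :
    stalkIdeal I x = ⊤ ↔ x ∉ I.support := by
  rw [mem_support_iff_stalkIdeal_le]
  exact ⟨fun h h' => (maximalIdeal.isMaximal _).ne_top (top_le_iff.mp (h ▸ h')),
    fun h => by_contra fun h' => h (le_maximalIdeal h')⟩

theorem mem_vanishingIdeal_iff (Z : TopologicalSpace.Closeds X) (U : X.affineOpens)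
    (r : Γ(X, U.1)) : r ∈ (reducedIdeal Z).ideal U ↔
      ∀ (x : X) (hx : x ∈ U.1), x ∈ Z →
        (X.presheaf.germ U.1 x hx).hom r ∈ maximalIdeal (X.presheaf.stalk x) := by
  have hU : IsAffineOpen U.1 := U.2
  rw [reducedIdeal, IdealSheafData.vanishingIdeal_ideal, PrimeSpectrum.mem_vanishingIdeal]
  change (∀ q, hU.fromSpec q ∈ Z → _) ↔ _
  constructor
  · intro h x hx hxZ
    rw [← mem_primeIdealOf_iff U hx]
    exact h _ (by rw [hU.fromSpec_primeIdealOf]; exact hxZ)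
  · intro h q hq
    obtain ⟨hqU, h1⟩ := fromSpec_mem_and_primeIdealOf U q
    rw [← h1, mem_primeIdealOf_iff U hqU]
    exact h _ hqU hq

theorem mem_vanishingIdeal_closure_iff (A : Set X) (U : X.affineOpens) (r : Γ(X, U.1)) :
    r ∈ (reducedIdeal (TopologicalSpace.Closeds.closure A)).ideal U ↔
      ∀ (x : X) (hx : x ∈ U.1), x ∈ A →
        (X.presheaf.germ U.1 x hx).hom r ∈ maximalIdeal (X.presheaf.stalk x) := by
  rw [mem_vanishingIdeal_iff]
  refine ⟨fun h x hx hA => h x hx (subset_closure hA), fun h x hx hZ hu => ?_⟩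
  obtain ⟨y, hy, hyA⟩ := mem_closure_iff.mp hZ (X.basicOpen r) (X.basicOpen r).2
    ((Scheme.mem_basicOpen _ r x hx).mpr (by simpa using hu))
  exact h y (X.basicOpen_le r hy) hyA ((Scheme.mem_basicOpen _ r y (X.basicOpen_le r hy)).mp hy)

theorem stalkIdeal_map_stalkSpecializes (I : X.IdealSheafData) {x y : X} (h : x ⤳ y) :
    (stalkIdeal I y).map (X.presheaf.stalkSpecializes h).hom = stalkIdeal I x := by
  obtain ⟨U, hU⟩ := exists_affineOpens_mem y
  rw [stalkIdeal_eq_map I U hU, stalkIdeal_eq_map I U (h.mem_open U.1.2 hU), Ideal.map_map,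
    ← CommRingCat.hom_comp, X.presheaf.germ_stalkSpecializes]

theorem exists_mul_germ_eq (U : X.affineOpens) {x : X} (hx : x ∈ U.1) (a : X.presheaf.stalk x) :
    ∃ r s : Γ(X, U.1), IsUnit ((X.presheaf.germ U.1 x hx).hom s) ∧
      a * (X.presheaf.germ U.1 x hx).hom s = (X.presheaf.germ U.1 x hx).hom r := by
  let := X.presheaf.algebra_section_stalk ⟨x, hx⟩
  have := U.2.isLocalization_stalk ⟨x, hx⟩
  obtain ⟨⟨r, s⟩, h⟩ := IsLocalization.surj (U.2.primeIdealOf ⟨x, hx⟩).asIdeal.primeCompl a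
  exact ⟨r, s, IsLocalization.map_units (M := (U.2.primeIdealOf ⟨x, hx⟩).asIdeal.primeCompl) _ s, h⟩

theorem germ_mem_stalkIdeal_iff (I : X.IdealSheafData) (U : X.affineOpens) {x : X} (hx : x ∈ U.1)
    (r : Γ(X, U.1)) : (X.presheaf.germ U.1 x hx).hom r ∈ stalkIdeal I x ↔
      ∃ s, IsUnit ((X.presheaf.germ U.1 x hx).hom s) ∧ s * r ∈ I.ideal U := by
  let := X.presheaf.algebra_section_stalk ⟨x, hx⟩
  have := U.2.isLocalization_stalk ⟨x, hx⟩
  rw [stalkIdeal_eq_map I U hx]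
  refine (IsLocalization.algebraMap_mem_map_algebraMap_iff
    (U.2.primeIdealOf ⟨x, hx⟩).asIdeal.primeCompl (X.presheaf.stalk x) (I.ideal U) r).trans ?_
  refine exists_congr fun s => and_congr_left fun _ => ?_
  refine not_iff_comm.mp ?_
  rw [← mem_nonunits_iff, ← mem_maximalIdeal]
  exact (mem_primeIdealOf_iff U hx s).symm

/-- Both stalks are localizations of the sections over an affine neighbourhood of `y`, so fractions
and relations can be written there. -/
theorem isLocalization_stalkSpecializes {x y : X} (h : x ⤳ y) :
    letI := (X.presheaf.stalkSpecializes h).hom.toAlgebra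
    IsLocalization.AtPrime (X.presheaf.stalk x)
      ((maximalIdeal (X.presheaf.stalk x)).comap (X.presheaf.stalkSpecializes h).hom) := by
  let := (X.presheaf.stalkSpecializes h).hom.toAlgebra
  obtain ⟨U, hU⟩ := exists_affineOpens_mem y
  have hx : x ∈ U.1 := h.mem_open U.1.2 hU
  have hg : ∀ r, (X.presheaf.stalkSpecializes h).hom ((X.presheaf.germ U.1 y hU).hom r) =
      (X.presheaf.germ U.1 x hx).hom r := fun r => by
    rw [← X.presheaf.germ_stalkSpecializes hU h]; rfl
  refine ⟨?_, ?_, ?_⟩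
  · rintro ⟨a, ha⟩
    have ha' : (X.presheaf.stalkSpecializes h).hom a ∉ maximalIdeal (X.presheaf.stalk x) := ha
    rw [mem_maximalIdeal, mem_nonunits_iff, not_not] at ha'
    exact ha'
  · intro b
    obtain ⟨r, s, hs, hrs⟩ := exists_mul_germ_eq U hx b
    refine ⟨((X.presheaf.germ U.1 y hU).hom r, ⟨(X.presheaf.germ U.1 y hU).hom s, ?_⟩), ?_⟩
    · change (X.presheaf.stalkSpecializes h).hom _ ∉ maximalIdeal (X.presheaf.stalk x)
      rw [hg]; simpa using hs
    · change b * (X.presheaf.stalkSpecializes h).hom _ = (X.presheaf.stalkSpecializes h).hom _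
      exact (congrArg (b * ·) (hg s)).trans (hrs.trans (hg r).symm)
  · intro a b hab
    have key : ∀ a, (X.presheaf.stalkSpecializes h).hom a = 0 →
        ∃ c, IsUnit ((X.presheaf.stalkSpecializes h).hom c) ∧ c * a = 0 := by
      intro a ha
      obtain ⟨r, s, hs, hrs⟩ := exists_mul_germ_eq U hU a
      have h0 : (X.presheaf.germ U.1 x hx).hom r ∈ stalkIdeal (⊥ : X.IdealSheafData) x := by
        rw [← hg, ← hrs, map_mul, ha, zero_mul]; exact zero_mem _
      obtain ⟨c, hc, hcr⟩ := (germ_mem_stalkIdeal_iff _ U hx r).mp h0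
      have hcr' : c * r = 0 := hcr
      refine ⟨(X.presheaf.germ U.1 y hU).hom c, by rwa [hg], hs.mul_left_injective ?_⟩
      beta_reduce
      rw [mul_assoc, hrs, ← map_mul, hcr', map_zero, zero_mul]
    obtain ⟨c, hc, hca⟩ := key (a - b) (by
      rw [map_sub, sub_eq_zero]; exact hab)
    refine ⟨⟨c, ?_⟩, by rwa [mul_sub, sub_eq_zero] at hca⟩
    change (X.presheaf.stalkSpecializes h).hom _ ∉ maximalIdeal (X.presheaf.stalk x)
    simpa using hc

theorem exists_specializes_of_isPrime (U : X.affineOpens) {x : X} (hx : x ∈ U.1)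
    (q : Ideal (X.presheaf.stalk x)) [q.IsPrime] :
    ∃ (y : X) (hy : y ∈ U.1), y ⤳ x ∧ ∀ r : Γ(X, U.1),
      (X.presheaf.germ U.1 y hy).hom r ∈ maximalIdeal (X.presheaf.stalk y) ↔
        (X.presheaf.germ U.1 x hx).hom r ∈ q := by
  let p : PrimeSpectrum Γ(X, U.1) := ⟨q.comap (X.presheaf.germ U.1 x hx).hom, inferInstance⟩
  have hU : IsAffineOpen U.1 := U.2
  obtain ⟨hpU, h1⟩ := fromSpec_mem_and_primeIdealOf U p
  refine ⟨_, hpU, ?_, fun r => ?_⟩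
  · have h2 : p ⤳ hU.primeIdealOf ⟨x, hx⟩ := by
      rw [← PrimeSpectrum.le_iff_specializes]
      intro r hr
      rw [mem_primeIdealOf_iff U hx]
      exact le_maximalIdeal Ideal.IsPrime.ne_top' hr
    have h3 := h2.map hU.fromSpec.continuous
    rwa [hU.fromSpec_primeIdealOf] at h3
  · rw [← mem_primeIdealOf_iff U hpU, h1]
    rfl

theorem stalkIdeal_inf_eq_bot {I J : X.IdealSheafData} (h : I ⊓ J = ⊥) (x : X) :
    stalkIdeal I x ⊓ stalkIdeal J x = ⊥ := by
  obtain ⟨U, hU⟩ := exists_affineOpens_mem x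
  let := X.presheaf.algebra_section_stalk ⟨x, hU⟩
  have := U.2.isLocalization_stalk ⟨x, hU⟩
  have h1 : I.ideal U ⊓ J.ideal U = ⊥ := congrArg (fun K : X.IdealSheafData => K.ideal U) h
  rw [stalkIdeal_eq_map I U hU, stalkIdeal_eq_map J U hU]
  refine (IsLocalization.map_inf (U.2.primeIdealOf ⟨x, hU⟩).asIdeal.primeCompl
    (X.presheaf.stalk x) (I.ideal U) (J.ideal U)).symm.trans ?_
  rw [h1, Ideal.map_bot]

theorem maximalIdeal_eq_sup_ker {A B : Type*} [CommRing A] [CommRing B] [IsLocalRing A]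
    [IsLocalRing B] (φ : A →+* B) [IsLocalHom φ] (hφ : Function.Surjective φ) {J : Ideal A}
    (hJ : maximalIdeal B = J.map φ) : maximalIdeal A = J ⊔ RingHom.ker φ := by
  rw [← maximalIdeal_comap φ, hJ, Ideal.comap_map_of_surjective' φ hφ]

end Stalks

/-! ### Fibre ideals and their local equations -/

section Fibres

open Scheme IsLocalRing

variable {X S : Scheme.{0}}

theorem fibreIdeal_eq_comap (π : X ⟶ S) {z : S} (hz : IsClosed ({z} : Set S)) :
    fibreIdeal π z = (S.fromSpecResidueField z).ker.comap π := by
  have := isClosed_singleton_iff_isClosedImmersion.mp hz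
  exact IdealSheafData.ker_fst_of_isClosedImmersion _ _

theorem isClosedImmersion_fiberι (π : X ⟶ S) {z : S} (hz : IsClosed ({z} : Set S)) :
    IsClosedImmersion (π.fiberι z) := by
  have := isClosed_singleton_iff_isClosedImmersion.mp hz
  exact inferInstanceAs (IsClosedImmersion (pullback.fst π (S.fromSpecResidueField z)))

theorem support_fibreIdeal (π : X ⟶ S) {z : S} (hz : IsClosed ({z} : Set S)) (x : X) :
    x ∈ (fibreIdeal π z).support ↔ π x = z := by
  have := isClosedImmersion_fiberι π hz
  rw [fibreIdeal, ← SetLike.mem_coe, Hom.support_ker, Hom.range_fiberι,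
    (hz.preimage π.continuous).closure_eq]
  rfl

theorem ker_eq_maximalIdeal_of_isClosedImmersion_Spec {K : Type} [Field K]
    (j : Spec (CommRingCat.of K) ⟶ S) [IsClosedImmersion j] (y : Spec (CommRingCat.of K)) :
    stalkIdeal j.ker (j y) = maximalIdeal (S.presheaf.stalk (j y)) := by
  rw [← ker_stalkMap_of_isClosedImmersion]
  refine le_antisymm (le_maximalIdeal (RingHom.ker_ne_top _)) fun a ha => ?_
  rw [RingHom.mem_ker]
  obtain ⟨r, s, hs, h⟩ := exists_mul_germ_eq (affineTop (Spec (CommRingCat.of K))) (x := y) trivial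
    ((j.stalkMap y).hom a)
  by_contra hne
  have hr : r ≠ 0 := by
    rintro rfl
    rw [map_zero] at h
    exact hne (hs.mul_left_eq_zero.mp h)
  have hr' : IsUnit r := by
    have h0 : (ΓSpecIso (CommRingCat.of K)).hom.hom r ≠ 0 :=
      (map_ne_zero_iff _ (ConcreteCategory.bijective_of_isIso
        (ΓSpecIso (CommRingCat.of K)).hom).1).mpr hr
    have h1 : IsUnit ((ΓSpecIso (CommRingCat.of K)).inv.hom
        ((ΓSpecIso (CommRingCat.of K)).hom.hom r)) :=
      IsUnit.map _ (IsUnit.mk0 (G₀ := K) _ h0)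
    simpa using h1
  have hu : IsUnit ((j.stalkMap y).hom a) := isUnit_of_mul_isUnit_left (h ▸ hr'.map _)
  exact ha (isUnit_of_map_unit (j.stalkMap y).hom a hu)

theorem stalkIdeal_ker_fromSpecResidueField {z : S} (hz : IsClosed ({z} : Set S)) :
    stalkIdeal (S.fromSpecResidueField z).ker z = maximalIdeal (S.presheaf.stalk z) := by
  have := isClosed_singleton_iff_isClosedImmersion.mp hz
  have key : ∀ w, w ∈ Set.range (S.fromSpecResidueField z) →
      stalkIdeal (S.fromSpecResidueField z).ker w = maximalIdeal (S.presheaf.stalk w) := by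
    rintro _ ⟨y, rfl⟩
    exact ker_eq_maximalIdeal_of_isClosedImmersion_Spec (K := S.residueField z) _ y
  exact key z (by rw [range_fromSpecResidueField]; rfl)

theorem stalkIdeal_fibreIdeal (π : X ⟶ S) (x : X) (hz : IsClosed ({π x} : Set S)) :
    stalkIdeal (fibreIdeal π (π x)) x =
      (maximalIdeal (S.presheaf.stalk (π x))).map (π.stalkMap x).hom := by
  rw [fibreIdeal_eq_comap π hz, stalkIdeal_comap, stalkIdeal_ker_fromSpecResidueField hz]

theorem stalkIdeal_fibreIdeal_of_ne (π : X ⟶ S) {z : S} (hz : IsClosed ({z} : Set S)) {x : X}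
    (h : π x ≠ z) : stalkIdeal (fibreIdeal π z) x = ⊤ := by
  rwa [stalkIdeal_eq_top_iff, support_fibreIdeal π hz]

theorem exists_uniformizer (sS : S ⟶ SpecC) [SmoothOfRelativeDimension 1 sS] {z : S}
    (hz : IsClosed ({z} : Set S)) : ∃ u : S.presheaf.stalk z,
      maximalIdeal (S.presheaf.stalk z) = Ideal.span {u} ∧ u ∈ nonZeroDivisors _ := by
  have : Smooth sS := SmoothOfRelativeDimension.smooth 1 sS
  have := isNoetherianRing_stalk sS z
  obtain ⟨u, hu, hu'⟩ :=
    exists_maximalIdeal_stalk_eq_span_singleton sS (isRationalPoint_of_isClosed sS hz)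
  have : (⊥ : Ideal (S.presheaf.stalk z)).IsPrime :=
    isPrime_of_maximalIdeal_eq_sup (u := u) (by rw [hu, bot_sup_eq]) hu'
  have : IsDomain (S.presheaf.stalk z) := IsDomain.of_bot_isPrime _
  exact ⟨u, hu, mem_nonZeroDivisors_of_ne_zero (by simpa using hu' 1)⟩

theorem exists_stalkIdeal_fibreIdeal_eq (sS : S ⟶ SpecC) [SmoothOfRelativeDimension 1 sS]
    (π : X ⟶ S) {x : X} (hz : IsClosed ({π x} : Set S)) :
    ∃ t ∈ maximalIdeal (X.presheaf.stalk x),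
      stalkIdeal (fibreIdeal π (π x)) x = Ideal.span {t} := by
  obtain ⟨u, hu, -⟩ := exists_uniformizer sS hz
  refine ⟨(π.stalkMap x).hom u, ?_, ?_⟩
  · have : u ∈ maximalIdeal (S.presheaf.stalk (π x)) := hu ▸ Ideal.mem_span_singleton_self u
    rwa [← maximalIdeal_comap (π.stalkMap x).hom] at this
  · rw [stalkIdeal_fibreIdeal π x hz, hu, Ideal.map_span, Set.image_singleton]

theorem map_mem_nonZeroDivisors_of_flat {A B : Type*} [CommRing A] [CommRing B] {f : A →+* B}
    (hf : f.Flat) {u : A} (hu : u ∈ nonZeroDivisors A) : f u ∈ nonZeroDivisors B := by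
  algebraize [f]
  have h := Module.Flat.isSMulRegular_of_nonZeroDivisors (M := B) hu
  rw [mem_nonZeroDivisors_iff_right]
  intro b hb
  refine h ?_
  beta_reduce
  rw [smul_zero, Algebra.smul_def, mul_comm]
  exact hb

/-- By flatness, a uniformizer of `S` pulls back to a nonzerodivisor on the subscheme defined by
`J`. That pull-back is a multiple of `t`, so `t` is regular as well. -/
theorem IsFamilyOfSmoothCurves.isRegularMod {sS : S ⟶ SpecC} [SmoothOfRelativeDimension 1 sS]
    {π : X ⟶ S} {J : X.IdealSheafData} (h : IsFamilyOfSmoothCurves sS (J.subschemeι ≫ π))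
    {x : X} (hx : x ∈ J.support) (hz : IsClosed ({π x} : Set S)) {t : X.presheaf.stalk x}
    (ht : stalkIdeal (fibreIdeal π (π x)) x = Ideal.span {t}) :
    IsRegularMod (stalkIdeal J x) t := by
  obtain ⟨y, rfl⟩ : x ∈ Set.range J.subschemeι := by rwa [IdealSheafData.range_subschemeι]
  obtain ⟨u, hu, hu'⟩ := exists_uniformizer sS hz
  rw [stalkIdeal_fibreIdeal π _ hz, hu, Ideal.map_span, Set.image_singleton] at ht
  have hker := ker_stalkMap_of_isClosedImmersion J.subschemeι y
  rw [IdealSheafData.ker_subschemeι] at hker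
  have := h.flat
  have hflat : ((J.subschemeι ≫ π).stalkMap y).hom.Flat := Flat.stalkMap _ y
  have hreg := map_mem_nonZeroDivisors_of_flat hflat hu'
  have hcomp : ((J.subschemeι ≫ π).stalkMap y).hom u =
      (J.subschemeι.stalkMap y).hom ((π.stalkMap (J.subschemeι y)).hom u) :=
    congrArg (fun φ => φ.hom u) (Hom.stalkMap_comp J.subschemeι π y)
  rw [hcomp] at hreg
  obtain ⟨c, hc⟩ : ∃ c, (π.stalkMap (J.subschemeι y)).hom u = c * t :=
    Ideal.mem_span_singleton'.mp (ht ▸ Ideal.mem_span_singleton_self _) |>.imp fun _ h => h.symm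
  intro a ha
  rw [← hker, RingHom.mem_ker] at ha ⊢
  refine (mem_nonZeroDivisors_iff.mp hreg).1 _ ?_
  have h1 := congrArg (· * (J.subschemeι.stalkMap y).hom c) ha
  simp only [← map_mul, zero_mul] at h1
  rw [← map_mul]
  rw [hc, ← h1]
  congr 1
  ring

end Fibres

/-! ### Generators of maximal ideals at closed points -/

section LocalStructure

open Scheme IsLocalRing

variable {X Y S : Scheme.{0}}

theorem isClosed_singleton_of_injective (g : Y ⟶ X) (hg : Function.Injective g) {y : Y}
    (h : IsClosed ({g y} : Set X)) : IsClosed ({y} : Set Y) := by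
  have := h.preimage g.continuous
  rwa [← Set.image_singleton, hg.preimage_image] at this

/-- The quotient by `J` and `t` is the local ring of a fibre of the family, a smooth curve; `u`
lifts a uniformizer of it. -/
theorem IsFamilyOfSmoothCurves.exists_maximalIdeal_eq {sS : S ⟶ SpecC}
    {π : X ⟶ S} {J : X.IdealSheafData} (h : IsFamilyOfSmoothCurves sS (J.subschemeι ≫ π))
    {x : X} (hx : x ∈ J.support) (hxc : IsClosed ({x} : Set X)) {z : S}
    (hz : IsClosed ({z} : Set S)) (hπ : π x = z) {t : X.presheaf.stalk x}
    (ht : stalkIdeal (fibreIdeal π z) x = Ideal.span {t}) :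
    ∃ u, maximalIdeal (X.presheaf.stalk x) = stalkIdeal J x ⊔ Ideal.span {t} ⊔ Ideal.span {u} ∧
      ∀ n : ℕ, u ^ n ∉ stalkIdeal J x ⊔ Ideal.span {t} := by
  obtain ⟨y, rfl⟩ : x ∈ Set.range J.subschemeι := by rwa [IdealSheafData.range_subschemeι]
  let f := (J.subschemeι ≫ π).fiberι z
  have : IsClosedImmersion f := isClosedImmersion_fiberι (J.subschemeι ≫ π) hz
  obtain ⟨w, rfl⟩ : y ∈ Set.range f := by
    rw [Hom.range_fiberι]; exact hπ
  have hC := h.fibre z hz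
  have hw : IsClosed {w} := isClosed_singleton_of_injective (f ≫ J.subschemeι)
    (f ≫ J.subschemeι).isClosedEmbedding.injective hxc
  have := hC.smooth
  have : Smooth (f ≫ (J.subschemeι ≫ π) ≫ sS) := SmoothOfRelativeDimension.smooth 1 _
  obtain ⟨v, hv, hv'⟩ := exists_maximalIdeal_stalk_eq_span_singleton _
    (isRationalPoint_of_isClosed (f ≫ (J.subschemeι ≫ π) ≫ sS) hw)
  have hj := J.subschemeι.stalkMap_surjective (f w)
  have hkj := ker_stalkMap_of_isClosedImmersion J.subschemeι (f w)
  rw [IdealSheafData.ker_subschemeι] at hkj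
  have hkf := ker_stalkMap_of_isClosedImmersion f w
  have hfib : f.ker = (fibreIdeal π z).comap J.subschemeι := by
    rw [fibreIdeal_eq_comap π hz, ← IdealSheafData.comap_comp, ← fibreIdeal_eq_comap _ hz]
    rfl
  rw [hfib, stalkIdeal_comap, ht] at hkf
  let φ := (f.stalkMap w).hom.comp (J.subschemeι.stalkMap (f w)).hom
  have hφ : Function.Surjective φ := (f.stalkMap_surjective w).comp hj
  have hker : RingHom.ker φ = stalkIdeal J (J.subschemeι (f w)) ⊔ Ideal.span {t} := by
    rw [← RingHom.comap_ker, hkf, Ideal.comap_map_of_surjective' _ hj, hkj, sup_comm]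
  obtain ⟨u, rfl⟩ := hφ v
  have : IsLocalHom φ := RingHom.isLocalHom_comp _ _
  refine ⟨u, ?_, fun n hn => hv' n ?_⟩
  · rw [← hker, sup_comm]
    refine maximalIdeal_eq_sup_ker φ hφ ?_
    rw [hv, Ideal.map_span, Set.image_singleton]
  · rw [← hker, RingHom.mem_ker, map_pow] at hn
    exact hn

theorem maximalIdeal_eq_of_surjective_stalkMap (n : ℕ) (q : Y ⟶ X) (y : Y)
    (hq : Function.Surjective (q.stalkMap y).hom) {g : Fin n → Y.presheaf.stalk y}
    (hg : maximalIdeal (Y.presheaf.stalk y) = Ideal.span (Set.range g)) :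
    ∃ g' : Fin n → X.presheaf.stalk (q y), maximalIdeal (X.presheaf.stalk (q y)) =
      Ideal.span (Set.range g') ⊔ RingHom.ker (q.stalkMap y).hom := by
  choose g' hg' using fun i => hq (g i)
  refine ⟨g', maximalIdeal_eq_sup_ker _ hq ?_⟩
  rw [hg, Ideal.map_span, ← Set.range_comp]
  congr 2
  exact funext fun i => (hg' i).symm

theorem maximalIdeal_stalk_eq_span_of_isImmersion (n : ℕ) {s : X ⟶ SpecC}
    [SmoothOfRelativeDimension n s] (j : Y ⟶ X) [IsImmersion j] {y : Y}
    (hy : IsRationalPoint (j ≫ s) y) : ∃ g : Fin n → Y.presheaf.stalk y,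
      maximalIdeal (Y.presheaf.stalk y) = Ideal.span (Set.range g) := by
  obtain ⟨g, hg⟩ := exists_maximalIdeal_stalk_eq_span n s (hy.map j s)
  refine ⟨fun i => (j.stalkMap y).hom (g i), ?_⟩
  rw [← IsLocalRing.map_maximalIdeal_of_surjective (j.stalkMap y).hom
    (j.stalkMap_surjective y), hg, Ideal.map_span, ← Set.range_comp]
  rfl

/-- Two is the dimension of the ambient smooth surface, and immersions are surjective on stalks. -/
theorem IsPrimitiveDoubleCurve.exists_maximalIdeal_stalk_eq {sY : Y ⟶ SpecC}
    (hY : IsPrimitiveDoubleCurve sY) {y : Y} (hy : IsClosed ({y} : Set Y)) :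
    ∃ g : Fin 2 → Y.presheaf.stalk y,
      maximalIdeal (Y.presheaf.stalk y) = Ideal.span (Set.range g) := by
  obtain ⟨U, hyU, T, sT, hT, j, hj, hjs⟩ := hY.locally_in_surface y hy
  have := hY.variety.locallyOfFiniteType
  have := hT.smooth
  obtain ⟨y, rfl⟩ : y ∈ Set.range U.ι := by rwa [Opens.range_ι]
  have hy' := isClosed_singleton_of_injective U.ι U.ι.isOpenEmbedding.injective hy
  obtain ⟨g, hg⟩ := maximalIdeal_stalk_eq_span_of_isImmersion 2 (s := sT) j (y := y)
    (hjs ▸ isRationalPoint_of_isClosed (U.ι ≫ sY) hy')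
  obtain ⟨g', hg'⟩ := maximalIdeal_eq_of_surjective_stalkMap 2 U.ι y
    (U.ι.stalkMap_surjective _) hg
  refine ⟨g', ?_⟩
  have hι : Function.Injective (U.ι.stalkMap y).hom := (ConcreteCategory.bijective_of_isIso _).1
  rwa [(RingHom.injective_iff_ker_eq_bot _).mp hι, sup_bot_eq] at hg'

theorem exists_maximalIdeal_eq_span_triple {sY : Y ⟶ SpecC} (hY : IsPrimitiveDoubleCurve sY)
    {π : X ⟶ S} {P : S} (hP : IsClosed ({P} : Set S)) (e : Y ≅ π.fiber P) {x : X}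
    (hxc : IsClosed ({x} : Set X)) (hx : π x = P) {t : X.presheaf.stalk x}
    (ht : stalkIdeal (fibreIdeal π P) x = Ideal.span {t}) :
    ∃ v w, maximalIdeal (X.presheaf.stalk x) = Ideal.span {t, v, w} := by
  have := isClosedImmersion_fiberι π hP
  let q := e.hom ≫ π.fiberι P
  obtain ⟨y, rfl⟩ : x ∈ Set.range q := by
    obtain ⟨w, rfl⟩ : x ∈ Set.range (π.fiberι P) := by rw [Hom.range_fiberι]; exact hx
    exact ⟨e.inv w, by simp [q, ← Scheme.Hom.comp_apply]⟩
  have hqk : q.ker = fibreIdeal π P := Hom.ker_comp_of_isIso _ _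
  obtain ⟨g, hg⟩ :=
    hY.exists_maximalIdeal_stalk_eq
      (isClosed_singleton_of_injective q q.isClosedEmbedding.injective hxc)
  obtain ⟨g', hg'⟩ := maximalIdeal_eq_of_surjective_stalkMap 2 q y (q.stalkMap_surjective y) hg
  rw [ker_stalkMap_of_isClosedImmersion, hqk, ht] at hg'
  refine ⟨g' 0, g' 1, ?_⟩
  rw [hg', ← Ideal.span_union]
  congr 1
  ext a
  simp [Fin.exists_fin_two, eq_comm]

end LocalStructure

/-! ### The two components and the generic point of the special fibre -/

section Components

open Scheme IsLocalRing

variable {X Y S : Scheme.{0}} {sY : Y ⟶ SpecC} {sS : S ⟶ SpecC} {π : X ⟶ S} {P : S}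
  {X₁ X₂ : TopologicalSpace.Closeds X}

theorem mem_support_reducedIdeal {Z : TopologicalSpace.Closeds X} {x : X} :
    x ∈ (reducedIdeal Z).support ↔ x ∈ Z := by
  rw [← SetLike.mem_coe, IdealSheafData.coe_support_vanishingIdeal, SetLike.mem_coe]

namespace IsMaximalReducibleDeformation

theorem symm (h : IsMaximalReducibleDeformation sY sS π P X₁ X₂) :
    IsMaximalReducibleDeformation sY sS π P X₂ X₁ where
  variety := h.variety
  reduced := h.reduced
  components_ne := h.components_ne.symm
  components := by rw [h.components, Set.pair_comm]
  specialFibre := h.specialFibre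
  family₁ := h.family₂
  family₂ := h.family₁
  specialFibre₁ := h.specialFibre₂
  specialFibre₂ := h.specialFibre₁
  reduced_fibre := h.reduced_fibre
  transversal z hz hzP x h₁ h₂ hx := by
    rw [sup_comm (reducedIdeal X₂)]
    exact h.transversal z hz hzP x h₂ h₁ hx

theorem mem_or_mem (h : IsMaximalReducibleDeformation sY sS π P X₁ X₂) (x : X) :
    x ∈ X₁ ∨ x ∈ X₂ := by
  have h1 := irreducibleComponent_mem_irreducibleComponents x
  have h2 : x ∈ irreducibleComponent x := mem_irreducibleComponent
  rw [h.components, Set.mem_insert_iff, Set.mem_singleton_iff] at h1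
  exact h1.imp (fun e => by rwa [e] at h2) (fun e => by rwa [e] at h2)

theorem inf_eq_bot (h : IsMaximalReducibleDeformation sY sS π P X₁ X₂) :
    reducedIdeal X₁ ⊓ reducedIdeal X₂ = ⊥ := by
  have := h.reduced
  have hsup : X₁ ⊔ X₂ = ⊤ := top_le_iff.mp fun x _ => h.mem_or_mem x
  rw [← IdealSheafData.vanishingIdeal_sup, hsup, IdealSheafData.vanishingIdeal_top,
    nilradical_eq_bot]

/-- Otherwise the ideal of `X₂` would vanish at the generic point of `X₁`, giving `X₁ ⊆ X₂` for two
distinct components. -/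
theorem stalkIdeal_ne_bot (h : IsMaximalReducibleDeformation sY sS π P X₁ X₂) {x : X}
    (hx : x ∈ X₁) : stalkIdeal (reducedIdeal X₂) x ≠ ⊥ := by
  intro hbot
  have h₁ : (X₁ : Set X) ∈ irreducibleComponents X := by rw [h.components]; exact .inl rfl
  have h₂ : (X₂ : Set X) ∈ irreducibleComponents X := by rw [h.components]; exact .inr rfl
  have hgen := h₁.1.isGenericPoint_genericPoint X₁.isClosed
  have hmem : h₁.1.genericPoint ∈ X₂ := by
    rw [← mem_support_reducedIdeal, mem_support_iff_stalkIdeal_le,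
      ← stalkIdeal_map_stalkSpecializes _ (hgen.specializes hx), hbot, Ideal.map_bot]
    exact bot_le
  have hle : (X₁ : Set X) ⊆ X₂ := by
    rw [← hgen.def]
    exact X₂.isClosed.closure_subset_iff.mpr (Set.singleton_subset_iff.mpr hmem)
  exact h.components_ne (SetLike.coe_injective (hle.antisymm (h₁.2 h₂.1 hle)))

theorem isClosed_map (h : IsMaximalReducibleDeformation sY sS π P X₁ X₂)
    [LocallyOfFiniteType sS] {x : X} (hx : IsClosed ({x} : Set X)) :
    IsClosed ({π x} : Set S) := by
  have := h.variety.locallyOfFiniteType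
  have : LocallyOfFiniteType π := locallyOfFiniteType_of_comp π sS
  have : JacobsonSpace S := LocallyOfFiniteType.jacobsonSpace sS
  exact π.closePoints_subset_preimage_closedPoints hx

theorem jacobsonSpace (h : IsMaximalReducibleDeformation sY sS π P X₁ X₂) : JacobsonSpace X := by
  have := h.variety.locallyOfFiniteType
  exact LocallyOfFiniteType.jacobsonSpace (π ≫ sS)

theorem isLocallyNoetherian (h : IsMaximalReducibleDeformation sY sS π P X₁ X₂) :
    IsLocallyNoetherian X := by
  have := h.variety.locallyOfFiniteType
  exact LocallyOfFiniteType.isLocallyNoetherian (π ≫ sS)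

theorem mem_of_map_eq (h : IsMaximalReducibleDeformation sY sS π P X₁ X₂)
    (hP : IsClosed ({P} : Set S)) {x : X} (hx : π x = P) : x ∈ X₁ := by
  have h1 : x ∈ (reducedIdeal X₁ ⊔ fibreIdeal π P).support := by
    rw [h.specialFibre₁, IdealSheafData.support_radical, support_fibreIdeal π hP]
    exact hx
  rw [IdealSheafData.support_sup] at h1
  exact mem_support_reducedIdeal.mp h1.1

theorem exists_generic (h : IsMaximalReducibleDeformation sY sS π P X₁ X₂)
    (hP : IsClosed ({P} : Set S)) : ∃ ξ : X, ∀ x, ξ ⤳ x ↔ π x = P := by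
  have hirr := (h.family₁.fibre P hP).irreducible
  have h1 : IsIrreducible (Set.range (((reducedIdeal X₁).subschemeι ≫ π).fiberι P ≫
      (reducedIdeal X₁).subschemeι)) := by
    rw [← Set.image_univ]
    exact (IrreducibleSpace.isIrreducible_univ _).image _ (Hom.continuous _).continuousOn
  have h2 : Set.range (((reducedIdeal X₁).subschemeι ≫ π).fiberι P ≫
      (reducedIdeal X₁).subschemeι) = π ⁻¹' {P} := by
    rw [Hom.comp_base, TopCat.coe_comp, Set.range_comp, Hom.range_fiberι, Hom.comp_base,
      TopCat.coe_comp, Set.preimage_comp, Set.image_preimage_eq_inter_range,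
      IdealSheafData.range_subschemeι, IdealSheafData.coe_support_vanishingIdeal]
    exact Set.inter_eq_left.mpr fun x hx => h.mem_of_map_eq hP hx
  rw [h2] at h1
  exact ⟨h1.genericPoint, fun x =>
    (h1.isGenericPoint_genericPoint (hP.preimage π.continuous)).specializes_iff_mem⟩

theorem exists_isClosed (h : IsMaximalReducibleDeformation sY sS π P X₁ X₂)
    (hP : IsClosed ({P} : Set S)) : ∃ x : X, IsClosed ({x} : Set X) ∧ π x = P := by
  have := h.jacobsonSpace
  obtain ⟨ξ, hξ⟩ := h.exists_generic hP
  obtain ⟨x, hx, hx'⟩ := nonempty_inter_closedPoints (Z := π ⁻¹' {P})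
    ⟨ξ, (hξ ξ).mp specializes_rfl⟩ (hP.preimage π.continuous).isLocallyClosed
  exact ⟨x, hx', hx⟩

end IsMaximalReducibleDeformation

/-- The properties at a closed point of the special fibre of the local equation `t` of that fibre
that are used in the study of the contact of the two components. -/
structure IsSpecialPoint (π : X ⟶ S) (P : S) (X₁ X₂ : TopologicalSpace.Closeds X) (x : X)
    (t : X.presheaf.stalk x) : Prop where
  noetherian : IsNoetherianRing (X.presheaf.stalk x)
  mem : t ∈ maximalIdeal (X.presheaf.stalk x)
  fibre_eq : stalkIdeal (fibreIdeal π P) x = Ideal.span {t}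
  isPrime : (stalkIdeal (fibreIdeal π P).radical x).IsPrime
  eq₁ : stalkIdeal (reducedIdeal X₁) x ⊔ Ideal.span {t} = stalkIdeal (fibreIdeal π P).radical x
  eq₂ : stalkIdeal (reducedIdeal X₂) x ⊔ Ideal.span {t} = stalkIdeal (fibreIdeal π P).radical x
  regular₁ : IsRegularMod (stalkIdeal (reducedIdeal X₁) x) t
  regular₂ : IsRegularMod (stalkIdeal (reducedIdeal X₂) x) t
  inf_eq_bot : stalkIdeal (reducedIdeal X₁) x ⊓ stalkIdeal (reducedIdeal X₂) x = ⊥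
  ne_bot₁ : stalkIdeal (reducedIdeal X₁) x ≠ ⊥
  ne_bot₂ : stalkIdeal (reducedIdeal X₂) x ≠ ⊥
  exists_eq_span : ∃ g, stalkIdeal (fibreIdeal π P).radical x = Ideal.span {t, g}

/-- Flatness of the two families gives regularity of `t`, smoothness of `C` gives primality of its
ideal, and the local embedding of `Y` in a surface gives its two generators. -/
theorem IsMaximalReducibleDeformation.isSpecialPoint
    (h : IsMaximalReducibleDeformation sY sS π P X₁ X₂) [SmoothOfRelativeDimension 1 sS]
    (hY : IsPrimitiveDoubleCurve sY) (hP : IsClosed ({P} : Set S)) {x : X}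
    (hxc : IsClosed ({x} : Set X)) (hx : π x = P) {t : X.presheaf.stalk x}
    (ht : stalkIdeal (fibreIdeal π P) x = Ideal.span {t}) :
    IsSpecialPoint π P X₁ X₂ x t := by
  have := h.isLocallyNoetherian
  have hnoeth : IsNoetherianRing (X.presheaf.stalk x) := inferInstance
  have hx₁ := h.mem_of_map_eq hP hx
  have hx₂ := h.symm.mem_of_map_eq hP hx
  have htm : t ∈ maximalIdeal (X.presheaf.stalk x) := by
    have := (mem_support_iff_stalkIdeal_le _ x).mp ((support_fibreIdeal π hP x).mpr hx)
    exact this (ht ▸ Ideal.mem_span_singleton_self t)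
  have eq₁ : stalkIdeal (reducedIdeal X₁) x ⊔ Ideal.span {t} =
      stalkIdeal (fibreIdeal π P).radical x := by
    rw [← h.specialFibre₁, stalkIdeal_sup, ht]
  have eq₂ : stalkIdeal (reducedIdeal X₂) x ⊔ Ideal.span {t} =
      stalkIdeal (fibreIdeal π P).radical x := by
    rw [← h.specialFibre₂, stalkIdeal_sup, ht]
  obtain ⟨u, hm, hu⟩ := h.family₁.exists_maximalIdeal_eq
    (mem_support_reducedIdeal.mpr hx₁) hxc hP hx ht
  rw [eq₁] at hm hu
  have hprime := isPrime_of_maximalIdeal_eq_sup hm hu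
  obtain ⟨e, -⟩ := h.specialFibre
  obtain ⟨v, w, hvw⟩ := exists_maximalIdeal_eq_span_triple hY hP e hxc hx ht
  have hP' := hP
  rw [← hx] at hP'
  have ht' := ht
  rw [← hx] at ht'
  exact
    { noetherian := hnoeth
      mem := htm
      fibre_eq := ht
      isPrime := hprime
      eq₁ := eq₁
      eq₂ := eq₂
      regular₁ := h.family₁.isRegularMod (mem_support_reducedIdeal.mpr hx₁) hP' ht'
      regular₂ := h.family₂.isRegularMod (mem_support_reducedIdeal.mpr hx₂) hP' ht'
      inf_eq_bot := stalkIdeal_inf_eq_bot h.inf_eq_bot x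
      ne_bot₁ := h.symm.stalkIdeal_ne_bot hx₂
      ne_bot₂ := h.stalkIdeal_ne_bot hx₁
      exists_eq_span := exists_eq_span_pair
        (eq₁ ▸ Ideal.mem_sup_right (Ideal.mem_span_singleton_self t)) hprime hm
        (by simpa using hu 1) hvw }

/-- A section is a unit on an open set, which contains `ξ` as soon as it meets the fibre. So a
section vanishing at `ξ` vanishes on the whole fibre, hence lies in the radical. -/
theorem comap_stalkSpecializes_maximalIdeal (hP : IsClosed ({P} : Set S)) {ξ : X}
    (hξ : ∀ x, ξ ⤳ x ↔ π x = P) {x : X} (hx : ξ ⤳ x) :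
    (maximalIdeal (X.presheaf.stalk ξ)).comap (X.presheaf.stalkSpecializes hx).hom =
      stalkIdeal (fibreIdeal π P).radical x := by
  apply le_antisymm
  · intro a ha
    obtain ⟨U, hU⟩ := exists_affineOpens_mem x
    obtain ⟨r, s, hs, hrs⟩ := exists_mul_germ_eq U hU a
    have hξU := hx.mem_open U.1.2 hU
    have hr : (X.presheaf.germ U.1 ξ hξU).hom r ∈ maximalIdeal (X.presheaf.stalk ξ) := by
      rw [← X.presheaf.germ_stalkSpecializes hU hx, CommRingCat.hom_comp, RingHom.comp_apply,
        ← hrs, map_mul]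
      exact Ideal.mul_mem_right _ _ ha
    have hrad : r ∈ (fibreIdeal π P).radical.ideal U := by
      rw [← IdealSheafData.vanishingIdeal_support]
      refine (mem_vanishingIdeal_iff _ U r).mpr fun y hy hyC hu => ?_
      have hξy : ξ ⤳ y := (hξ y).mpr ((support_fibreIdeal π hP y).mp hyC)
      have := (Scheme.mem_basicOpen _ r y hy).mpr hu
      exact hr ((Scheme.mem_basicOpen _ r ξ hξU).mp (hξy.mem_open (X.basicOpen r).2 this))
    rw [← Ideal.mul_unit_mem_iff_mem _ hs, hrs, stalkIdeal_eq_map _ U hU]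
    exact Ideal.mem_map_of_mem _ hrad
  · rw [← Ideal.map_le_iff_le_comap, stalkIdeal_map_stalkSpecializes,
      ← mem_support_iff_stalkIdeal_le, IdealSheafData.support_radical, support_fibreIdeal π hP]
    exact (hξ ξ).mp specializes_rfl

/-- The left side involves neither `x` nor `t`, `l`, `e`. Localizing at the ideal of `C` turns the
existence of `b ∉ K` with `t ^ n * b ∈ I₁ + I₂` into membership of `t ^ n` at `ξ`. -/
theorem IsSpecialPoint.le_iff {x : X} {t : X.presheaf.stalk x}
    (h : IsSpecialPoint π P X₁ X₂ x t) (hP : IsClosed ({P} : Set S)) {ξ : X}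
    (hξ : ∀ x, ξ ⤳ x ↔ π x = P) (hx : π x = P) {p : ℕ} {l e : X.presheaf.stalk x}
    (hc : IsContact (stalkIdeal (reducedIdeal X₁) x) (stalkIdeal (reducedIdeal X₂) x)
      (stalkIdeal (fibreIdeal π P).radical x) t l e p) (n : ℕ) :
    stalkIdeal (fibreIdeal π P ^ n) ξ ≤ stalkIdeal (reducedIdeal X₁ ⊔ reducedIdeal X₂) ξ ↔
      p ≤ n := by
  have := h.noetherian
  have hξx := (hξ x).mpr hx
  rw [← hc.pow_mul_mem_iff h.mem h.eq₁ h.eq₂ h.regular₁ h.regular₂ n,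
    ← stalkIdeal_map_stalkSpecializes _ hξx, ← stalkIdeal_map_stalkSpecializes _ hξx,
    stalkIdeal_pow, h.fibre_eq, Ideal.span_singleton_pow, Ideal.map_span, Set.image_singleton,
    Ideal.span_singleton_le_iff_mem, stalkIdeal_sup]
  let := (X.presheaf.stalkSpecializes hξx).hom.toAlgebra
  have hloc := isLocalization_stalkSpecializes hξx
  refine (IsLocalization.algebraMap_mem_map_algebraMap_iff
    ((maximalIdeal (X.presheaf.stalk ξ)).comap (X.presheaf.stalkSpecializes hξx).hom).primeCompl
    (X.presheaf.stalk ξ) _ _).trans ?_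
  refine exists_congr fun b => ?_
  rw [mul_comm b]
  refine and_congr_left fun _ => ?_
  rw [← comap_stalkSpecializes_maximalIdeal hP hξ hξx]
  rfl

end Components

/-! ### The contact exponent and the ideal of the intersection curve -/

section Charts

open Scheme IsLocalRing

variable {X Y S : Scheme.{0}} {sY : Y ⟶ SpecC} {sS : S ⟶ SpecC} {π : X ⟶ S} {P : S}
  {X₁ X₂ : TopologicalSpace.Closeds X}

theorem IsContactExponent.exists_isContact {p : ℕ} (hp : IsContactExponent π P X₁ X₂ p)
    (h : IsMaximalReducibleDeformation sY sS π P X₁ X₂) [SmoothOfRelativeDimension 1 sS]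
    (hY : IsPrimitiveDoubleCurve sY) (hP : IsClosed ({P} : Set S)) {x : X}
    (hxc : IsClosed ({x} : Set X)) (hx : π x = P) :
    ∃ t l e, IsSpecialPoint π P X₁ X₂ x t ∧
      IsContact (stalkIdeal (reducedIdeal X₁) x) (stalkIdeal (reducedIdeal X₂) x)
        (stalkIdeal (fibreIdeal π P).radical x) t l e p := by
  obtain ⟨t, l, e, ht, hl, he₁, he₂, hK⟩ := hp.2 x hxc hx
  have hs := h.isSpecialPoint hY hP hxc hx ht
  exact ⟨t, l, e, hs, hs.eq₁ ▸ hl, he₁, he₂, hK⟩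

theorem IsMaximalReducibleDeformation.existsUnique_isContactExponent
    (h : IsMaximalReducibleDeformation sY sS π P X₁ X₂) [SmoothOfRelativeDimension 1 sS]
    (hY : IsPrimitiveDoubleCurve sY) (hP : IsClosed ({P} : Set S)) :
    ∃! p : ℕ, IsContactExponent π P X₁ X₂ p := by
  obtain ⟨ξ, hξ⟩ := h.exists_generic hP
  have key : ∀ x : X, IsClosed ({x} : Set X) → π x = P → ∃ t p l e,
      IsSpecialPoint π P X₁ X₂ x t ∧
      IsContact (stalkIdeal (reducedIdeal X₁) x) (stalkIdeal (reducedIdeal X₂) x)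
        (stalkIdeal (fibreIdeal π P).radical x) t l e p := by
    intro x hxc hx
    obtain ⟨t, -, ht⟩ := exists_stalkIdeal_fibreIdeal_eq sS π (x := x) (hx ▸ hP)
    rw [hx] at ht
    have hs := h.isSpecialPoint hY hP hxc hx ht
    have := hs.noetherian
    obtain ⟨g, hg⟩ := hs.exists_eq_span
    obtain ⟨p, l, e, hc⟩ := exists_isContact hs.mem hs.eq₁ hs.eq₂ hs.inf_eq_bot hs.ne_bot₂
      hs.regular₂ hg
    exact ⟨t, p, l, e, hs, hc⟩
  obtain ⟨x₀, hx₀c, hx₀⟩ := h.exists_isClosed hP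
  obtain ⟨t₀, p, l₀, e₀, hs₀, hc₀⟩ := key x₀ hx₀c hx₀
  refine ⟨p, ⟨hc₀.pos hs₀.eq₁ hs₀.eq₂, fun x hxc hx => ?_⟩, fun q hq => ?_⟩
  · obtain ⟨t, q, l, e, hs, hc⟩ := key x hxc hx
    -- Exponents at two closed points agree because both are read off at `ξ`.
    have hpq : q = p := le_antisymm
      ((hs.le_iff hP hξ hx hc p).mp ((hs₀.le_iff hP hξ hx₀ hc₀ p).mpr le_rfl))
      ((hs₀.le_iff hP hξ hx₀ hc₀ q).mp ((hs.le_iff hP hξ hx hc q).mpr le_rfl))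
    subst hpq
    exact ⟨t, l, e, hs.fibre_eq, hs.eq₁ ▸ hc.notMem, hc.sub_mem, hc.mem, hc.eq_span⟩
  · obtain ⟨t, l, e, hs, hc⟩ := hq.exists_isContact h hY hP hx₀c hx₀
    exact le_antisymm
      ((hs.le_iff hP hξ hx₀ hc p).mp ((hs₀.le_iff hP hξ hx₀ hc₀ p).mpr le_rfl))
      ((hs₀.le_iff hP hξ hx₀ hc₀ q).mp ((hs.le_iff hP hξ hx₀ hc q).mpr le_rfl))

theorem mem_of_stalkIdeal_sup_le {x : X}
    (h : stalkIdeal (reducedIdeal X₁ ⊔ reducedIdeal X₂) x ≤ maximalIdeal _) :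
    x ∈ X₁ ∧ x ∈ X₂ := by
  rw [← mem_support_iff_stalkIdeal_le, IdealSheafData.support_sup] at h
  exact ⟨mem_support_reducedIdeal.mp h.1, mem_support_reducedIdeal.mp h.2⟩

/-- The prime `I₁ + I₂` at `x` is the ideal of a generization `y` of `x`. This `y` lies on both
components, and off the fibre since the fibre is closed; hence `r` vanishes at `y`. -/
theorem germ_mem_of_mem_ideal_intersectionCurve (hP : IsClosed ({P} : Set S)) (U : X.affineOpens)
    {r : Γ(X, U.1)} (hr : r ∈ (reducedIdeal (intersectionCurve π P X₁ X₂)).ideal U) {x : X}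
    (hx : x ∈ U.1) (hxP : π x ≠ P)
    (hN : (stalkIdeal (reducedIdeal X₁ ⊔ reducedIdeal X₂) x).IsPrime) :
    (X.presheaf.germ U.1 x hx).hom r ∈ stalkIdeal (reducedIdeal X₁ ⊔ reducedIdeal X₂) x := by
  obtain ⟨y, hy, hyx, hyr⟩ := exists_specializes_of_isPrime U hx
    (stalkIdeal (reducedIdeal X₁ ⊔ reducedIdeal X₂) x)
  rw [← hyr]
  have hyN : stalkIdeal (reducedIdeal X₁ ⊔ reducedIdeal X₂) y ≤ maximalIdeal _ := by
    rw [stalkIdeal_eq_map _ U hy, Ideal.map_le_iff_le_comap]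
    intro a ha
    refine (hyr a).mpr ?_
    rw [stalkIdeal_eq_map _ U hx]
    exact Ideal.mem_map_of_mem _ ha
  refine (mem_vanishingIdeal_closure_iff _ U r).mp hr y hy
    ⟨(mem_of_stalkIdeal_sup_le hyN).1, (mem_of_stalkIdeal_sup_le hyN).2, fun hyP => hxP ?_⟩
  exact (hyx.map π.continuous).mem_closed hP hyP

theorem exists_isClosed_point [JacobsonSpace X] (U : X.affineOpens) (M : Ideal Γ(X, U.1))
    {f : Γ(X, U.1)} (hf : f ∉ M.radical) : ∃ (y : X) (hy : y ∈ U.1), IsClosed ({y} : Set X) ∧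
      (∀ a ∈ M, (X.presheaf.germ U.1 y hy).hom a ∈ maximalIdeal _) ∧
      (X.presheaf.germ U.1 y hy).hom f ∉ maximalIdeal _ := by
  obtain ⟨q, hqM, hq, hqf⟩ : ∃ q : Ideal Γ(X, U.1), M ≤ q ∧ q.IsPrime ∧ f ∉ q := by
    by_contra! hcon
    rw [Ideal.radical_eq_sInf, Ideal.mem_sInf] at hf
    exact hf fun {q} hq => hcon q hq.1 hq.2
  have key : ∀ (y : X) (hy : y ∈ U.1) (a : Γ(X, U.1)),
      (X.presheaf.germ U.1 y hy).hom a ∈ maximalIdeal _ ↔ y ∉ X.basicOpen a := fun y hy a => by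
    rw [Scheme.mem_basicOpen _ a y hy, mem_maximalIdeal, mem_nonunits_iff]
  obtain ⟨hqU, h1⟩ := fromSpec_mem_and_primeIdealOf U ⟨q, hq⟩
  have hq' : ∀ a, a ∈ q ↔
      IsAffineOpen.fromSpec U.2 (⟨q, hq⟩ : PrimeSpectrum Γ(X, U.1)) ∉ X.basicOpen a := fun a => by
    rw [← key _ hqU, ← mem_primeIdealOf_iff U hqU, h1]
  obtain ⟨y, ⟨hyM, hyf⟩, hyc⟩ := nonempty_inter_closedPoints
    (Z := X.zeroLocus (U := U.1) M ∩ X.basicOpen f)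
    ⟨_, (mem_zeroLocus_iff ..).mpr fun a ha => (hq' a).mp (hqM ha), not_not.mp fun hn =>
      hqf ((hq' f).mpr hn)⟩
    ((X.zeroLocus_isClosed _).isLocallyClosed.inter (X.basicOpen f).2.isLocallyClosed)
  refine ⟨y, X.basicOpen_le f hyf, hyc, fun a ha => (key _ _ a).mpr ?_, fun hn =>
    (key _ _ f).mp hn hyf⟩
  exact (mem_zeroLocus_iff ..).mp hyM a ha

/-- Primality in `hN` says that the intersection of the components is reduced at closed points off
the fibre, so its ideal differs from that of `Z` only by elements killed by powers of the fibre
ideal. -/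
theorem mem_stalkIdeal_intersectionCurve_iff [JacobsonSpace X] [IsLocallyNoetherian X]
    (hP : IsClosed ({P} : Set S))
    (hN : ∀ y : X, IsClosed ({y} : Set X) → y ∈ X₁ → y ∈ X₂ → π y ≠ P →
      (stalkIdeal (reducedIdeal X₁ ⊔ reducedIdeal X₂) y).IsPrime)
    {x : X} {t : X.presheaf.stalk x} (ht : stalkIdeal (fibreIdeal π P) x = Ideal.span {t})
    (a : X.presheaf.stalk x) :
    a ∈ stalkIdeal (reducedIdeal (intersectionCurve π P X₁ X₂)) x ↔
      ∃ n : ℕ, t ^ n * a ∈ stalkIdeal (reducedIdeal X₁ ⊔ reducedIdeal X₂) x := by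
  obtain ⟨U, hU⟩ := exists_affineOpens_mem x
  have : IsNoetherianRing Γ(X, U.1) := IsLocallyNoetherian.component_noetherian U
  set N := reducedIdeal X₁ ⊔ reducedIdeal X₂ with hNdef
  set F := fibreIdeal π P with hF
  have hmap : ∀ n : ℕ, ((F.ideal U) ^ n).map (X.presheaf.germ U.1 x hU).hom =
      Ideal.span {t ^ n} := fun n => by
    rw [Ideal.map_pow, ← stalkIdeal_eq_map F U hU, ht, Ideal.span_singleton_pow]
  obtain ⟨r, s, hs, hrs⟩ := exists_mul_germ_eq U hU a
  have hZ : a ∈ stalkIdeal (reducedIdeal (intersectionCurve π P X₁ X₂)) x ↔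
      (X.presheaf.germ U.1 x hU).hom r ∈
        stalkIdeal (reducedIdeal (intersectionCurve π P X₁ X₂)) x := by
    rw [← hrs, Ideal.mul_unit_mem_iff_mem _ hs]
  have hNn : ∀ n, t ^ n * a ∈ stalkIdeal N x ↔
      t ^ n * (X.presheaf.germ U.1 x hU).hom r ∈ stalkIdeal N x := fun n => by
    rw [← hrs, ← mul_assoc, Ideal.mul_unit_mem_iff_mem _ hs]
  simp only [hZ, hNn]
  rw [germ_mem_stalkIdeal_iff _ U hU]
  constructor
  · rintro ⟨c, hc, hcr⟩
    -- The closed subset defined by `M = (N : c * r)` lies in the fibre: at a closed point off the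
    -- fibre, `c * r` is locally in `N`, so `M` contains a unit there. By Noetherianity a power of
    -- the fibre ideal is contained in `M`.
    let M : Ideal Γ(X, U.1) := colonElement (N.ideal U) (c * r)
    have hFM : F.ideal U ≤ M.radical := by
      intro f hf
      by_contra hfM
      obtain ⟨y, hy, hyc, hyM, hyf⟩ := exists_isClosed_point U M hfM
      have hyN : stalkIdeal N y ≤ maximalIdeal _ := by
        rw [stalkIdeal_eq_map _ U hy, Ideal.map_le_iff_le_comap]
        exact fun b hb => hyM b (Ideal.mul_mem_left (N.ideal U) _ hb)
      have hyP : π y ≠ P := fun hyP => hyf <| by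
        have := (mem_support_iff_stalkIdeal_le _ y).mp ((support_fibreIdeal π hP y).mpr hyP)
        refine this ?_
        rw [stalkIdeal_eq_map _ U hy]
        exact Ideal.mem_map_of_mem _ hf
      obtain ⟨hy₁, hy₂⟩ := mem_of_stalkIdeal_sup_le hyN
      have h1 := germ_mem_of_mem_ideal_intersectionCurve hP U hcr hy hyP (hN y hyc hy₁ hy₂ hyP)
      obtain ⟨d, hd, hdr⟩ := (germ_mem_stalkIdeal_iff _ U hy _).mp h1
      rw [mul_comm] at hdr
      exact (mem_maximalIdeal _).mp (hyM d hdr) hd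
    obtain ⟨n, hn⟩ := Ideal.exists_pow_le_of_le_radical_of_fg hFM
      (IsNoetherian.noetherian (F.ideal U))
    refine ⟨n, ?_⟩
    have h1 : t ^ n ∈ ((F.ideal U) ^ n).map (X.presheaf.germ U.1 x hU).hom :=
      hmap n ▸ Ideal.mem_span_singleton_self _
    have h2 : t ^ n ∈ colonElement (stalkIdeal N x)
        ((X.presheaf.germ U.1 x hU).hom (c * r)) := by
      refine (Ideal.map_le_iff_le_comap.mpr fun b hb => ?_ : Ideal.map _ _ ≤ _) h1
      change (X.presheaf.germ U.1 x hU).hom (c * r) * (X.presheaf.germ U.1 x hU).hom b ∈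
        stalkIdeal N x
      rw [← map_mul, stalkIdeal_eq_map _ U hU]
      exact Ideal.mem_map_of_mem _ (hn hb)
    have h3 : (X.presheaf.germ U.1 x hU).hom (c * r) * t ^ n ∈ stalkIdeal N x := h2
    rw [map_mul, mul_assoc, mul_comm ((X.presheaf.germ U.1 x hU).hom r)] at h3
    exact (Ideal.unit_mul_mem_iff_mem _ hc).mp h3
  · rintro ⟨n, hn⟩
    let := X.presheaf.algebra_section_stalk ⟨x, hU⟩
    have hloc := U.2.isLocalization_stalk ⟨x, hU⟩
    obtain ⟨f, hf, hf'⟩ := exists_notMem_forall_mul_mem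
      (IsAffineOpen.primeIdealOf U.2 ⟨x, hU⟩).asIdeal (X.presheaf.stalk x)
      (K := F.ideal U ^ n * Ideal.span {r}) (L := N.ideal U) (IsNoetherian.noetherian _) (by
        change Ideal.map (X.presheaf.germ U.1 x hU).hom _ ≤
          Ideal.map (X.presheaf.germ U.1 x hU).hom _
        rw [Ideal.map_mul, hmap, Ideal.map_span, Set.image_singleton,
          Ideal.span_singleton_mul_span_singleton, Ideal.span_singleton_le_iff_mem,
          ← stalkIdeal_eq_map]
        exact hn)
    refine ⟨f, ?_, (mem_vanishingIdeal_closure_iff _ U _).mpr ?_⟩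
    · rw [mem_primeIdealOf_iff U hU] at hf
      simpa using hf
    · rintro y hy ⟨hy₁, hy₂, hyP⟩
      -- Off the fibre some `g` in its ideal is invertible at `y`, so `f * g ^ n * r ∈ N` forces `f
      -- * r` to vanish at `y`.
      obtain ⟨g, hg, hgy⟩ : ∃ g ∈ F.ideal U,
          (X.presheaf.germ U.1 y hy).hom g ∉ maximalIdeal _ := by
        by_contra! hcon
        refine hyP ((support_fibreIdeal π hP y).mp ((mem_support_iff_stalkIdeal_le _ y).mpr ?_))
        rw [stalkIdeal_eq_map _ U hy, Ideal.map_le_iff_le_comap]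
        exact hcon
      have hNy : stalkIdeal N y ≤ maximalIdeal _ := by
        rw [← mem_support_iff_stalkIdeal_le, hNdef, IdealSheafData.support_sup]
        exact ⟨mem_support_reducedIdeal.mpr hy₁, mem_support_reducedIdeal.mpr hy₂⟩
      have h1 : f * (g ^ n * r) ∈ N.ideal U :=
        hf' _ (Ideal.mul_mem_mul (Ideal.pow_mem_pow hg n) (Ideal.mem_span_singleton_self r))
      have h2 : (X.presheaf.germ U.1 y hy).hom (f * (g ^ n * r)) ∈ maximalIdeal _ := by
        refine hNy ?_
        rw [stalkIdeal_eq_map _ U hy]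
        exact Ideal.mem_map_of_mem _ h1
      rw [mul_left_comm, map_mul, map_pow] at h2
      exact (Ideal.IsPrime.mem_or_mem inferInstance h2).resolve_left fun h3 =>
        hgy (Ideal.IsPrime.mem_of_pow_mem inferInstance n h3)

end Charts

/-! ### Gluing charts at closed points and their spreading out -/

section Charts

open Scheme IsLocalRing

variable {X Y S : Scheme.{0}} {sY : Y ⟶ SpecC} {sS : S ⟶ SpecC} {π : X ⟶ S} {P : S}
  {X₁ X₂ : TopologicalSpace.Closeds X}

theorem isRegularMod_one {R : Type*} [CommRing R] (I : Ideal R) : IsRegularMod I 1 :=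
  fun a ha => by simpa using ha

/-- Away from `C` the components are separated, so `s = 1` and necessarily `l = e + e'`; this
element already lies in `I₁ + I₂`. -/
theorem isGluingChart_one {R : Type*} [CommRing R] {I₁ I₂ J Z : Ideal R} {e e' : R}
    (h₁ : I₁ = Ideal.span {e'}) (h₂ : I₂ = Ideal.span {e}) (hinf : I₁ ⊓ I₂ = ⊥) (hJ : J = ⊤)
    (hZ : Z = I₁ ⊔ I₂) (hr₁ : IsRegularMod I₁ (e + e')) (hr₂ : IsRegularMod I₂ (e + e')) :
    IsGluingChart I₁ I₂ J Z e e' 1 (e + e') where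
  eq₁ := h₁
  eq₂ := h₂
  inf := hinf
  add := (one_mul _).symm
  glue := by rw [hJ, Ideal.span_singleton_one, sup_top_eq]
  center := by
    rw [hZ, eq_comm, sup_eq_left, Ideal.span_singleton_le_iff_mem]
    exact add_mem (Ideal.mem_sup_right (h₂ ▸ Ideal.mem_span_singleton_self e))
      (Ideal.mem_sup_left (h₁ ▸ Ideal.mem_span_singleton_self e'))
  regular₁ := hr₁
  regular₂ := hr₂
  regular := isRegularMod_one _

theorem exists_isGluingChart_of_eq_top {R : Type*} [CommRing R] {I₁ I₂ J Z : Ideal R}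
    (hinf : I₁ ⊓ I₂ = ⊥) (hJ : J = ⊤) (hZ : Z = I₁ ⊔ I₂) (h : I₁ = ⊤ ∨ I₂ = ⊤) :
    ∃ e e' s l, IsGluingChart I₁ I₂ J Z e e' s l := by
  rcases h with rfl | rfl
  · rw [top_inf_eq] at hinf
    refine ⟨0, 1, 1, 0 + 1, isGluingChart_one Ideal.span_singleton_one.symm
      (by rw [hinf, Ideal.span_singleton_zero]) (by rw [hinf, inf_bot_eq]) hJ hZ ?_ ?_⟩ <;>
    · rw [zero_add]; exact isRegularMod_one _
  · rw [inf_top_eq] at hinf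
    refine ⟨1, 0, 1, 1 + 0, isGluingChart_one (by rw [hinf, Ideal.span_singleton_zero])
      Ideal.span_singleton_one.symm (by rw [hinf, bot_inf_eq]) hJ hZ ?_ ?_⟩ <;>
    · rw [add_zero]; exact isRegularMod_one _

namespace IsMaximalReducibleDeformation

theorem span_isRadical (h : IsMaximalReducibleDeformation sY sS π P X₁ X₂) {x : X}
    (hz : IsClosed ({π x} : Set S)) (hxP : π x ≠ P) {t : X.presheaf.stalk x}
    (ht : stalkIdeal (fibreIdeal π (π x)) x = Ideal.span {t}) : (Ideal.span {t}).IsRadical := by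
  have hred := h.reduced_fibre _ hz hxP
  have := isClosedImmersion_fiberι π hz
  have key : ∀ y ∈ Set.range (π.fiberι (π x)), (stalkIdeal (fibreIdeal π (π x)) y).IsRadical := by
    rintro _ ⟨w, rfl⟩
    rw [fibreIdeal, ← ker_stalkMap_of_isClosedImmersion]
    intro a ⟨n, hn⟩
    rw [RingHom.mem_ker, map_pow] at hn
    exact IsReduced.eq_zero _ ⟨n, hn⟩
  exact ht ▸ key x (by rw [Hom.range_fiberι]; rfl)

theorem isPrime_stalkIdeal (h : IsMaximalReducibleDeformation sY sS π P X₁ X₂)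
    [SmoothOfRelativeDimension 1 sS] {x : X} (hxc : IsClosed ({x} : Set X)) (hx : x ∈ X₁)
    (hz : IsClosed ({π x} : Set S)) {t : X.presheaf.stalk x}
    (ht : stalkIdeal (fibreIdeal π (π x)) x = Ideal.span {t}) (htm : t ∈ maximalIdeal _) :
    (stalkIdeal (reducedIdeal X₁) x).IsPrime := by
  have := h.isLocallyNoetherian
  obtain ⟨u, hm, hu⟩ := h.family₁.exists_maximalIdeal_eq
    (mem_support_reducedIdeal.mpr hx) hxc hz rfl ht
  exact isPrime_of_isPrime_sup htm
    (h.family₁.isRegularMod (mem_support_reducedIdeal.mpr hx) hz ht)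
    (isPrime_of_maximalIdeal_eq_sup hm hu)

theorem pow_notMem_sup (h : IsMaximalReducibleDeformation sY sS π P X₁ X₂)
    [SmoothOfRelativeDimension 1 sS] {x : X} (hx₁ : x ∈ X₁) (hx₂ : x ∈ X₂)
    (hz : IsClosed ({π x} : Set S)) (hxP : π x ≠ P) {t : X.presheaf.stalk x}
    (ht : stalkIdeal (fibreIdeal π (π x)) x = Ideal.span {t}) (n : ℕ) :
    t ^ n ∉ stalkIdeal (reducedIdeal X₁) x ⊔ stalkIdeal (reducedIdeal X₂) x := by
  refine pow_notMem_sup_of_isRadical ?_ (stalkIdeal_inf_eq_bot h.inf_eq_bot x)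
    (h.family₁.isRegularMod (mem_support_reducedIdeal.mpr hx₁) hz ht)
    (h.family₂.isRegularMod (mem_support_reducedIdeal.mpr hx₂) hz ht)
    (h.span_isRadical hz hxP ht) n
  intro htop
  have := sup_le ((mem_support_iff_stalkIdeal_le _ x).mp (mem_support_reducedIdeal.mpr hx₁))
    ((mem_support_iff_stalkIdeal_le _ x).mp (mem_support_reducedIdeal.mpr hx₂))
  rw [htop] at this
  exact (maximalIdeal.isMaximal (X.presheaf.stalk x)).ne_top (top_le_iff.mp this)

theorem maximalIdeal_eq_sup (h : IsMaximalReducibleDeformation sY sS π P X₁ X₂) {x : X}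
    (hx₁ : x ∈ X₁) (hx₂ : x ∈ X₂) (hz : IsClosed ({π x} : Set S)) (hxP : π x ≠ P)
    {t : X.presheaf.stalk x} (ht : stalkIdeal (fibreIdeal π (π x)) x = Ideal.span {t}) :
    maximalIdeal (X.presheaf.stalk x) =
      stalkIdeal (reducedIdeal X₁) x ⊔ stalkIdeal (reducedIdeal X₂) x ⊔ Ideal.span {t} := by
  rw [← h.transversal _ hz hxP x hx₁ hx₂ rfl, stalkIdeal_sup, stalkIdeal_sup, ht]

/-- By transversality `I₁ + I₂` and `t` generate the maximal ideal, and reducedness of the fibre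
keeps `t` from being nilpotent modulo `I₁ + I₂`. -/
theorem isPrime_stalkIdeal_sup (h : IsMaximalReducibleDeformation sY sS π P X₁ X₂)
    [SmoothOfRelativeDimension 1 sS] {x : X} (hxc : IsClosed ({x} : Set X)) (hx₁ : x ∈ X₁)
    (hx₂ : x ∈ X₂) (hxP : π x ≠ P) :
    (stalkIdeal (reducedIdeal X₁ ⊔ reducedIdeal X₂) x).IsPrime := by
  have : Smooth sS := SmoothOfRelativeDimension.smooth 1 sS
  have := h.isLocallyNoetherian
  have hz := h.isClosed_map hxc
  obtain ⟨t, -, ht⟩ := exists_stalkIdeal_fibreIdeal_eq sS π hz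
  rw [stalkIdeal_sup]
  exact isPrime_of_maximalIdeal_eq_sup (h.maximalIdeal_eq_sup hx₁ hx₂ hz hxP ht)
    (h.pow_notMem_sup hx₁ hx₂ hz hxP ht)

theorem stalkIdeal_intersectionCurve_eq_sup
    (h : IsMaximalReducibleDeformation sY sS π P X₁ X₂) [SmoothOfRelativeDimension 1 sS]
    (hP : IsClosed ({P} : Set S)) {x : X} (hxP : π x ≠ P) :
    stalkIdeal (reducedIdeal (intersectionCurve π P X₁ X₂)) x =
      stalkIdeal (reducedIdeal X₁) x ⊔ stalkIdeal (reducedIdeal X₂) x := by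
  have := h.isLocallyNoetherian
  have := h.jacobsonSpace
  ext a
  -- Off the fibre its local equation is `1`, and saturating changes nothing.
  rw [mem_stalkIdeal_intersectionCurve_iff hP (fun y hyc hy₁ hy₂ hyP =>
    h.isPrime_stalkIdeal_sup hyc hy₁ hy₂ hyP) (t := 1), stalkIdeal_sup]
  · simp
  · rw [stalkIdeal_fibreIdeal_of_ne π hP hxP, Ideal.span_singleton_one]

theorem stalkIdeal_infinitesimalIdeal (x : X) (p : ℕ) :
    stalkIdeal (infinitesimalIdeal π P X₁ X₂ p) x =
      stalkIdeal (reducedIdeal X₁) x ⊔ stalkIdeal (reducedIdeal X₂) x ⊔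
        stalkIdeal (fibreIdeal π P) x ^ p := by
  rw [infinitesimalIdeal, stalkIdeal_sup, stalkIdeal_sup, stalkIdeal_pow]

theorem exists_isGluingChart_of_ne (h : IsMaximalReducibleDeformation sY sS π P X₁ X₂)
    [SmoothOfRelativeDimension 1 sS] (hP : IsClosed ({P} : Set S)) (p : ℕ) {x : X}
    (hxc : IsClosed ({x} : Set X)) (hxP : π x ≠ P) :
    ∃ e e' s l, IsGluingChart (stalkIdeal (reducedIdeal X₁) x) (stalkIdeal (reducedIdeal X₂) x)
      (stalkIdeal (infinitesimalIdeal π P X₁ X₂ p) x)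
      (stalkIdeal (reducedIdeal (intersectionCurve π P X₁ X₂)) x) e e' s l := by
  have : Smooth sS := SmoothOfRelativeDimension.smooth 1 sS
  have := h.isLocallyNoetherian
  have hz := h.isClosed_map hxc
  have hinf := stalkIdeal_inf_eq_bot h.inf_eq_bot x
  have hZ := h.stalkIdeal_intersectionCurve_eq_sup hP hxP
  have hJ : stalkIdeal (infinitesimalIdeal π P X₁ X₂ p) x = ⊤ := by
    rw [stalkIdeal_infinitesimalIdeal, stalkIdeal_fibreIdeal_of_ne π hP hxP, Ideal.top_pow,
      sup_top_eq]
  by_cases hx₁ : x ∈ X₁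
  · by_cases hx₂ : x ∈ X₂
    · obtain ⟨t, htm, ht⟩ := exists_stalkIdeal_fibreIdeal_eq sS π hz
      have hm := h.maximalIdeal_eq_sup hx₁ hx₂ hz hxP ht
      have hpow := h.pow_notMem_sup hx₁ hx₂ hz hxP ht
      obtain ⟨u₁, hm₁, -⟩ := h.family₁.exists_maximalIdeal_eq
        (mem_support_reducedIdeal.mpr hx₁) hxc hz rfl ht
      obtain ⟨u₂, hm₂, -⟩ := h.family₂.exists_maximalIdeal_eq
        (mem_support_reducedIdeal.mpr hx₂) hxc hz rfl ht
      obtain ⟨e, he, hsup⟩ := exists_sup_eq_sup_span hm₁ hm hpow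
      have he₂ := eq_span_of_sup_eq_sup_span he hsup hinf
      rw [sup_comm (stalkIdeal (reducedIdeal X₁) x)] at hm hpow
      rw [inf_comm] at hinf
      obtain ⟨e', he', hsup'⟩ := exists_sup_eq_sup_span hm₂ hm hpow
      have he₁ := eq_span_of_sup_eq_sup_span he' hsup' hinf
      rw [inf_comm] at hinf
      have hp₁ := h.isPrime_stalkIdeal hxc hx₁ hz ht htm
      have hp₂ := h.symm.isPrime_stalkIdeal hxc hx₂ hz ht htm
      refine ⟨e, e', 1, e + e', isGluingChart_one he₁ he₂ hinf hJ hZ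
        (isRegularMod_of_isPrime hp₁ fun hmem => h.stalkIdeal_ne_bot hx₁ ?_)
        (isRegularMod_of_isPrime hp₂ fun hmem => h.symm.stalkIdeal_ne_bot hx₂ ?_)⟩
      -- If `e + e' ∈ I₁` then `e ∈ I₁`, so `I₂ = (e)` is contained in `I₁` and equals `I₁ ∩ I₂ =
      -- 0`.
      · have h1 := (Submodule.add_mem_iff_left _ he').mp hmem
        rw [← hinf, eq_comm, inf_eq_right, he₂, Ideal.span_singleton_le_iff_mem]
        exact h1
      · have h1 := (Submodule.add_mem_iff_right _ he).mp hmem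
        rw [← hinf, eq_comm, inf_eq_left, he₁, Ideal.span_singleton_le_iff_mem]
        exact h1
    · exact exists_isGluingChart_of_eq_top hinf hJ hZ
        (.inr ((stalkIdeal_eq_top_iff _ x).mpr fun h => hx₂ (mem_support_reducedIdeal.mp h)))
  · exact exists_isGluingChart_of_eq_top hinf hJ hZ
      (.inl ((stalkIdeal_eq_top_iff _ x).mpr fun h => hx₁ (mem_support_reducedIdeal.mp h)))

theorem exists_isGluingChart_of_eq (h : IsMaximalReducibleDeformation sY sS π P X₁ X₂)
    [SmoothOfRelativeDimension 1 sS] (hY : IsPrimitiveDoubleCurve sY)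
    (hP : IsClosed ({P} : Set S)) {p : ℕ} (hp : IsContactExponent π P X₁ X₂ p) {x : X}
    (hxc : IsClosed ({x} : Set X)) (hx : π x = P) :
    ∃ e e' s l, IsGluingChart (stalkIdeal (reducedIdeal X₁) x) (stalkIdeal (reducedIdeal X₂) x)
      (stalkIdeal (infinitesimalIdeal π P X₁ X₂ p) x)
      (stalkIdeal (reducedIdeal (intersectionCurve π P X₁ X₂)) x) e e' s l := by
  have := h.isLocallyNoetherian
  have := h.jacobsonSpace
  obtain ⟨t, l, e, hs, hc⟩ := hp.exists_isContact h hY hP hxc hx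
  have hK₁ : (stalkIdeal (reducedIdeal X₁) x ⊔ Ideal.span {t}).IsPrime := hs.eq₁ ▸ hs.isPrime
  have hK₂ : (stalkIdeal (reducedIdeal X₂) x ⊔ Ideal.span {t}).IsPrime := hs.eq₂ ▸ hs.isPrime
  exact ⟨e, t ^ p * l - e, t ^ p, l,
    { eq₁ := hc.span_sub_eq hs.mem hs.isPrime hs.eq₁ hs.eq₂ hs.regular₁ hs.regular₂ hs.inf_eq_bot
        hs.ne_bot₁
      eq₂ := hc.span_eq hs.mem hs.eq₂ hs.regular₂
      inf := hs.inf_eq_bot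
      add := by ring
      glue := by rw [stalkIdeal_infinitesimalIdeal, hs.fibre_eq, Ideal.span_singleton_pow]
      center := by
        ext a
        rw [mem_stalkIdeal_intersectionCurve_iff hP (fun y hyc hy₁ hy₂ hyP =>
          h.isPrime_stalkIdeal_sup hyc hy₁ hy₂ hyP) hs.fibre_eq, stalkIdeal_sup]
        exact hc.exists_pow_mul_mem_iff hs.mem hs.isPrime hs.eq₁ hs.eq₂ hs.regular₁ hs.regular₂ a
      regular₁ := isRegularMod_of_isPrime (isPrime_of_isPrime_sup hs.mem hs.regular₁ hK₁)
        fun hl => hc.notMem (hs.eq₁ ▸ Ideal.mem_sup_left hl)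
      regular₂ := isRegularMod_of_isPrime (isPrime_of_isPrime_sup hs.mem hs.regular₂ hK₂)
        fun hl => hc.notMem (hs.eq₂ ▸ Ideal.mem_sup_left hl)
      regular := hs.regular₁.pow p }⟩

/-- The closure of any point contains a closed point, and an open neighbourhood of the latter
contains the former. So charts at closed points suffice. -/
theorem exists_affineOpens_isGluingChart (h : IsMaximalReducibleDeformation sY sS π P X₁ X₂)
    [SmoothOfRelativeDimension 1 sS] (hY : IsPrimitiveDoubleCurve sY)
    (hP : IsClosed ({P} : Set S)) {p : ℕ} (hp : IsContactExponent π P X₁ X₂ p) (x : X) :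
    ∃ U : X.affineOpens, x ∈ U.1 ∧ ∃ e e' s l, IsGluingChart ((reducedIdeal X₁).ideal U)
      ((reducedIdeal X₂).ideal U) ((infinitesimalIdeal π P X₁ X₂ p).ideal U)
      ((reducedIdeal (intersectionCurve π P X₁ X₂)).ideal U) e e' s l := by
  have := h.isLocallyNoetherian
  have := h.jacobsonSpace
  obtain ⟨y, hy, hyc⟩ := nonempty_inter_closedPoints (Z := closure {x})
    ⟨x, subset_closure rfl⟩ isClosed_closure.isLocallyClosed
  have hxy : x ⤳ y := specializes_iff_mem_closure.mpr hy
  obtain ⟨e, e', s, l, hchart⟩ : ∃ e e' s l, IsGluingChart (stalkIdeal (reducedIdeal X₁) y)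
      (stalkIdeal (reducedIdeal X₂) y) (stalkIdeal (infinitesimalIdeal π P X₁ X₂ p) y)
      (stalkIdeal (reducedIdeal (intersectionCurve π P X₁ X₂)) y) e e' s l := by
    by_cases hyP : π y = P
    · exact h.exists_isGluingChart_of_eq hY hP hp hyc hyP
    · exact h.exists_isGluingChart_of_ne hP p hyc hyP
  obtain ⟨U, hU⟩ := exists_affineOpens_mem y
  have : IsNoetherianRing Γ(X, U.1) := IsLocallyNoetherian.component_noetherian U
  let := X.presheaf.algebra_section_stalk ⟨y, hU⟩
  have := U.2.isLocalization_stalk ⟨y, hU⟩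
  simp only [stalkIdeal_eq_map _ U hU] at hchart
  obtain ⟨f, hf, hchart'⟩ := IsGluingChart.exists_away
    (IsAffineOpen.primeIdealOf U.2 ⟨y, hU⟩).asIdeal (X.presheaf.stalk y) hchart
  let := (X.presheaf.map (homOfLE (X.basicOpen_le f)).op).hom.toAlgebra
  have hloc : IsLocalization.Away f Γ(X, X.basicOpen f) := U.2.isLocalization_basicOpen f
  rw [mem_primeIdealOf_iff U hU, mem_maximalIdeal, mem_nonunits_iff, not_not] at hf
  refine ⟨X.affineBasicOpen f, hxy.mem_open (X.basicOpen f).2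
    ((Scheme.mem_basicOpen _ f y hU).mpr hf), ?_⟩
  have hmap : ∀ I : X.IdealSheafData, (I.ideal U).map (algebraMap Γ(X, U.1) Γ(X, X.basicOpen f)) =
      I.ideal (X.affineBasicOpen f) := fun I => I.map_ideal_basicOpen U f
  have h1 := hchart' Γ(X, X.basicOpen f)
  simp only [hmap] at h1
  exact h1 (congrArg (fun I : X.IdealSheafData => I.ideal (X.affineBasicOpen f)) h.inf_eq_bot)

end IsMaximalReducibleDeformation

end Charts

/-! ### Affine pieces of the glued scheme -/

section GluedCharts

open Scheme

variable {X : Scheme.{0}} {I₁ I₂ J : X.IdealSheafData} (h₁ : I₁ ≤ J) (h₂ : I₂ ≤ J)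

/-- The inclusion of the part of the glued scheme that lies over an affine open subset. -/
noncomputable def gluedSchemeChart (U : X.affineOpens) :
    Spec (CommRingCat.of (gluedRing (h₁ U) (h₂ U))) ⟶ gluedScheme h₁ h₂ :=
  (AffineZariskiSite.relativeGluingData (toGluedAlgebra_coequifibered h₁ h₂)).cover.f U

instance isOpenImmersion_gluedSchemeChart (U : X.affineOpens) :
    IsOpenImmersion (gluedSchemeChart h₁ h₂ U) :=
  (AffineZariskiSite.relativeGluingData (toGluedAlgebra_coequifibered h₁ h₂)).cover.map_prop U

theorem gluedSchemeChart_comp (U : X.affineOpens) :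
    gluedSchemeChart h₁ h₂ U ≫ gluedSchemeTo h₁ h₂ =
      Spec.map (CommRingCat.ofHom (toGluedRing (h₁ U) (h₂ U))) ≫ IsAffineOpen.fromSpec U.2 := by
  refine ((AffineZariskiSite.relativeGluingData
    (toGluedAlgebra_coequifibered h₁ h₂)).ι_toBase U).trans ?_
  change (Spec.map (CommRingCat.ofHom (toGluedRing (h₁ U) (h₂ U))) ≫
    (IsAffineOpen.isoSpec U.2).inv) ≫ U.1.ι = _
  rw [Category.assoc]
  rfl

theorem opensRange_gluedSchemeChart (U : X.affineOpens) :
    (gluedSchemeChart h₁ h₂ U).opensRange = gluedSchemeTo h₁ h₂ ⁻¹ᵁ U.1 := by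
  have h := (AffineZariskiSite.relativeGluingData
    (toGluedAlgebra_coequifibered h₁ h₂)).toBase_preimage_eq_opensRange_ι U
  have h1 : ((AffineZariskiSite.directedCover X).f U).opensRange = U.1 := Opens.opensRange_ι U.1
  rw [h1] at h
  exact h.symm

end GluedCharts

/-! ### The blowing-up property is local on the target -/

section BlowingUp

open Scheme

variable {X D T W : Scheme.{0}}

/-- The ideal sheaf is generated by a non zero divisor on the affine open subset `U`. -/
def IsPrincipalOn (I : X.IdealSheafData) (U : X.affineOpens) : Prop :=
  ∃ a ∈ nonZeroDivisors Γ(X, U.1), I.ideal U = Ideal.span {a}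

theorem IsPrincipalOn.exists_le {I : X.IdealSheafData} {U : X.affineOpens}
    (h : IsPrincipalOn I U) {x : X} (hx : x ∈ U.1) {V : X.Opens} (hV : x ∈ V) :
    ∃ W : X.affineOpens, x ∈ W.1 ∧ W.1 ≤ V ∧ IsPrincipalOn I W := by
  obtain ⟨a, ha, haI⟩ := h
  obtain ⟨f, hfV, hxf⟩ := IsAffineOpen.exists_basicOpen_le U.2 ⟨x, hV⟩ hx
  let := (X.presheaf.map (homOfLE (X.basicOpen_le f)).op).hom.toAlgebra
  have hloc : IsLocalization.Away f Γ(X, X.basicOpen f) := U.2.isLocalization_basicOpen f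
  have hI : (I.ideal U).map (algebraMap Γ(X, U.1) Γ(X, X.basicOpen f)) =
    I.ideal (X.affineBasicOpen f) := I.map_ideal_basicOpen U f
  refine ⟨X.affineBasicOpen f, hxf, hfV,
    (algebraMap Γ(X, U.1) Γ(X, X.basicOpen f) a : Γ(X, X.basicOpen f)), ?_, ?_⟩
  · exact IsLocalization.nonZeroDivisors_le_comap (Submonoid.powers f) Γ(X, X.basicOpen f) ha
  · rw [← hI, haI, Ideal.map_span, Set.image_singleton]
    rfl

theorem exists_eq_span_iff_of_ringEquiv {A B : Type*} [CommRing A] [CommRing B] (E : A ≃+* B)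
    (I : Ideal A) : (∃ a ∈ nonZeroDivisors A, I = Ideal.span {a}) ↔
      ∃ b ∈ nonZeroDivisors B, I.map (E : A →+* B) = Ideal.span {b} := by
  constructor
  · rintro ⟨a, ha, rfl⟩
    refine ⟨E a, ?_, by rw [Ideal.map_span, Set.image_singleton]; rfl⟩
    refine mem_nonZeroDivisors_of_injective (f := E.symm) E.symm.injective ?_
    rwa [E.symm_apply_apply]
  · rintro ⟨b, hb, hI⟩
    refine ⟨E.symm b, ?_, ?_⟩
    · refine mem_nonZeroDivisors_of_injective (f := E) E.injective ?_
      rwa [E.apply_symm_apply]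
    · rw [← Ideal.map_of_equiv (I := I) E, hI, Ideal.map_span, Set.image_singleton]
      rfl

theorem isPrincipalOn_comap_iff (I : X.IdealSheafData) (j : W ⟶ X) [IsOpenImmersion j]
    (U : W.affineOpens) (V : X.affineOpens) (hV : V.1 = j ''ᵁ U.1) :
    IsPrincipalOn (I.comap j) U ↔ IsPrincipalOn I V := by
  have e : U.1 ≤ j ⁻¹ᵁ V.1 := by rw [hV, j.preimage_image_eq]
  have hiso : IsIso (j.appLE V.1 U.1 e) := by
    obtain ⟨V, hVa⟩ := V
    subst hV
    rw [← Hom.appIso_hom']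
    infer_instance
  have hbij : Function.Bijective (j.appLE V.1 U.1 e).hom := ConcreteCategory.bijective_of_isIso _
  have hE := exists_eq_span_iff_of_ringEquiv (RingEquiv.ofBijective _ hbij) (I.ideal V)
  rw [IsPrincipalOn, ideal_comap_image I j U V hV e]
  exact hE.symm

theorem IsInvertibleIdeal.comap {I : X.IdealSheafData} (h : IsInvertibleIdeal I) (j : W ⟶ X)
    [IsOpenImmersion j] : IsInvertibleIdeal (I.comap j) := by
  intro w
  obtain ⟨U, hU, hI⟩ := h (j w)
  obtain ⟨V, hV, hVr, hIV⟩ := IsPrincipalOn.exists_le hI hU (V := j.opensRange) ⟨w, rfl⟩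
  have hVa : IsAffineOpen V.1 := V.2
  refine ⟨⟨j ⁻¹ᵁ V.1, hVa.preimage_of_isOpenImmersion j hVr⟩, hV,
    (isPrincipalOn_comap_iff I j _ V ?_).mpr hIV⟩
  change V.1 = j ''ᵁ (j ⁻¹ᵁ V.1)
  rw [j.image_preimage_eq_opensRange_inf, inf_eq_right.mpr hVr]

/-- The affine version of the blowing-up property, for a ring homomorphism and an ideal. -/
structure IsAffineBlowingUp {R B : Type} [CommRing R] [CommRing B] (φ : R →+* B) (Z : Ideal R) :
    Prop where
  exists_eq_span : ∃ a ∈ nonZeroDivisors B, Z.map φ = Ideal.span {a}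
  existsUnique_lift : ∀ {O : Type} [CommRing O] (θ : R →+* O),
    (∃ a ∈ nonZeroDivisors O, Z.map θ = Ideal.span {a}) → ∃! ψ : B →+* O, ψ.comp φ = θ

/-- An affine chart of `η : D ⟶ X` over `U` that is an affine blowing-up of the ideal `Z`. -/
structure IsBlowingUpChart (η : D ⟶ X) (Z : X.IdealSheafData) (U : X.affineOpens) {B : Type}
    [CommRing B] (φ : Γ(X, U.1) →+* B) (ι : Spec (CommRingCat.of B) ⟶ D) : Prop where
  isOpenImmersion : IsOpenImmersion ι
  opensRange_eq : ι.opensRange = η ⁻¹ᵁ U.1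
  comp_eq : ι ≫ η = Spec.map (CommRingCat.ofHom φ) ≫ IsAffineOpen.fromSpec U.2
  isAffineBlowingUp : IsAffineBlowingUp φ (Z.ideal U)

theorem isPrincipalOn_affineTop_iff {R : Type} [CommRing R] (Z : X.IdealSheafData)
    (U : X.affineOpens) (φ : Γ(X, U.1) →+* R) (f : Spec (CommRingCat.of R) ⟶ X)
    (hf : f = Spec.map (CommRingCat.ofHom φ) ≫ IsAffineOpen.fromSpec U.2) :
    IsPrincipalOn (Z.comap f) (affineTop _) ↔
      ∃ a ∈ nonZeroDivisors R, (Z.ideal U).map φ = Ideal.span {a} := by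
  have hUa : IsAffineOpen U.1 := U.2
  have hle : (affineTop (Spec (CommRingCat.of R))).1 ≤ f ⁻¹ᵁ U.1 := by
    intro y _
    have : f y ∈ Set.range hUa.fromSpec := by rw [hf]; exact ⟨_, rfl⟩
    rwa [hUa.range_fromSpec] at this
  have happ : f.appLE U.1 ⊤ hle = CommRingCat.ofHom φ ≫ (ΓSpecIso (CommRingCat.of R)).inv := by
    apply Spec.map_injective
    rw [← cancel_mono hUa.fromSpec, IsAffineOpen.SpecMap_appLE_fromSpec f hUa (isAffineOpen_top _),
      IsAffineOpen.fromSpec_top, isoSpec_Spec_inv, Spec.map_comp, Category.assoc]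
    exact congrArg _ hf
  have h1 := exists_eq_span_iff_of_ringEquiv
    (ΓSpecIso (CommRingCat.of R)).symm.commRingCatIsoToRingEquiv ((Z.ideal U).map φ)
  rw [IsPrincipalOn, ideal_comap Z f _ U hle, h1, Ideal.map_map]
  change (∃ a ∈ _, Ideal.map (f.appLE U.1 ⊤ hle).hom _ = _) ↔ _
  rw [happ]
  rfl

namespace IsBlowingUpChart

variable {η : D ⟶ X} {Z : X.IdealSheafData} {U : X.affineOpens} {B : Type} [CommRing B]
  {φ : Γ(X, U.1) →+* B} {ι : Spec (CommRingCat.of B) ⟶ D}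

theorem exists_isPrincipalOn (h : IsBlowingUpChart η Z U φ ι) {d : D} (hd : η d ∈ U.1) :
    ∃ V : D.affineOpens, d ∈ V.1 ∧ IsPrincipalOn (Z.comap η) V := by
  have := h.isOpenImmersion
  have hd' : d ∈ ι.opensRange := by rw [h.opensRange_eq]; exact hd
  refine ⟨⟨ι.opensRange, isAffineOpen_opensRange ι⟩, hd', ?_⟩
  refine (isPrincipalOn_comap_iff (Z.comap η) ι (affineTop _) _
    ι.image_top_eq_opensRange.symm).mp ?_
  rw [← IdealSheafData.comap_comp]
  exact (isPrincipalOn_affineTop_iff Z U φ (ι ≫ η) h.comp_eq).mpr h.isAffineBlowingUp.exists_eq_span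

theorem existsUnique_lift (h : IsBlowingUpChart η Z U φ ι) {f : T ⟶ X} {V : T.affineOpens}
    (hV : V.1 ≤ f ⁻¹ᵁ U.1) (hZ : IsPrincipalOn (Z.comap f) V) :
    ∃! g : Spec Γ(T, V.1) ⟶ D, g ≫ η = IsAffineOpen.fromSpec V.2 ≫ f := by
  have := h.isOpenImmersion
  have hUa : IsAffineOpen U.1 := U.2
  have hVa : IsAffineOpen V.1 := V.2
  have hfV := IsAffineOpen.SpecMap_appLE_fromSpec f hUa hVa hV
  rw [IsPrincipalOn, ideal_comap Z f V U hV] at hZ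
  obtain ⟨ψ, hψ, huniq⟩ := h.isAffineBlowingUp.existsUnique_lift (f.appLE U.1 V.1 hV).hom hZ
  refine ⟨Spec.map (CommRingCat.ofHom ψ) ≫ ι, ?_, fun g hg => ?_⟩
  · beta_reduce
    rw [Category.assoc, h.comp_eq, ← Spec.map_comp_assoc, ← CommRingCat.ofHom_comp, hψ]
    exact hfV
  -- Any lift lands in the preimage of `U`, which is the affine chart, so its uniqueness is that of
  -- a ring homomorphism.
  · have hrange : Set.range g ⊆ Set.range ι := by
      rintro _ ⟨y, rfl⟩
      change g y ∈ ι.opensRange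
      rw [h.opensRange_eq]
      change η (g y) ∈ U.1
      rw [← Scheme.Hom.comp_apply, hg]
      refine hV ?_
      have : hVa.fromSpec y ∈ Set.range hVa.fromSpec := ⟨y, rfl⟩
      rwa [hVa.range_fromSpec] at this
    rw [← IsOpenImmersion.lift_fac ι g hrange]
    congr 1
    obtain ⟨χ, hχ⟩ := Spec.map_surjective (IsOpenImmersion.lift ι g hrange)
    rw [← hχ]
    congr 1
    ext1
    refine huniq χ.hom ?_
    have h1 : Spec.map (CommRingCat.ofHom φ ≫ χ) ≫ hUa.fromSpec =
        Spec.map (f.appLE U.1 V.1 hV) ≫ hUa.fromSpec := by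
      rw [hfV, ← hg, ← IsOpenImmersion.lift_fac ι g hrange, ← hχ, Category.assoc, h.comp_eq,
        Spec.map_comp, Category.assoc]
    exact congrArg CommRingCat.Hom.hom (Spec.map_injective ((cancel_mono _).mp h1))

end IsBlowingUpChart

/-- Uniqueness is assumed for every source because it is applied to the overlaps of the cover, where
the inverse image ideal remains invertible. -/
theorem existsUnique_lift_of_openCover (η : D ⟶ X) (Z : X.IdealSheafData)
    (huniq : ∀ {T : Scheme.{0}} (f : T ⟶ X), IsInvertibleIdeal (Z.comap f) →
      ∀ g₁ g₂ : T ⟶ D, g₁ ≫ η = f → g₂ ≫ η = f → g₁ = g₂)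
    (f : T ⟶ X) (hf : IsInvertibleIdeal (Z.comap f)) (𝒰 : T.OpenCover)
    (g : ∀ i : 𝒰.I₀, 𝒰.X i ⟶ D) (hg : ∀ i, g i ≫ η = 𝒰.f i ≫ f) :
    ∃! g : T ⟶ D, g ≫ η = f := by
  have hglue : ∀ s t, pullback.fst (𝒰.f s) (𝒰.f t) ≫ g s = pullback.snd (𝒰.f s) (𝒰.f t) ≫ g t := by
    intro s t
    refine huniq (pullback.fst (𝒰.f s) (𝒰.f t) ≫ 𝒰.f s ≫ f) ?_ _ _ ?_ ?_
    · rw [← Category.assoc, IdealSheafData.comap_comp]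
      exact hf.comap _
    · rw [Category.assoc, hg s]
    · rw [Category.assoc, hg t, pullback.condition_assoc]
  have hlift : 𝒰.glueMorphisms g hglue ≫ η = f := by
    refine 𝒰.hom_ext _ _ fun t => ?_
    rw [Cover.ι_glueMorphisms_assoc]
    exact hg t
  exact ⟨𝒰.glueMorphisms g hglue, hlift, fun g' hg' => huniq f hf _ _ hg' hlift⟩

theorem isBlowingUp_of_charts (η : D ⟶ X) (Z : X.IdealSheafData)
    (h : ∀ x : X, ∃ U : X.affineOpens, x ∈ U.1 ∧ ∃ (B : Type) (_ : CommRing B)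
      (φ : Γ(X, U.1) →+* B) (ι : Spec (CommRingCat.of B) ⟶ D), IsBlowingUpChart η Z U φ ι) :
    IsBlowingUp η Z := by
  have hgood : ∀ {T : Scheme.{0}} (f : T ⟶ X), IsInvertibleIdeal (Z.comap f) → ∀ t : T,
      ∃ V : T.affineOpens, t ∈ V.1 ∧
        ∃! g : Spec Γ(T, V.1) ⟶ D, g ≫ η = IsAffineOpen.fromSpec V.2 ≫ f := by
    intro T f hf t
    obtain ⟨U, hU, B, _, φ, ι, hι⟩ := h (f t)
    obtain ⟨V₀, hV₀, hprin⟩ := hf t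
    obtain ⟨V, htV, hVU, hV⟩ := IsPrincipalOn.exists_le hprin hV₀ (V := f ⁻¹ᵁ U.1) hU
    exact ⟨V, htV, hι.existsUnique_lift hVU hV⟩
  -- Two lifts agree on a neighbourhood of every point; this must come before existence, since it
  -- makes the local lifts glue.
  have huniq : ∀ {T : Scheme.{0}} (f : T ⟶ X), IsInvertibleIdeal (Z.comap f) →
      ∀ g₁ g₂ : T ⟶ D, g₁ ≫ η = f → g₂ ≫ η = f → g₁ = g₂ := by
    intro T f hf g₁ g₂ hg₁ hg₂
    refine hom_ext_of_forall g₁ g₂ fun t => ?_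
    obtain ⟨V, htV, hV⟩ := hgood f hf t
    refine ⟨V.1, htV, ?_⟩
    have hVa : IsAffineOpen V.1 := V.2
    rw [← hVa.isoSpec_hom_fromSpec, Category.assoc, Category.assoc]
    congr 1
    exact hV.unique (by rw [Category.assoc, hg₁]) (by rw [Category.assoc, hg₂])
  refine ⟨fun d => ?_, fun T f hf => ?_⟩
  · obtain ⟨U, hU, B, _, φ, ι, hι⟩ := h (η d)
    exact hι.exists_isPrincipalOn hU
  · choose V hV hVg using fun t => hgood f hf t
    choose g hg using fun t => (hVg t).exists
    have hrange : ∀ t : T, ∃ y, IsAffineOpen.fromSpec (V t).2 y = t := by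
      intro t
      have hVa : IsAffineOpen (V t).1 := (V t).2
      have : t ∈ Set.range hVa.fromSpec := by
        rw [hVa.range_fromSpec]
        exact hV t
      exact this
    exact existsUnique_lift_of_openCover η Z huniq f hf
      (Cover.mkOfCovers T (fun t => Spec Γ(T, (V t).1)) (fun t => IsAffineOpen.fromSpec (V t).2)
        (fun t => ⟨t, hrange t⟩) (fun t => IsAffineOpen.isOpenImmersion_fromSpec (V t).2)) g hg

end BlowingUp

theorem IsGluingChart.isAffineBlowingUp {R : Type} [CommRing R] {I₁ I₂ J Z : Ideal R}
    {e e' s l : R} (h₁ : I₁ ≤ J) (h₂ : I₂ ≤ J) (h : IsGluingChart I₁ I₂ J Z e e' s l) :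
    IsAffineBlowingUp (toGluedRing h₁ h₂) Z where
  exists_eq_span := ⟨_, h.mem_nonZeroDivisors, h.map_center_eq⟩
  existsUnique_lift θ := fun ⟨_, ha, haZ⟩ => h.existsUnique_lift θ ha haZ

theorem isBlowingUp_gluedSchemeTo {X : Scheme.{0}} {I₁ I₂ J : X.IdealSheafData} (h₁ : I₁ ≤ J)
    (h₂ : I₂ ≤ J) (Z : X.IdealSheafData)
    (h : ∀ x : X, ∃ U : X.affineOpens, x ∈ U.1 ∧ ∃ e e' s l : Γ(X, U.1),
      IsGluingChart (I₁.ideal U) (I₂.ideal U) (J.ideal U) (Z.ideal U) e e' s l) :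
    IsBlowingUp (gluedSchemeTo h₁ h₂) Z := by
  refine isBlowingUp_of_charts _ Z fun x => ?_
  obtain ⟨U, hU, e, e', s, l, hc⟩ := h x
  exact ⟨U, hU, gluedRing (h₁ U) (h₂ U), inferInstance, toGluedRing (h₁ U) (h₂ U),
    gluedSchemeChart h₁ h₂ U, isOpenImmersion_gluedSchemeChart h₁ h₂ U,
    opensRange_gluedSchemeChart h₁ h₂ U, gluedSchemeChart_comp h₁ h₂ U,
    hc.isAffineBlowingUp (h₁ U) (h₂ U)⟩

end ReducibleDeformation

theorem proposition6p1p4 {Y X S : AlgebraicGeometry.Scheme.{0}}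
    (sY : Y ⟶ ReducibleDeformation.SpecC) (sS : S ⟶ ReducibleDeformation.SpecC)
    (π : X ⟶ S) (P : S) (X₁ X₂ : TopologicalSpace.Closeds X)
    (hY : ReducibleDeformation.IsPrimitiveDoubleCurve sY)
    (hS : ReducibleDeformation.IsSmoothConnectedCurve sS)
    (hP : IsClosed ({P} : Set S))
    (hX : ReducibleDeformation.IsMaximalReducibleDeformation sY sS π P X₁ X₂) :
    (∃! p : ℕ, ReducibleDeformation.IsContactExponent π P X₁ X₂ p) ∧
      ∀ p : ℕ, ReducibleDeformation.IsContactExponent π P X₁ X₂ p →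
        ReducibleDeformation.IsBlowingUp
          (ReducibleDeformation.associatedFragmentedTo π P X₁ X₂ p)
          (ReducibleDeformation.reducedIdeal
            (ReducibleDeformation.intersectionCurve π P X₁ X₂)) := by
  have := hS.smooth
  refine ⟨hX.existsUnique_isContactExponent hY hP, fun p hp => ?_⟩
  exact ReducibleDeformation.isBlowingUp_gluedSchemeTo _ _ _
    (hX.exists_affineOpens_isGluingChart hY hP hp)
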